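/- **Setting.** Let $S\subset\mathbb R^d$ be a domain (open, connected), $D\subset S$ compact, and $\mu$ a Radon measure on $S$. Let $K:S^2\to\mathbb C$ be a measurable, locally square integrable kernel with associated integral operator $\mathcal K$, and let $\mathcal K_C$ denote the integral operator with kernel $K$ on $L^2(C,\mu)$, for $C\subset S$ compact. Assume: * **(H1)** $K(x,y)=\overline{K(y,x)}$ for $\mu^{\otimes2}$-a.e. $(x,y)$; $\mathcal K$ extends to a bounded operator on $L^2(S,\mu)$ with spectrum contained in $[0,1)$; and for every compact $C\subset S$ the operator $\mathcal K_C$ is of trace class, i.e. it has an orthonormal basis of eigenfunctions $\varphi_j$ with absolutely summable eigenvalues $\lambda_j$. As usual $K$ is the proper version of the kernel: $K(x,y)=\sum_j\lambda_j\varphi_j(x)\overline{\varphi_j(y)}$ for a.e. $(x,y)\in C^2$ and, on the diagonal, for a.e. $x=y\in C$. * **(H2)** $\mu$ has a density $\rho$ with respect to Lebesgue measure on $S$ which is strictly positive and $C^1$ on $D$. * Let $J[D]$ be the (proper) kernel of $\mathcal J[D]=(\mathrm{Id}-\mathcal K_D)^{-1}\mathcal K_D$ on $L^2(D,\mu)$,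 i.e. $J[D](x,y)=\sum_j\frac{\lambda_j}{1-\lambda_j}\varphi_j(x)\overline{\varphi_j(y)}$ in the same sense, and $\det J[D](x_1,\dots,x_n)=\det(J[D](x_i,x_j))_{1\le i,j\le n}$. **(H3)** For every $n\ge1$ the function $\det J[D]$ is $C^1$ on $D^n$. * For all $n\ge1$, $1\le i,j\le n$, $1\le h,k\le d$, $$\int_{D^n}\left|\frac{\partial_{x_i^{(h)}}\det J[D]\;\partial_{x_j^{(k)}}\det J[D]}{\det J[D]}\right|\mathbf 1_{\{\det J[D]>0\}}\,d\mu^{\otimes n}<\infty .$$ Let $\mathbf X$ be a determinantal point process on $S$ with kernel $K$ with respect to $\mu$, i.e. a random locally finite subset of $S$ with $E[\prod_{i=1}^k\mathbf X(B_i)]=\int_{B_1\times\dots\times B_k}\det(K(x_i,x_j))\,d\mu^{\otimes k}$ for all disjoint Borel sets $B_1,\dots,B_k\subset S$, $k\ge1$. Let $P_D$ be the law of $\mathbf X^D=\mathbf X\cap D$ on the space $N_f^D$ of finite subsets of $D$, and $L^2_D=L^2(N_f^D,P_D)$ (real valued). Let $C^\infty(D^k)$ be the set of restrictions to $D^k$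 of smooth functions on $(\mathbb R^d)^k$, and likewise $C^\infty(D,\mathbb R^d)$. Let $\mathcal S_D$ be the set of functionals $F$ on $N_f^D$ of the form $F(\emptyset)=f_0\in\mathbb R$, $F(\{x_1,\dots,x_k\})=f_k(x_1,\dots,x_k)$ with $f_k\in C^\infty(D^k)$ symmetric and $f_k=0$ for all large $k$. For $v\in C^\infty(D,\mathbb R^d)$ and $\mathbf x=\{x_1,\dots,x_k\}\in N_f^D$ put $$\nabla_vF(\mathbf x)=\sum_{i=1}^k\nabla_{x_i}f_k(x_1,\dots,x_k)\cdot v(x_i),\qquad \nabla_vU[D](\mathbf x)=-\sum_{i=1}^k\frac{\nabla_{x_i}\det J[D](x_1,\dots,x_k)}{\det J[D](x_1,\dots,x_k)}\cdot v(x_i),$$ $$B_v^\mu(\mathbf x)=\sum_{i=1}^k\Big(-\frac{\nabla\rho(x_i)}{\rho(x_i)}\cdot v(x_i)+\operatorname{div}v(x_i)\Big),\qquad \operatorname{div}v:=-\sum_{j=1}^d\partial_jv^{(j)}$$ (so that $\operatorname{div}$ is the formal adjoint of the gradient), and $$\nabla_v^*G=-\nabla_vG+G\,\big(B_v^\mu+\nabla_vU[D]\big).$$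 We say that the flow of $v$ preserves $D$ if through every point of $D$ passes an integral curve of $v$ which is defined for all times $t\in\mathbb R$ and stays in $D$ (this holds for instance if $v$ is supported in the interior of $D$). **Theorem.** For every $v\in C^\infty(D,\mathbb R^d)$: (i) $\mathcal S_D\subset L^2_D$, $\nabla_v(\mathcal S_D)\subset L^2_D$ and $\nabla_v^*(\mathcal S_D)\subset L^2_D$, and $\nabla_v$, $\nabla_v^*$ are well-defined linear operators in $L^2_D$ with domain $\mathcal S_D$ (the $P_D$-class of $F\in\mathcal S_D$ determines those of $\nabla_vF$ and $\nabla_v^*F$). If the flow of $v$ preserves $D$, or if the boundary of $D$ is Lebesgue-null, then $\nabla_v$ and $\nabla_v^*$ are closable. (ii) If the flow of $v$ preserves $D$, then $$E\big[\mathbf G\,\overline{\nabla_v}\mathbf F\big]=E\big[\mathbf F\,\overline{\nabla_v^*}\mathbf G\big]$$ for all $\mathbf F\in\mathrm{Dom}(\overline{\nabla_v})$ and $\mathbf G\in\mathrm{Dom}(\overline{\nabla_v^*})$, where $\overline A$ denotes the minimal closed extension of $A$. -/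

import Mathlib

open MeasureTheory Set Function
open scoped ENNReal ComplexConjugate

namespace DPP

/-- The Euclidean space `ℝ^d`. -/
abbrev Sp (d : ℕ) : Type := EuclideanSpace ℝ (Fin d)

section Configurations

variable {d : ℕ}

/-- `N_lf`: the locally finite point configurations on `S`. -/
def LocFinConf (S : Set (Sp d)) : Type :=
  {B : Set (Sp d) // B ⊆ S ∧ ∀ C : Set (Sp d), C ⊆ S → IsCompact C → (B ∩ C).Finite}

/-- The sigma-field on `N_lf` generated by the counts of points in compact sets. -/
instance (S : Set (Sp d)) : MeasurableSpace (LocFinConf S) :=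
  MeasurableSpace.generateFrom
    {A | ∃ (C : Set (Sp d)) (m : ℕ), C ⊆ S ∧ IsCompact C ∧
      A = {B : LocFinConf S | (B.1 ∩ C).ncard = m}}

/-- `N_f^D`: the finite point configurations on `D`. -/
def FinConf (D : Set (Sp d)) : Type := {B : Finset (Sp d) // (B : Set (Sp d)) ⊆ D}

/-- The sigma-field on `N_f^D` generated by the counts of points in compact sets. -/
instance (D : Set (Sp d)) : MeasurableSpace (FinConf D) :=
  MeasurableSpace.generateFrom
    {A | ∃ (C : Set (Sp d)) (m : ℕ), C ⊆ D ∧ IsCompact C ∧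
      A = {B : FinConf D | ((B.1 : Set (Sp d)) ∩ C).ncard = m}}

/-- The restriction `B ↦ B ∩ D` of a locally finite configuration to a compact set `D ⊆ S`. -/
noncomputable def LocFinConf.restrict {S D : Set (Sp d)} (hD : IsCompact D) (hDS : D ⊆ S)
    (B : LocFinConf S) : FinConf D :=
  ⟨(B.2.2 D hDS hD).toFinset, by
    rw [Set.Finite.coe_toFinset]; exact Set.inter_subset_right⟩

theorem LocFinConf.measurable_restrict {S D : Set (Sp d)} (hD : IsCompact D) (hDS : D ⊆ S) :
    Measurable (LocFinConf.restrict hD hDS) := by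
  refine measurable_generateFrom ?_
  rintro A ⟨C, m, hCD, hC, rfl⟩
  refine MeasurableSpace.measurableSet_generateFrom ⟨C, m, hCD.trans hDS, hC, ?_⟩
  ext B
  have h : ((LocFinConf.restrict hD hDS B).1 : Set (Sp d)) ∩ C = B.1 ∩ C := by
    simp only [LocFinConf.restrict, Set.Finite.coe_toFinset]
    rw [Set.inter_assoc, Set.inter_eq_right.2 hCD]
  simp only [Set.mem_preimage, Set.mem_ofPred_eq, h]

/-- The law `P_D` of the restriction `X^D = X ∩ D` of the point process `X`. -/
noncomputable def lawD {S D : Set (Sp d)} (hD : IsCompact D) (hDS : D ⊆ S)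
    {Ω : Type*} [MeasurableSpace Ω] (P : Measure Ω) (X : Ω → LocFinConf S) :
    Measure (FinConf D) :=
  P.map (fun ω => LocFinConf.restrict hD hDS (X ω))

/-- An enumeration of the points of a finite configuration. -/
noncomputable def FinConf.pts {D : Set (Sp d)} (B : FinConf D) : Fin B.1.card → Sp d :=
  fun i => (B.1.equivFin.symm i : Sp d)

/-- The function on `N_f^D` equal to `g k (x_1, …, x_k)` at a configuration
`{x_1, …, x_k}` of `k` points. It is meant for `g k` symmetric. -/
noncomputable def evalConf (D : Set (Sp d)) (g : ∀ k : ℕ, (Fin k → Sp d) → ℝ) :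
    FinConf D → ℝ :=
  fun B => g B.1.card B.pts

/-- The product `D^n`. -/
def cube (D : Set (Sp d)) (n : ℕ) : Set (Fin n → Sp d) := {x | ∀ i, x i ∈ D}

end Configurations

section Kernels

variable {d : ℕ}

/-- `T` is the integral operator on `L²(ν)` with kernel `k`. -/
def IsIntegralOperator (ν : Measure (Sp d)) (k : Sp d → Sp d → ℂ)
    (T : Lp ℂ 2 ν →L[ℂ] Lp ℂ 2 ν) : Prop :=
  ∀ f : Lp ℂ 2 ν, (T f : Sp d → ℂ) =ᵐ[ν] fun x => ∫ y, k x y * f y ∂ν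

/-- `T` is of trace class with kernel `k`, and `k` is a proper version of the kernel:
`T` has an orthonormal basis of eigenfunctions `φ_i`, with absolutely summable
eigenvalues `λ_i`, and `k(x,y) = ∑ λ_i φ_i(x) conj (φ_i(y))` for almost all `(x,y)`
and also, on the diagonal, for almost all `x = y`. -/
def IsProperTraceClass (ν : Measure (Sp d)) (k : Sp d → Sp d → ℂ)
    (T : Lp ℂ 2 ν →L[ℂ] Lp ℂ 2 ν) : Prop :=
  IsIntegralOperator ν k T ∧
  ∃ (ι : Type) (_ : Countable ι) (φ : HilbertBasis ι ℂ (Lp ℂ 2 ν)) (l : ι → ℝ),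
    (∀ i, T (φ i) = (l i : ℂ) • φ i) ∧
    Summable (fun i => |l i|) ∧
    (∀ᵐ p ∂(ν.prod ν),
      HasSum (fun i => (l i : ℂ) * φ i p.1 * conj (φ i p.2)) (k p.1 p.2)) ∧
    (∀ᵐ x ∂ν, HasSum (fun i => (l i : ℂ) * φ i x * conj (φ i x)) (k x x))

/-- Hypothesis (H1): the kernel `K` is measurable, locally square integrable and Hermitian;
the operator `f ↦ ∫ K(·,y) f(y) μ(dy)`, given on the square integrable functions that vanish
outside a compact set, is (the restriction of) a bounded operator on `L²(S, μ)` with spectrum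
in `[0,1)`; and its compressions to compact sets are of trace class (with a proper kernel). -/
structure HypH1 (S : Set (Sp d)) (μ : Measure (Sp d)) (K : Sp d → Sp d → ℂ) : Prop where
  measurable : Measurable (uncurry K)
  locSqIntegrable : ∀ C : Set (Sp d), C ⊆ S → IsCompact C →
    ∫⁻ p in C ×ˢ C, ‖K p.1 p.2‖ₑ ^ 2 ∂(μ.prod μ) < ∞
  hermitian : ∀ᵐ p ∂(μ.prod μ), K p.1 p.2 = conj (K p.2 p.1)
  spectrum_subset : ∃ T : Lp ℂ 2 μ →L[ℂ] Lp ℂ 2 μ,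
    (∀ f : Lp ℂ 2 μ,
      (∃ C : Set (Sp d), C ⊆ S ∧ IsCompact C ∧ ∀ᵐ x ∂μ, x ∉ C → f x = 0) →
      (T f : Sp d → ℂ) =ᵐ[μ] fun x => ∫ y, K x y * f y ∂μ) ∧
    spectrum ℂ T ⊆ (fun r : ℝ => (r : ℂ)) '' Set.Ico 0 1
  locTraceClass : ∀ C : Set (Sp d), C ⊆ S → IsCompact C →
    ∃ T : Lp ℂ 2 (μ.restrict C) →L[ℂ] Lp ℂ 2 (μ.restrict C),
      IsProperTraceClass (μ.restrict C) K T

/-- `J` is the kernel `J[D]` of the local interaction operator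
`𝒥[D] = (Id - 𝒦_D)⁻¹ 𝒦_D` on `L²(D, μ)`, where `𝒦_D` is the integral operator with kernel `K`
on `L²(D, μ)`. -/
def IsInteractionKernel (D : Set (Sp d)) (μ : Measure (Sp d)) (K J : Sp d → Sp d → ℂ) : Prop :=
  Measurable (uncurry J) ∧
  ∃ T : Lp ℂ 2 (μ.restrict D) →L[ℂ] Lp ℂ 2 (μ.restrict D),
    IsIntegralOperator (μ.restrict D) K T ∧
    IsProperTraceClass (μ.restrict D) J (Ring.inverse (1 - T) * T)

/-- The determinant `det (k(x_i, x_j))_{i,j}` (real for a Hermitian kernel). -/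
noncomputable def kdet (k : Sp d → Sp d → ℂ) (n : ℕ) (x : Fin n → Sp d) : ℝ :=
  (Matrix.det (Matrix.of fun i j => k (x i) (x j))).re

/-- `X` is a determinantal point process on `S` with kernel `K` with respect to `μ`: for
disjoint `B_1, …, B_k`, the expectation of `∏ X(B_i)` is the integral of
`det (K(x_i, x_j))` over `B_1 × ⋯ × B_k`. -/
def IsDeterminantal (S : Set (Sp d)) (μ : Measure (Sp d)) (K : Sp d → Sp d → ℂ)
    {Ω : Type*} [MeasurableSpace Ω] (P : Measure Ω) (X : Ω → LocFinConf S) : Prop :=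
  Measurable X ∧
  ∀ (k : ℕ) (B : Fin k → Set (Sp d)), 1 ≤ k → (∀ i, MeasurableSet (B i)) → (∀ i, B i ⊆ S) →
    Pairwise (Disjoint on B) →
    ∫⁻ ω, ∏ i, (((X ω).1 ∩ B i).encard : ℝ≥0∞) ∂P =
      ∫⁻ x in Set.univ.pi B, ENNReal.ofReal (kdet K k x) ∂(Measure.pi fun _ : Fin k => μ)

end Kernels

section Calculus

variable {d : ℕ}

/-- Hypothesis (H2): `μ` has the Lebesgue density `ρ` on `S`, which is strictly positive and
continuously differentiable on `D`. -/
structure HypH2 (S D : Set (Sp d)) (μ : Measure (Sp d)) (ρ : Sp d → ℝ) : Prop where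
  measurable : Measurable ρ
  density : μ = (volume.restrict S).withDensity fun x => ENNReal.ofReal (ρ x)
  pos : ∀ x ∈ D, 0 < ρ x
  contDiffOn : ContDiffOn ℝ 1 ρ D

/-- Hypothesis (H3): `det J[D]` is continuously differentiable on `D^n`, for all `n ≥ 1`. -/
def HypH3 (D : Set (Sp d)) (J : Sp d → Sp d → ℂ) : Prop :=
  ∀ n : ℕ, 1 ≤ n → ContDiffOn ℝ 1 (kdet J n) (cube D n)

/-- The partial derivative of `det J[D](x_1, …, x_n)` with respect to the `h`-th coordinate
of `x_i`. -/
noncomputable def partialDet (D : Set (Sp d)) (J : Sp d → Sp d → ℂ) (n : ℕ) (i : Fin n)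
    (h : Fin d) (x : Fin n → Sp d) : ℝ :=
  fderivWithin ℝ (kdet J n) (cube D n) x (Pi.single i (EuclideanSpace.single h (1 : ℝ)))

/-- The integrability condition on `∂ det J[D] · ∂ det J[D] / det J[D]` on the set where
`det J[D] > 0`. -/
def IntegrabilityCondition (D : Set (Sp d)) (μ : Measure (Sp d)) (J : Sp d → Sp d → ℂ) : Prop :=
  ∀ (n : ℕ), 1 ≤ n → ∀ (i j : Fin n) (h k : Fin d),
    ∫⁻ x in {x | x ∈ cube D n ∧ 0 < kdet J n x},
      ‖partialDet D J n i h x * partialDet D J n j k x / kdet J n x‖ₑ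
        ∂(Measure.pi fun _ : Fin n => μ) < ∞

/-- The data `f_0, f_1, …, f_n` of a functional in `S_D`: symmetric smooth functions `f_k` of
`k` points, vanishing for `k` large. Only their restrictions to `D^k` matter, i.e. the
functions in `C^∞(D^k)` are the restrictions to `D^k` of smooth functions. -/
structure TestFunctional (d : ℕ) where
  coeff : ∀ k : ℕ, (Fin k → Sp d) → ℝ
  deg : ℕ
  smooth : ∀ k, ContDiff ℝ ((⊤ : ℕ∞) : WithTop ℕ∞) (coeff k)
  symm : ∀ (k : ℕ) (σ : Equiv.Perm (Fin k)) (x : Fin k → Sp d), coeff k (x ∘ σ) = coeff k x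
  vanish : ∀ k, deg < k → coeff k = 0

/-- The functional `F(x) = f_k(x_1, …, x_k)` on `N_f^D`. -/
noncomputable def TestFunctional.eval (D : Set (Sp d)) (F : TestFunctional d) : FinConf D → ℝ :=
  evalConf D F.coeff

/-- `∇_v F = ∑_i ∇_{x_i} f_k(x_1, …, x_k) · v(x_i)`. -/
noncomputable def TestFunctional.grad (D : Set (Sp d)) (v : Sp d → Sp d)
    (F : TestFunctional d) : FinConf D → ℝ :=
  evalConf D fun k x => ∑ i : Fin k, fderiv ℝ (F.coeff k) x (Pi.single i (v (x i)))

/-- `∇_v U[D] = - ∑_i (∇_{x_i} det J[D](x_1, …, x_k) / det J[D](x_1, …, x_k)) · v(x_i)`. -/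
noncomputable def gradU (D : Set (Sp d)) (J : Sp d → Sp d → ℂ) (v : Sp d → Sp d) :
    FinConf D → ℝ :=
  evalConf D fun k x => - ∑ i : Fin k,
    fderivWithin ℝ (kdet J k) (cube D k) x (Pi.single i (v (x i))) / kdet J k x

/-- The vector field `β^μ = ∇ρ / ρ` on `D`. -/
noncomputable def betaMu (D : Set (Sp d)) (ρ : Sp d → ℝ) (x : Sp d) : Sp d :=
  (ρ x)⁻¹ • gradientWithin ρ D x

/-- The formal adjoint of the gradient, `div v = - ∑_j ∂_j v_j`. -/
noncomputable def adjDiv (v : Sp d → Sp d) (x : Sp d) : ℝ :=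
  - ∑ j : Fin d, (fderiv ℝ v x (EuclideanSpace.single j (1 : ℝ))) j

/-- `B_v^μ = ∑_i (- β^μ(x_i) · v(x_i) + div v(x_i))`, where `div` is the adjoint of `∇`. -/
noncomputable def driftB (D : Set (Sp d)) (ρ : Sp d → ℝ) (v : Sp d → Sp d) : FinConf D → ℝ :=
  evalConf D fun k x => ∑ i : Fin k, (- inner ℝ (betaMu D ρ (x i)) (v (x i)) + adjDiv v (x i))

/-- `∇_v^* G = - ∇_v G + G (B_v^μ + ∇_v U[D])`. -/
noncomputable def TestFunctional.gradStar (D : Set (Sp d)) (ρ : Sp d → ℝ)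
    (J : Sp d → Sp d → ℂ) (v : Sp d → Sp d) (G : TestFunctional d) : FinConf D → ℝ :=
  fun B => - G.grad D v B + G.eval D B * (driftB D ρ v B + gradU D J v B)

/-- The flow of `v` maps `D` into itself: through each point of `D` passes an integral curve
of `v` that is defined for all times and stays in `D`. -/
def FlowPreserves (D : Set (Sp d)) (v : Sp d → Sp d) : Prop :=
  ∀ x ∈ D, ∃ γ : ℝ → Sp d, γ 0 = x ∧ ∀ t : ℝ, HasDerivAt γ (v (γ t)) t ∧ γ t ∈ D

/-- `A` is the linear operator in `L²(ν)` with domain `S_D` and `A F = op F` for `F ∈ S_D`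
(so `op F` depends, almost everywhere, only on the `ν`-class of `F`). -/
def IsOperatorOnTests {D : Set (Sp d)} (ν : Measure (FinConf D))
    (op : TestFunctional d → FinConf D → ℝ) (A : Lp ℝ 2 ν →ₗ.[ℝ] Lp ℝ 2 ν) : Prop :=
  ∀ p : Lp ℝ 2 ν × Lp ℝ 2 ν, p ∈ A.graph ↔
    ∃ F : TestFunctional d, p.1 =ᵐ[ν] F.eval D ∧ p.2 =ᵐ[ν] op F

end Calculus

end DPP

open DPP

/-!
The law of `X ∩ D` is explicit: its part on the configurations of `n` points is the image of a
measure on ordered `n`-tuples with the Lebesgue density `c_n det J[D](x_1, …, x_n) ρ(x_1) ⋯ ρ(x_n)`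
on `D^n`. Given this, `∇_v^*` is minus the divergence of the field `(v(x_1), …, v(x_n))`, weighted
by this density, so that the theorem reduces to integration by parts on `D^n` for each `n`.

*The law* (`exists_lawD_eq_sum`). The operator `𝒦` is positive and of norm less than one, so the
eigenfunctions of `𝒥[D]` have eigenvalues `q_i ≥ 0` and expand the proper versions of both `J` and
`K`, the latter with the eigenvalues `q_i / (1 + q_i)` (`exists_common_eigenbasis`). By the
Cauchy–Binet formula, the determinants are superpositions of squared Slater determinants, from which
points can be integrated out one at a time. The resulting moments over disjoint sets of the law with
the above densities are those of the determinantal process (`lintegral_prod_num_janossyLaw`). The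
law has a finite exponential moment, and therefore is determined by these moments
(`SameDisjointMoments.eq`).

*Integration by parts* (`integral_mul_adjoint_eq`). The set `D` may be arbitrarily irregular. If the
flow of `v` preserves `D`, the flow `φ_t` of the product field is a bi-Lipschitz bijection of `D^n`,
and by Rademacher's theorem `∫ h = ∫ h(φ_t) |det Dφ_t|` over `D^n`. The derivative at `t = 0` is the
divergence theorem (`IsFlowOn.integral_deriv_add_trace`). For functions with compact support in the
interior of `D^n` the classical divergence theorem applies. On the set where the determinant
vanishes, its derivative vanishes too, at almost every point: almost every point of a measurable set
is a density point, where derivatives within the set are unique (`ae_uniqueDiffWithinAt`).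

*The operators*. Square integrability of the logarithmic derivatives of the determinants is the
integrability condition. The operators are well-defined on classes, because a function that vanishes
almost everywhere for the law on `n`-tuples has zero derivative almost everywhere for it
(`ae_fderiv_eq_zero`). For closability (`IsTestOperator.isClosable`), pull limits back to ordered
tuples and pair them with smooth functions which need not be symmetric: these have compact support,
in the interior of `D^n` when only the boundary is known to be negligible. The duality on test
functionals extends to the closures by continuity of the inner product
(`IsTestOperator.integral_closure_eq`).
-/

namespace DPP
open Filter Topology Metric
open scoped Pointwise

/-! ### Density points and tangent cones -/
section Density

variable {E : Type*} [NormedAddCommGroup E] [NormedSpace ℝ E] [FiniteDimensional ℝ E]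
  [MeasurableSpace E] [BorelSpace E]

/-- At a Lebesgue density point of `s`, every direction is tangent to `s`. -/
theorem ae_tangentConeAt_eq_univ (μ : Measure E) [μ.IsAddHaarMeasure] {s : Set E}
    (hs : MeasurableSet s) : ∀ᵐ x ∂μ.restrict s, tangentConeAt ℝ s x = univ := by
  filter_upwards [Besicovitch.ae_tendsto_measure_inter_div μ s, ae_restrict_mem hs] with x hx hxs
  refine eq_univ_of_forall fun z => ?_
  have B : ∀ n : ℕ, ∃ r : ℝ, 0 < r ∧ r < 1 / ((n : ℝ) + 1) ∧
      ∃ a ∈ closedBall z (1 / ((n : ℝ) + 1)), x + r • a ∈ s := by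
    intro n
    have hn : (0 : ℝ) < 1 / ((n : ℝ) + 1) := by positivity
    have B₁ := Measure.eventually_nonempty_inter_smul_of_density_one μ s x hx
      (closedBall z (1 / ((n : ℝ) + 1))) measurableSet_closedBall
      (measure_closedBall_pos μ z hn).ne'
    have B₂ : ∀ᶠ r in 𝓝[>] (0 : ℝ), r < 1 / ((n : ℝ) + 1) :=
      nhdsWithin_le_nhds (Iio_mem_nhds hn)
    obtain ⟨r, ⟨y, hys, hy⟩, hr, hr0⟩ := (B₁.and (B₂.and self_mem_nhdsWithin)).exists
    simp only [singleton_add, image_add_left, mem_preimage, mem_smul_set] at hy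
    obtain ⟨a, ha, hay⟩ := hy
    refine ⟨r, hr0, hr, a, ha, ?_⟩
    rw [hay]; simpa using hys
  choose r hr0 hr a ha has using B
  have lim : Tendsto (fun n : ℕ => 1 / ((n : ℝ) + 1)) atTop (𝓝 0) :=
    tendsto_one_div_add_atTop_nhds_zero_nat
  have ha' : Tendsto a atTop (𝓝 z) := by
    rw [tendsto_iff_dist_tendsto_zero]
    exact squeeze_zero (fun _ => dist_nonneg) (fun n => mem_closedBall.1 (ha n)) lim
  have hr' : Tendsto r atTop (𝓝 0) := squeeze_zero (fun n => (hr0 n).le) (fun n => (hr n).le) lim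
  refine mem_tangentConeAt_of_seq atTop (fun n => (r n)⁻¹) (fun n => r n • a n) ?_
    (Eventually.of_forall has) ?_
  · simpa using hr'.smul ha'
  · refine ha'.congr fun n => ?_
    rw [smul_smul, inv_mul_cancel₀ (hr0 n).ne', one_smul]

/-- Without any regularity of `s`, derivatives within `s` are unique at almost every point. -/
theorem ae_uniqueDiffWithinAt (μ : Measure E) [μ.IsAddHaarMeasure] {s : Set E}
    (hs : MeasurableSet s) : ∀ᵐ x ∂μ.restrict s, UniqueDiffWithinAt ℝ s x := by
  filter_upwards [ae_tangentConeAt_eq_univ μ hs, ae_restrict_mem hs] with x hx hxs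
  exact ⟨by rw [hx]; simp, subset_closure hxs⟩

/-- A function that is differentiable within `t` and vanishes on `s ⊆ t` has zero derivative at
almost every point of `s`. -/
theorem ae_fderivWithin_eq_zero_of_eq_zero (μ : Measure E) [μ.IsAddHaarMeasure] {s t : Set E}
    (hs : MeasurableSet s) (hst : s ⊆ t) {f : E → ℝ} (hf : DifferentiableOn ℝ f t)
    (h0 : ∀ x ∈ s, f x = 0) : ∀ᵐ x ∂μ.restrict s, fderivWithin ℝ f t x = 0 := by
  filter_upwards [ae_uniqueDiffWithinAt μ hs, ae_restrict_mem hs] with x hx hxs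
  have h1 : HasFDerivWithinAt f (fderivWithin ℝ f t x) s x :=
    (hf x (hst hxs)).hasFDerivWithinAt.mono hst
  have h2 : HasFDerivWithinAt f (0 : E →L[ℝ] ℝ) s x :=
    (hasFDerivWithinAt_const (0 : ℝ) x s).congr h0 (h0 x hxs)
  exact hx.eq h1 h2

end Density

/-! ### The derivative of the determinant -/
section Determinant

variable {E : Type*} [NormedAddCommGroup E] [NormedSpace ℝ E] [FiniteDimensional ℝ E]

/-- The trace of an endomorphism, as a continuous linear form. -/
noncomputable def traceCLM (E : Type*) [NormedAddCommGroup E] [NormedSpace ℝ E]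
    [FiniteDimensional ℝ E] : (E →L[ℝ] E) →L[ℝ] ℝ :=
  LinearMap.toContinuousLinearMap
    ((LinearMap.trace ℝ E).comp (ContinuousLinearMap.coeLM ℝ))

theorem traceCLM_apply (A : E →L[ℝ] E) : traceCLM E A = LinearMap.trace ℝ E (A : E →ₗ[ℝ] E) := rfl

/-- The derivative of the determinant at the identity is the trace. -/
theorem hasFDerivAt_det_one_add :
    HasFDerivAt (fun B : E →L[ℝ] E => (1 + B).det) (traceCLM E) 0 := by
  classical
  set b := Module.finBasis ℝ E
  have hdet : ∀ B : E →L[ℝ] E, (1 + B).det =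
      (1 + LinearMap.toMatrix b b (B : E →ₗ[ℝ] E)).det := by
    intro B
    rw [ContinuousLinearMap.det, ← LinearMap.det_toMatrix b]
    congr 1
    rw [ContinuousLinearMap.toLinearMap_add, map_add]
    congr 1
    exact LinearMap.toMatrix_one b
  have hd : DifferentiableAt ℝ (fun B : E →L[ℝ] E => (1 + B).det) 0 := by
    simp only [hdet, Matrix.det_apply]
    have hentry : ∀ i j, Differentiable ℝ (fun B : E →L[ℝ] E =>
        (1 + LinearMap.toMatrix b b (B : E →ₗ[ℝ] E)) i j) := by
      intro i j
      simp only [Matrix.add_apply, LinearMap.toMatrix_apply]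
      refine (differentiable_const _).add ?_
      have : (fun B : E →L[ℝ] E => (b.repr ((B : E →ₗ[ℝ] E) (b j))) i) = fun B =>
        ((LinearMap.toContinuousLinearMap (b.coord i)).comp
          (ContinuousLinearMap.apply ℝ E (b j))) B := rfl
      rw [this]
      exact ContinuousLinearMap.differentiable _
    refine DifferentiableAt.fun_sum fun σ _ => ?_
    refine DifferentiableAt.const_smul ?_ _
    exact (HasFDerivAt.finsetProd (u := Finset.univ)
      fun i _ => (hentry (σ i) i 0).hasFDerivAt).differentiableAt
  convert! hd.hasFDerivAt using 1
  ext B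
  -- along a line through `0`, the linear coefficient of `det (1 + t B)` is the trace
  have hline : HasDerivAt (fun t : ℝ => (1 + t • B).det) (LinearMap.trace ℝ E (B : E →ₗ[ℝ] E)) 0 := by
    have : (fun t : ℝ => (1 + t • B).det) = fun t : ℝ =>
        1 + (LinearMap.toMatrix b b (B : E →ₗ[ℝ] E)).trace * t +
          ((Matrix.det (1 + (Polynomial.X : Polynomial ℝ) •
            (LinearMap.toMatrix b b (B : E →ₗ[ℝ] E)).map Polynomial.C)).divX.divX.eval t) * t ^ 2 := by
      funext t
      rw [hdet, ContinuousLinearMap.toLinearMap_smul, map_smul, Matrix.det_one_add_smul]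
    rw [this, LinearMap.trace_eq_matrix_trace ℝ b]
    have h1 := ((hasDerivAt_id (0 : ℝ)).const_mul
      (LinearMap.toMatrix b b (B : E →ₗ[ℝ] E)).trace).const_add 1
    have h2 := ((Matrix.det (1 + (Polynomial.X : Polynomial ℝ) •
            (LinearMap.toMatrix b b (B : E →ₗ[ℝ] E)).map Polynomial.C)).divX.divX.hasDerivAt 0).mul
            ((hasDerivAt_id (0 : ℝ)).pow 2)
    have h3 := h1.add h2
    convert! h3 using 1
    simp
  have hline2 : HasDerivAt (fun t : ℝ => (1 + t • B).det)
      (fderiv ℝ (fun B : E →L[ℝ] E => (1 + B).det) 0 B) 0 := by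
    have hs : HasDerivAt (fun t : ℝ => t • B) B 0 := by
      simpa using (hasDerivAt_id (0 : ℝ)).smul_const B
    have hd' : HasFDerivAt (fun B : E →L[ℝ] E => (1 + B).det)
      (fderiv ℝ (fun B : E →L[ℝ] E => (1 + B).det) 0) ((fun t : ℝ => t • B) 0) := by
      simpa using hd.hasFDerivAt
    exact hd'.comp_hasDerivAt (0 : ℝ) hs
  exact hline.unique hline2

end Determinant

/-! ### The divergence theorem for compactly supported functions -/
section IntegrationByParts

variable {E : Type*} [NormedAddCommGroup E] [NormedSpace ℝ E] [FiniteDimensional ℝ E]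
  [MeasurableSpace E] [BorelSpace E]

/-- The divergence theorem for `φ V`, where `φ` is `C¹` with compact support. -/
theorem integral_fderiv_apply_eq_neg_of_hasCompactSupport (μ : Measure E) [μ.IsAddHaarMeasure]
    {φ : E → ℝ} (hφ : ContDiff ℝ 1 φ) (hc : HasCompactSupport φ) {V : E → E}
    (hV : ContDiff ℝ 1 V) :
    ∫ x, fderiv ℝ φ x (V x) ∂μ = - ∫ x, φ x * traceCLM E (fderiv ℝ V x) ∂μ := by
  classical
  set b := Module.finBasis ℝ E
  let c : ∀ i, E →L[ℝ] ℝ := fun i => LinearMap.toContinuousLinearMap (b.coord i)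
  have hVd : Differentiable ℝ V := hV.differentiable one_ne_zero
  have hφd : Differentiable ℝ φ := hφ.differentiable one_ne_zero
  have hdc : HasCompactSupport (fderiv ℝ φ) := hc.fderiv (𝕜 := ℝ)
  have hcd : ∀ i, ContDiff ℝ 1 (fun x => c i (V x)) := fun i => (c i).contDiff.comp hV
  have hfd : ∀ i x, fderiv ℝ (fun x => c i (V x)) x = (c i).comp (fderiv ℝ V x) := fun i x =>
    ((c i).hasFDerivAt.comp x (hVd x).hasFDerivAt).fderiv
  have hcV : Continuous (fderiv ℝ V) := hV.continuous_fderiv one_ne_zero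
  have hcφ : Continuous (fderiv ℝ φ) := hφ.continuous_fderiv one_ne_zero
  have i1 : ∀ i, Integrable (fun x => c i (fderiv ℝ V x (b i)) * φ x) μ := fun i =>
    Continuous.integrable_of_hasCompactSupport (by fun_prop) hc.mul_left
  have i2 : ∀ i, Integrable (fun x => c i (V x) * fderiv ℝ φ x (b i)) μ := fun i =>
    Continuous.integrable_of_hasCompactSupport
      (((c i).continuous.comp hV.continuous).mul (hcφ.clm_apply continuous_const))
      ((hdc.comp_left (g := fun L : E →L[ℝ] ℝ => L (b i)) (by simp)).mul_left)
  have i3 : ∀ i, Integrable (fun x => c i (V x) * φ x) μ := fun i =>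
    Continuous.integrable_of_hasCompactSupport
      (((c i).continuous.comp hV.continuous).mul hφ.continuous) hc.mul_left
  have key : ∀ i, ∫ x, c i (V x) * fderiv ℝ φ x (b i) ∂μ =
      - ∫ x, c i (fderiv ℝ V x (b i)) * φ x ∂μ := by
    intro i
    have := integral_mul_fderiv_eq_neg_fderiv_mul_of_integrable (μ := μ) (𝕜 := ℝ)
      (f := fun x => c i (V x)) (g := φ) (v := b i) (by simpa [hfd] using i1 i) (i2 i) (i3 i)
      (fun x _ => ((hcd i).differentiable one_ne_zero) x) (fun x _ => hφd x)
    simpa [hfd] using this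
  have e1 : ∀ x, fderiv ℝ φ x (V x) = ∑ i, c i (V x) * fderiv ℝ φ x (b i) := by
    intro x
    conv_lhs => rw [← b.sum_repr (V x), map_sum]
    simp [c]
  have e2 : ∀ x, φ x * traceCLM E (fderiv ℝ V x) = ∑ i, c i (fderiv ℝ V x (b i)) * φ x := by
    intro x
    rw [traceCLM_apply, LinearMap.trace_eq_matrix_trace ℝ b, Matrix.trace, Finset.mul_sum]
    refine Finset.sum_congr rfl fun i _ => ?_
    simp [LinearMap.toMatrix_apply, c, mul_comm]
  simp only [e1, e2]
  rw [integral_finsetSum _ (fun i _ => i2 i), integral_finsetSum _ (fun i _ => i1 i),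
    ← Finset.sum_neg_distrib]
  exact Finset.sum_congr rfl fun i _ => key i

end IntegrationByParts

/-! ### Flows on compact sets -/
section Flow

variable {E : Type*} [NormedAddCommGroup E] [NormedSpace ℝ E]

/-- `γ x` is, for each `x ∈ D`, an integral curve of `V` that starts at `x`, is defined for all
times, and stays in `D`. -/
structure IsFlowOn (D : Set E) (V : E → E) (γ : E → ℝ → E) : Prop where
  zero : ∀ x ∈ D, γ x 0 = x
  deriv : ∀ x ∈ D, ∀ t, HasDerivAt (γ x) (V (γ x t)) t
  mem : ∀ x ∈ D, ∀ t, γ x t ∈ D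

/-- Gronwall's inequality for two integral curves in a set, in both time directions. -/
theorem dist_integralCurve_le {B : Set E} {V : E → E} {K : NNReal} (hV : LipschitzOnWith K V B)
    {α β : ℝ → E} (hα : ∀ t, HasDerivAt α (V (α t)) t) (hαB : ∀ t, α t ∈ B)
    (hβ : ∀ t, HasDerivAt β (V (β t)) t) (hβB : ∀ t, β t ∈ B) (t : ℝ) :
    dist (α t) (β t) ≤ dist (α 0) (β 0) * Real.exp (K * |t|) := by
  have key : ∀ (W : E → E) (a b : ℝ → E), LipschitzOnWith K W B →
      (∀ t, HasDerivAt a (W (a t)) t) → (∀ t, a t ∈ B) → (∀ t, HasDerivAt b (W (b t)) t) →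
      (∀ t, b t ∈ B) → ∀ t, 0 ≤ t → dist (a t) (b t) ≤ dist (a 0) (b 0) * Real.exp (K * t) := by
    intro W a b hW ha haB hb hbB t ht
    have := dist_le_of_trajectories_ODE_of_mem (v := fun _ => W) (s := fun _ => B) (f := a) (g := b)
      (a := 0) (b := t) (K := K) (δ := dist (a 0) (b 0)) (fun _ _ => hW)
      (fun s _ => (ha s).continuousAt.continuousWithinAt) (fun s _ => (ha s).hasDerivWithinAt)
      (fun s _ => haB s) (fun s _ => (hb s).continuousAt.continuousWithinAt)
      (fun s _ => (hb s).hasDerivWithinAt) (fun s _ => hbB s) le_rfl t ⟨ht, le_rfl⟩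
    simpa using this
  rcases le_total 0 t with ht | ht
  · rw [abs_of_nonneg ht]; exact key V α β hV hα hαB hβ hβB t ht
  · rw [abs_of_nonpos ht]
    have hrev : ∀ a : ℝ → E, (∀ t, HasDerivAt a (V (a t)) t) →
        ∀ t, HasDerivAt (fun s => a (-s)) ((-V) (a (-t))) t := by
      intro a ha t
      have := (ha (-t)).scomp t (hasDerivAt_neg t)
      simpa [Function.comp_def] using this
    have := key (-V) (fun s => α (-s)) (fun s => β (-s)) hV.neg (hrev α hα) (fun s => hαB _)
      (hrev β hβ) (fun s => hβB _) (-t) (by linarith)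
    simpa using this

/-- The flow is a group action: integral curves in `B` are unique. -/
theorem IsFlowOn.add {D B : Set E} {V : E → E} {γ : E → ℝ → E} (hγ : IsFlowOn D V γ)
    (hDB : D ⊆ B) {K : NNReal} (hV : LipschitzOnWith K V B) {x : E} (hx : x ∈ D) (t s : ℝ) :
    γ (γ x t) s = γ x (t + s) := by
  have h1 : ∀ r, HasDerivAt (fun r => γ x (t + r)) (V (γ x (t + r))) r := by
    intro r
    have := (hγ.deriv x hx (t + r)).scomp r ((hasDerivAt_id r).const_add t)
    simpa [Function.comp_def] using this
  have h := dist_integralCurve_le hV (hγ.deriv _ (hγ.mem x hx t))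
    (fun r => hDB (hγ.mem _ (hγ.mem x hx t) r)) h1 (fun r => hDB (hγ.mem x hx _)) s
  rw [hγ.zero _ (hγ.mem x hx t), add_zero, dist_self, zero_mul] at h
  exact dist_le_zero.1 h

/-- The flow `φ_t` is a group action by bi-Lipschitz maps, and it differs from `id + t V` by a map
that is, at small scales, Lipschitz with a constant of order `t²`. -/
theorem IsFlowOn.exists_norm_sub_le [FiniteDimensional ℝ E] {D : Set E} (hD : IsCompact D)
    {V : E → E} (hV : ContDiff ℝ 2 V) {γ : E → ℝ → E} (hγ : IsFlowOn D V γ) :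
    ∃ (K : NNReal) (C : ℝ), 0 ≤ C ∧
      (∀ x ∈ D, ∀ t s, γ (γ x t) s = γ x (t + s)) ∧
      (∀ x ∈ D, ∀ y ∈ D, ∀ t, dist (γ x t) (γ y t) ≤ dist x y * Real.exp (K * |t|)) ∧
      (∀ x ∈ D, ∀ y ∈ D, ∀ t, |t| ≤ 1 →
        ‖γ y t - γ x t - (y - x) - t • fderiv ℝ V x (y - x)‖ ≤
          C * |t| * (|t| + ‖y - x‖) * ‖y - x‖) := by
  -- `D` need not be convex, so the Lipschitz bounds for `V` and `DV` are taken on a ball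
  obtain ⟨R, hR⟩ := hD.isBounded.subset_closedBall (0 : E)
  set B := closedBall (0 : E) R
  have hBc : IsCompact B := isCompact_closedBall _ _
  have hBconv : Convex ℝ B := convex_closedBall _ _
  have hVd : Differentiable ℝ V := hV.differentiable two_ne_zero
  have hDV : ContDiff ℝ 1 (fderiv ℝ V) := hV.fderiv_right (m := 1) (by norm_num)
  obtain ⟨K', hK'⟩ := hBc.exists_bound_of_continuousOn (f := fderiv ℝ V) hDV.continuous.continuousOn
  obtain ⟨K2', hK2'⟩ := hBc.exists_bound_of_continuousOn (f := fderiv ℝ (fderiv ℝ V))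
    (hDV.continuous_fderiv one_ne_zero).continuousOn
  obtain ⟨M', hM'⟩ := hBc.exists_bound_of_continuousOn (f := V) hV.continuous.continuousOn
  set K : NNReal := Real.toNNReal K'
  set K2 : NNReal := Real.toNNReal K2'
  set M : NNReal := Real.toNNReal M'
  have hK : ∀ z ∈ B, ‖fderiv ℝ V z‖ ≤ K := fun z hz => (hK' z hz).trans (Real.le_coe_toNNReal _)
  have hK2 : ∀ z ∈ B, ‖fderiv ℝ (fderiv ℝ V) z‖ ≤ K2 :=
    fun z hz => (hK2' z hz).trans (Real.le_coe_toNNReal _)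
  have hM : ∀ z ∈ B, ‖V z‖ ≤ M := fun z hz => (hM' z hz).trans (Real.le_coe_toNNReal _)
  have hVL : LipschitzOnWith K V B := hBconv.lipschitzOnWith_of_nnnorm_fderiv_le
    (fun z _ => hVd z) (fun z hz => by exact_mod_cast hK z hz)
  have hDVL : LipschitzOnWith K2 (fderiv ℝ V) B := hBconv.lipschitzOnWith_of_nnnorm_fderiv_le
    (fun z _ => (hDV.differentiable one_ne_zero) z) (fun z hz => by exact_mod_cast hK2 z hz)
  have hdist : ∀ x ∈ D, ∀ y ∈ D, ∀ t, dist (γ x t) (γ y t) ≤ dist x y * Real.exp (K * |t|) := by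
    intro x hx y hy t
    have := dist_integralCurve_le hVL (hγ.deriv x hx) (fun r => hR (hγ.mem x hx r))
      (hγ.deriv y hy) (fun r => hR (hγ.mem y hy r)) t
    rwa [hγ.zero x hx, hγ.zero y hy] at this
  set e := Real.exp K
  have he : 0 ≤ e := (Real.exp_pos _).le
  set C : ℝ := K2 * (M + 1) * e + K * (K * e)
  have hC : 0 ≤ C := by positivity
  refine ⟨K, C, hC, fun x hx t s => hγ.add hR hVL hx t s, hdist, ?_⟩
  intro x hx y hy t ht
  have hseg : ∀ s ∈ Icc (-|t|) |t|, |s| ≤ |t| := fun s hs => abs_le.2 hs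
  have h0mem : (0 : ℝ) ∈ Icc (-|t|) |t| := by simp
  have htmem : t ∈ Icc (-|t|) |t| := ⟨neg_abs_le t, le_abs_self t⟩
  have hde : ∀ s ∈ Icc (-|t|) |t|, ‖γ y s - γ x s‖ ≤ e * ‖y - x‖ := by
    intro s hs
    have h1 := hdist y hy x hx s
    rw [dist_eq_norm, dist_eq_norm] at h1
    refine h1.trans ?_
    rw [mul_comm]
    gcongr
    exact Real.exp_le_exp.2 (by nlinarith [hseg s hs, K.coe_nonneg])
  have hmove : ∀ z ∈ D, ∀ s ∈ Icc (-|t|) |t|, ‖γ z s - z‖ ≤ M * |t| := by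
    intro z hz s hs
    have := (convex_Icc (-|t|) |t|).norm_image_sub_le_of_norm_hasDerivWithin_le
      (fun r _ => (hγ.deriv z hz r).hasDerivWithinAt)
      (fun r _ => hM _ (hR (hγ.mem z hz r))) h0mem hs
    rw [hγ.zero z hz, sub_zero, Real.norm_eq_abs] at this
    exact this.trans (mul_le_mul_of_nonneg_left (hseg s hs) (by positivity))
  have hrel : ∀ s ∈ Icc (-|t|) |t|, ‖γ y s - γ x s - (y - x)‖ ≤ K * (e * ‖y - x‖) * |t| := by
    intro s hs
    have := (convex_Icc (-|t|) |t|).norm_image_sub_le_of_norm_hasDerivWithin_le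
      (f := fun r => γ y r - γ x r) (C := K * (e * ‖y - x‖))
      (fun r _ => ((hγ.deriv y hy r).sub (hγ.deriv x hx r)).hasDerivWithinAt)
      (fun r hr => by
        have := hVL.dist_le_mul _ (hR (hγ.mem y hy r)) _ (hR (hγ.mem x hx r))
        rw [dist_eq_norm, dist_eq_norm] at this
        exact this.trans (by gcongr; exact hde r hr)) h0mem hs
    simp only [hγ.zero x hx, hγ.zero y hy, sub_zero, Real.norm_eq_abs] at this
    exact this.trans (mul_le_mul_of_nonneg_left (hseg s hs) (by positivity))
  -- the quantity to be bounded vanishes at time `0`, so it suffices to bound its time derivative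
  have hG : ∀ s, HasDerivAt (fun s => γ y s - γ x s - s • fderiv ℝ V x (y - x))
      (V (γ y s) - V (γ x s) - fderiv ℝ V x (y - x)) s := by
    intro s
    have h1 := (hγ.deriv y hy s).sub (hγ.deriv x hx s)
    have h2 := (hasDerivAt_id s).smul_const (fderiv ℝ V x (y - x))
    convert! h1.sub h2 using 1
    simp
  have hbound : ∀ s ∈ Icc (-|t|) |t|, ‖V (γ y s) - V (γ x s) - fderiv ℝ V x (y - x)‖ ≤
      C * (|t| + ‖y - x‖) * ‖y - x‖ := by
    intro s hs
    set r := M * |t| + ‖y - x‖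
    have hS : Convex ℝ (B ∩ closedBall x r) := hBconv.inter (convex_closedBall _ _)
    have hxS : γ x s ∈ B ∩ closedBall x r := by
      refine ⟨hR (hγ.mem x hx s), ?_⟩
      rw [mem_closedBall, dist_eq_norm]
      exact (hmove x hx s hs).trans (le_add_of_nonneg_right (norm_nonneg _))
    have hyS : γ y s ∈ B ∩ closedBall x r := by
      refine ⟨hR (hγ.mem y hy s), ?_⟩
      rw [mem_closedBall, dist_eq_norm]
      calc ‖γ y s - x‖ = ‖(γ y s - y) + (y - x)‖ := by congr 1; abel
        _ ≤ r := (norm_add_le _ _).trans (add_le_add (hmove y hy s hs) le_rfl)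
    have h1 := hS.norm_image_sub_le_of_norm_hasFDerivWithin_le' (f := V) (f' := fderiv ℝ V)
      (φ := fderiv ℝ V x) (C := K2 * r)
      (fun z _ => (hVd z).hasFDerivAt.hasFDerivWithinAt)
      (fun z hz => by
        have := hDVL.dist_le_mul z hz.1 x (hR hx)
        rw [dist_eq_norm] at this
        exact this.trans (by gcongr; exact hz.2)) hxS hyS
    have h2 : ‖fderiv ℝ V x (γ y s - γ x s - (y - x))‖ ≤ K * (K * (e * ‖y - x‖) * |t|) :=
      (ContinuousLinearMap.le_opNorm _ _).trans (by
        gcongr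
        · exact hK x (hR hx)
        · exact hrel s hs)
    have h3 : V (γ y s) - V (γ x s) - fderiv ℝ V x (y - x) =
        (V (γ y s) - V (γ x s) - fderiv ℝ V x (γ y s - γ x s)) +
          fderiv ℝ V x (γ y s - γ x s - (y - x)) := by
      rw [map_sub (fderiv ℝ V x) (γ y s - γ x s) (y - x)]; abel
    rw [h3]
    refine (norm_add_le _ _).trans ((add_le_add h1 h2).trans ?_)
    have h4 : K2 * r * ‖γ y s - γ x s‖ ≤ K2 * ((M + 1) * (|t| + ‖y - x‖)) * (e * ‖y - x‖) := by
      gcongr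
      · have := norm_nonneg (y - x)
        have := abs_nonneg t
        have := M.coe_nonneg
        simp only [r]; nlinarith
      · exact hde s hs
    refine (add_le_add_left h4 _).trans ?_
    have h5 : 0 ≤ (K : ℝ) * (K * e) * ‖y - x‖ * ‖y - x‖ := by positivity
    simp only [C]
    nlinarith
  have hfin := (convex_Icc (-|t|) |t|).norm_image_sub_le_of_norm_hasDerivWithin_le
    (fun s _ => (hG s).hasDerivWithinAt) hbound h0mem htmem
  simp only [hγ.zero x hx, hγ.zero y hy, zero_smul, sub_zero, Real.norm_eq_abs] at hfin
  calc _ = ‖γ y t - γ x t - t • fderiv ℝ V x (y - x) - (y - x)‖ := by congr 1; abel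
    _ ≤ _ := hfin
    _ = _ := by ring

/-- The derivative of a map that is close to a linear map at small scales is close to it, at a
point where all directions are tangent. -/
theorem norm_hasFDerivWithinAt_sub_le {f : E → E} {L A : E →L[ℝ] E} {s : Set E} {x : E}
    (hx : tangentConeAt ℝ s x = univ) (hf : HasFDerivWithinAt f L s x) {δ η : ℝ} (hδ : 0 ≤ δ)
    (h : ∀ y ∈ s, ‖f y - f x - A (y - x)‖ ≤ (δ + η * ‖y - x‖) * ‖y - x‖) : ‖L - A‖ ≤ δ := by
  refine ContinuousLinearMap.opNorm_le_bound _ hδ fun z => ?_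
  have hz : z ∈ tangentConeAt ℝ s x := hx ▸ mem_univ z
  obtain ⟨ι, l, hl, c, d, hd, hds, hcd⟩ := exists_fun_of_mem_tangentConeAt hz
  have hg : HasFDerivWithinAt (fun y => f y - A y) (L - A) s x := hf.sub A.hasFDerivWithinAt
  have h1 := (hg.lim hd hds hcd).norm
  have h2 : Tendsto (fun n => (δ + η * ‖d n‖) * ‖c n • d n‖) l (𝓝 ((δ + η * 0) * ‖z‖)) :=
    ((tendsto_const_nhds.add ((tendsto_norm_zero.comp hd).const_mul η))).mul hcd.norm
  rw [mul_zero, add_zero] at h2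
  refine le_of_tendsto_of_tendsto h1 h2 ?_
  filter_upwards [hds] with n hn
  have := h _ hn
  rw [add_sub_cancel_left] at this
  calc ‖c n • (f (x + d n) - A (x + d n) - (f x - A x))‖
      = ‖c n‖ * ‖f (x + d n) - f x - A (d n)‖ := by
        rw [norm_smul, map_add]; congr 2; abel
    _ ≤ ‖c n‖ * ((δ + η * ‖d n‖) * ‖d n‖) := by gcongr
    _ = _ := by rw [norm_smul]; ring

end Flow

/-! ### The divergence theorem on a flow-invariant compact set -/
section FlowIntegral

variable {E : Type*} [NormedAddCommGroup E] [NormedSpace ℝ E] [FiniteDimensional ℝ E]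
  [MeasurableSpace E] [BorelSpace E]

/-- A Lipschitz map of a finite-dimensional space into itself preserves null sets. -/
theorem addHaar_image_eq_zero_of_lipschitzOnWith (μ : Measure E) [μ.IsAddHaarMeasure] {f : E → E}
    {K : NNReal} {s : Set E} (hf : LipschitzOnWith K f s) (hs : μ s = 0) : μ (f '' s) = 0 := by
  have h1 : μ ≪ μH[Module.finrank ℝ E] := Measure.absolutelyContinuous_isAddHaarMeasure _ _
  have h2 : (μH[Module.finrank ℝ E] : Measure E) ≪ μ :=
    Measure.absolutelyContinuous_isAddHaarMeasure _ _
  refine h1 ?_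
  have := hf.hausdorffMeasure_image_le (d := (Module.finrank ℝ E : ℝ)) (Nat.cast_nonneg _)
  rw [h2 hs, mul_zero] at this
  exact le_antisymm this bot_le

/-- Transport of an integral by a bi-Lipschitz bijection of a measurable set. -/
theorem setIntegral_eq_of_lipschitzOn_bijOn (μ : Measure E) [μ.IsAddHaarMeasure] {φ : E → E}
    {K : NNReal} {D : Set E} (hD : MeasurableSet D) (hφ : LipschitzOnWith K φ D)
    (hb : BijOn φ D D) (h : E → ℝ) :
    ∫ x in D, h x ∂μ = ∫ x in D, |(fderivWithin ℝ φ D x).det| * h (φ x) ∂μ := by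
  have hae := hφ.ae_differentiableWithinAt (μ := μ) hD
  obtain ⟨N, hN1, hN2, hN3⟩ := exists_measurable_superset_of_null (ae_iff.1 hae)
  have hDN : MeasurableSet (D \ N) := hD.diff hN2
  have hmem : ∀ x ∈ D \ N, HasFDerivWithinAt φ (fderivWithin ℝ φ D x) (D \ N) x := by
    intro x hx
    have : DifferentiableWithinAt ℝ φ D x := by
      by_contra hcon; exact hx.2 (hN1 hcon)
    exact this.hasFDerivWithinAt.mono sdiff_subset
  have hnull : μ (D ∩ N) = 0 := by
    rw [Measure.restrict_apply hN2] at hN3; rwa [inter_comm]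
  have key := integral_image_eq_integral_abs_det_fderiv_smul μ hDN hmem
    (hb.injOn.mono sdiff_subset) h
  -- the points of non-differentiability are null, and so is their image
  have e1 : φ '' (D \ N) =ᵐ[μ] D := by
    have hsub : D \ φ '' (D \ N) ⊆ φ '' (D ∩ N) := by
      rintro y ⟨hy, hy2⟩
      obtain ⟨x, hx, rfl⟩ := hb.surjOn hy
      by_cases hxN : x ∈ N
      · exact ⟨x, ⟨hx, hxN⟩, rfl⟩
      · exact absurd ⟨x, ⟨hx, hxN⟩, rfl⟩ hy2
    refine ae_eq_set.2 ⟨?_, ?_⟩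
    · have : φ '' (D \ N) \ D = ∅ := by
        rw [sdiff_eq_empty]
        rintro _ ⟨x, hx, rfl⟩; exact hb.mapsTo hx.1
      rw [this, measure_empty]
    · exact measure_mono_null hsub
        (addHaar_image_eq_zero_of_lipschitzOnWith μ (hφ.mono inter_subset_left) hnull)
  have e2 : (D \ N : Set E) =ᵐ[μ] D := by
    refine ae_eq_set.2 ⟨?_, ?_⟩
    · rw [show (D \ N) \ D = ∅ by rw [sdiff_eq_empty]; exact sdiff_subset, measure_empty]
    · rw [Set.sdiff_sdiff_right_self]; exact hnull
  rw [setIntegral_congr_set e1, setIntegral_congr_set e2] at key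
  simpa using key

/-- The divergence theorem on a compact set `D` that is invariant under the flow of `V`: if `h`
has the bounded derivative `hV` along the flow, then `∫_D (hV + h tr DV) = 0`. It comes from the
time derivative at `0` of `∫_D h(φ_t(x)) |det Dφ_t(x)| dx`, which does not depend on `t`. The set
`D` may be arbitrarily irregular. -/
theorem IsFlowOn.integral_deriv_add_trace (μ : Measure E) [μ.IsAddHaarMeasure] {D : Set E}
    (hD : IsCompact D) {V : E → E} (hV : ContDiff ℝ 2 V) {γ : E → ℝ → E} (hγ : IsFlowOn D V γ)
    {h hV' : E → ℝ} (hc : ContinuousOn h D)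
    (hd : ∀ x ∈ D, HasDerivAt (fun t => h (γ x t)) (hV' x) 0) {M : ℝ}
    (hb : ∀ x ∈ D, |hV' x| ≤ M) :
    IntegrableOn hV' D μ ∧
      ∫ x in D, hV' x ∂μ = - ∫ x in D, h x * traceCLM E (fderiv ℝ V x) ∂μ := by
  obtain ⟨K, C, hC, hadd, hdist, happ⟩ := hγ.exists_norm_sub_le hD hV
  have hDm : MeasurableSet D := hD.measurableSet
  have hlip : ∀ t, LipschitzOnWith (Real.toNNReal (Real.exp (K * |t|))) (fun x => γ x t) D := by
    intro t
    refine LipschitzOnWith.of_dist_le_mul fun x hx y hy => ?_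
    rw [Real.coe_toNNReal _ (Real.exp_pos _).le, mul_comm]
    exact hdist x hx y hy t
  have hbij : ∀ t, BijOn (fun x => γ x t) D D := by
    intro t
    have hinv : ∀ s, LeftInvOn (fun x => γ x (-s)) (fun x => γ x s) D := by
      intro s x hx
      simp only
      rw [hadd x hx, add_neg_cancel, hγ.zero x hx]
    refine ⟨fun x hx => hγ.mem x hx t, (hinv t).injOn, ?_⟩
    intro y hy
    exact ⟨γ y (-t), hγ.mem y hy _, by simpa using hinv (-t) hy⟩
  set L : ℝ → E → E →L[ℝ] E := fun t x => fderivWithin ℝ (fun x => γ x t) D x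
  -- the flow is only Lipschitz on `D`, so by Rademacher's theorem it has a derivative at almost every
  -- point, and this derivative is unique at density points
  have hLae : ∀ t, |t| ≤ 1 → ∀ᵐ x ∂μ.restrict D,
      ‖L t x - (1 + t • fderiv ℝ V x)‖ ≤ C * t ^ 2 := by
    intro t ht
    filter_upwards [ae_tangentConeAt_eq_univ μ hDm, (hlip t).ae_differentiableWithinAt hDm,
      ae_restrict_mem hDm] with x hx hdx hxD
    refine norm_hasFDerivWithinAt_sub_le hx hdx.hasFDerivWithinAt (by positivity)
      (η := C * |t|) fun y hy => ?_
    refine le_trans (le_of_eq ?_) ((happ x hxD y hy t ht).trans (le_of_eq ?_))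
    · congr 1
      simp only [add_apply, one_apply_eq_self,
        smul_apply]
      abel
    · rw [show t ^ 2 = |t| ^ 2 by rw [sq_abs]]; ring
  obtain ⟨H, hH⟩ := hD.exists_bound_of_continuousOn hc
  have hDVc : Continuous (fderiv ℝ V) := hV.continuous_fderiv two_ne_zero
  obtain ⟨K1, hK1⟩ := hD.exists_bound_of_continuousOn (f := fderiv ℝ V) hDVc.continuousOn
  have hderiv : ∀ x ∈ D, ∀ t, HasDerivAt (fun t => h (γ x t)) (hV' (γ x t)) t := by
    intro x hx t
    have h1 := hd _ (hγ.mem x hx t)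
    simp only [hadd x hx t] at h1
    have h2 : HasDerivAt (fun s => h (γ x (t + s))) (hV' (γ x t)) (t - t) := by simpa using h1
    simpa using h2.comp_sub_const t t
  have hMV : ∀ x ∈ D, ∀ t, |h (γ x t) - h x| ≤ M * |t| := by
    intro x hx t
    have := convex_univ.norm_image_sub_le_of_norm_hasDerivWithin_le (f := fun t => h (γ x t))
      (fun r _ => (hderiv x hx r).hasDerivWithinAt) (fun r _ => hb _ (hγ.mem x hx r))
      (mem_univ (0 : ℝ)) (mem_univ t)
    simpa [hγ.zero x hx] using this
  set τ : ℕ → ℝ := fun n => 1 / ((n : ℝ) + 1)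
  have hτ0 : ∀ n, 0 < τ n := fun n => by positivity
  have hτ1 : ∀ n, |τ n| ≤ 1 := fun n => by
    rw [abs_of_pos (hτ0 n)]; simp only [τ]
    rw [div_le_one (by positivity)]; linarith [(Nat.cast_nonneg n : (0 : ℝ) ≤ n)]
  have hτlim : Tendsto τ atTop (𝓝 0) := tendsto_one_div_add_atTop_nhds_zero_nat
  have hLall : ∀ᵐ x ∂μ.restrict D, ∀ n,
      ‖L (τ n) x - (1 + τ n • fderiv ℝ V x)‖ ≤ C * (τ n) ^ 2 :=
    ae_all_iff.2 fun n => hLae _ (hτ1 n)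
  set T := traceCLM E
  have hdet := hasFDerivAt_det_one_add (E := E)
  obtain ⟨δ, hδ, hdetδ⟩ : ∃ δ > 0, ∀ B : E →L[ℝ] E, ‖B‖ < δ →
      |(1 + B).det - 1| ≤ (‖T‖ + 1) * ‖B‖ := by
    have h1 := (hasFDerivAt_iff_isLittleO_nhds_zero.1 hdet).def one_pos
    obtain ⟨δ, hδ, h2⟩ := Metric.eventually_nhds_iff.1 h1
    refine ⟨δ, hδ, fun B hB => ?_⟩
    have h3 := h2 (y := B) (by simpa using hB)
    simp only [zero_add, add_zero, one_mul, Real.norm_eq_abs] at h3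
    have h4 : ((1 : E →L[ℝ] E)).det = 1 := by
      rw [ContinuousLinearMap.det]; exact LinearMap.det_id
    rw [h4] at h3
    have h5 : |T B| ≤ ‖T‖ * ‖B‖ := T.le_opNorm B
    calc |(1 + B).det - 1| = |((1 + B).det - 1 - T B) + T B| := by congr 1; ring
      _ ≤ _ := (abs_add_le _ _).trans (by linarith [h3])
  set C1 := |K1| + C
  have hBn : ∀ᵐ x ∂μ.restrict D, ∀ n, ‖L (τ n) x - 1‖ ≤ C1 * τ n := by
    filter_upwards [hLall, ae_restrict_mem hDm] with x hx hxD n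
    have h1 : ‖fderiv ℝ V x‖ ≤ |K1| := (hK1 x hxD).trans (le_abs_self _)
    have h2 : τ n ≤ 1 := (le_abs_self _).trans (hτ1 n)
    calc ‖L (τ n) x - 1‖ = ‖(L (τ n) x - (1 + τ n • fderiv ℝ V x)) + τ n • fderiv ℝ V x‖ := by
          congr 1; abel
      _ ≤ C * (τ n) ^ 2 + τ n * |K1| := by
          refine (norm_add_le _ _).trans (add_le_add (hx n) ?_)
          rw [norm_smul, Real.norm_eq_abs, abs_of_pos (hτ0 n)]
          have := hτ0 n
          gcongr
      _ ≤ C1 * τ n := by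
          simp only [C1]; nlinarith [mul_nonneg hC (hτ0 n).le, hτ0 n, h2,
            mul_le_mul_of_nonneg_left h2 (mul_nonneg hC (hτ0 n).le)]
  -- the difference quotients at `0` of the integral that does not depend on time
  set F : ℕ → E → ℝ := fun n x => (τ n)⁻¹ * (|(L (τ n) x).det| * h (γ x (τ n)) - h x)
  have hFmeas1 : ∀ n, AEStronglyMeasurable (fun x => |(L (τ n) x).det| * h (γ x (τ n)))
      (μ.restrict D) := by
    intro n
    have hγc : ContinuousOn (fun x => γ x (τ n)) D := (hlip (τ n)).continuousOn
    have h1 : AEStronglyMeasurable (fun x => h (γ x (τ n))) (μ.restrict D) :=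
      (hc.comp hγc (fun x hx => hγ.mem x hx _)).aestronglyMeasurable hDm
    have h2 : AEMeasurable (L (τ n)) (μ.restrict D) := by
      have hae := (hlip (τ n)).ae_differentiableWithinAt (μ := μ) hDm
      obtain ⟨N, hN1, hN2, hN3⟩ := exists_measurable_superset_of_null (ae_iff.1 hae)
      have h3 : AEMeasurable (L (τ n)) (μ.restrict (D \ N)) :=
        aemeasurable_fderivWithin (f := fun x => γ x (τ n)) μ (hDm.diff hN2) fun x hx => by
          have : DifferentiableWithinAt ℝ (fun x => γ x (τ n)) D x := by
            by_contra hcon; exact hx.2 (hN1 hcon)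
          exact this.hasFDerivWithinAt.mono sdiff_subset
      have h4 : μ.restrict (D \ N) = μ.restrict D := by
        refine Measure.restrict_congr_set (ae_eq_set.2 ⟨?_, ?_⟩)
        · rw [show (D \ N) \ D = ∅ by rw [sdiff_eq_empty]; exact sdiff_subset, measure_empty]
        · rw [Set.sdiff_sdiff_right_self]
          rwa [Measure.restrict_apply hN2, inter_comm] at hN3
      rwa [h4] at h3
    have h5 : Measurable fun A : E →L[ℝ] E => |A.det| :=
      ((ContinuousLinearMap.continuous_det).abs).measurable
    exact (h5.comp_aemeasurable h2).aestronglyMeasurable.mul h1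
  have hFmeas : ∀ n, AEStronglyMeasurable (F n) (μ.restrict D) := fun n =>
    ((hFmeas1 n).sub (hc.aestronglyMeasurable hDm)).const_mul _
  have hhint : IntegrableOn h D μ := hc.integrableOn_compact hD
  set C2 := (‖T‖ + 1) * C1
  have hC1 : 0 ≤ C1 := by positivity
  have hev : ∀ᶠ n in atTop, C1 * τ n < δ := by
    have : Tendsto (fun n => C1 * τ n) atTop (𝓝 0) := by simpa using hτlim.const_mul C1
    exact this.eventually (gt_mem_nhds hδ)
  have hdetbd : ∀ᵐ x ∂μ.restrict D, ∀ n, C1 * τ n < δ → |(L (τ n) x).det - 1| ≤ C2 * τ n := by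
    filter_upwards [hBn] with x hx n hn
    have h1 := hdetδ (L (τ n) x - 1) ((hx n).trans_lt hn)
    rw [add_sub_cancel] at h1
    refine h1.trans ?_
    simp only [C2]; rw [mul_assoc]
    gcongr
    exact hx n
  have hH0 : ∀ x ∈ D, |h x| ≤ |H| := fun x hx => (hH x hx).trans (le_abs_self _)
  have hFeq : ∀ n x, F n x = (τ n)⁻¹ * ((|(L (τ n) x).det| - 1) * h (γ x (τ n))) +
      (τ n)⁻¹ * (h (γ x (τ n)) - h x) := fun n x => by simp only [F]; ring
  have hFb : ∀ᶠ n in atTop, ∀ᵐ x ∂μ.restrict D, ‖F n x‖ ≤ C2 * |H| + M := by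
    filter_upwards [hev] with n hn
    filter_upwards [hdetbd, ae_restrict_mem hDm] with x hx hxD
    have hτ := hτ0 n
    have h1 : |(|(L (τ n) x).det|) - 1| ≤ C2 * τ n := by
      refine le_trans ?_ (hx n hn)
      simpa using abs_abs_sub_abs_le (L (τ n) x).det 1
    have h2 := hH0 _ (hγ.mem x hxD (τ n))
    have h3 := hMV x hxD (τ n)
    rw [abs_of_pos hτ] at h3
    rw [hFeq]
    refine (norm_add_le _ _).trans (add_le_add ?_ ?_)
    · rw [norm_mul, norm_mul, norm_inv, Real.norm_eq_abs, Real.norm_eq_abs, Real.norm_eq_abs,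
        abs_of_pos hτ, inv_mul_le_iff₀ hτ]
      calc _ ≤ (C2 * τ n) * |H| := by gcongr
        _ = _ := by ring
    · rw [norm_mul, norm_inv, Real.norm_eq_abs, Real.norm_eq_abs, abs_of_pos hτ,
        inv_mul_le_iff₀ hτ]
      linarith
  have hFlim : ∀ᵐ x ∂μ.restrict D, Tendsto (fun n => F n x) atTop
      (𝓝 (hV' x + h x * T (fderiv ℝ V x))) := by
    filter_upwards [hLall, hdetbd, ae_restrict_mem hDm] with x hLx hdx hxD
    have hγlim : Tendsto (fun n => h (γ x (τ n))) atTop (𝓝 (h x)) := by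
      have := (hderiv x hxD 0).continuousAt.tendsto.comp hτlim
      simpa [hγ.zero x hxD, Function.comp_def] using this
    have hB0 : Tendsto (fun n => L (τ n) x - 1) atTop (𝓝 0) ∧
        Tendsto (fun n => (τ n)⁻¹ • (L (τ n) x - 1)) atTop (𝓝 (fderiv ℝ V x)) := by
      have h1 : Tendsto (fun n => (τ n)⁻¹ • (L (τ n) x - 1)) atTop (𝓝 (fderiv ℝ V x)) := by
        rw [tendsto_iff_norm_sub_tendsto_zero]
        refine squeeze_zero (fun _ => norm_nonneg _) (g := fun n => C * τ n) (fun n => ?_)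
          (by simpa using hτlim.const_mul C)
        have h2 : (τ n)⁻¹ • (L (τ n) x - 1) - fderiv ℝ V x =
            (τ n)⁻¹ • (L (τ n) x - (1 + τ n • fderiv ℝ V x)) := by
          rw [← sub_sub, smul_sub _ (L (τ n) x - 1), smul_smul, inv_mul_cancel₀ (hτ0 n).ne',
            one_smul]
        rw [h2, norm_smul, norm_inv, Real.norm_eq_abs, abs_of_pos (hτ0 n),
          inv_mul_le_iff₀ (hτ0 n)]
        exact (hLx n).trans (le_of_eq (by ring))
      refine ⟨?_, h1⟩
      have := hτlim.smul h1
      rw [zero_smul] at this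
      refine this.congr fun n => ?_
      rw [smul_smul, mul_inv_cancel₀ (hτ0 n).ne', one_smul]
    have hdetlim : Tendsto (fun n => (τ n)⁻¹ * ((L (τ n) x).det - 1)) atTop
        (𝓝 (T (fderiv ℝ V x))) := by
      have := (hdet.hasFDerivWithinAt (s := univ)).lim hB0.1
        (Eventually.of_forall fun _ => mem_univ _) hB0.2
      refine this.congr fun n => ?_
      have h4 : ((1 : E →L[ℝ] E)).det = 1 := by
        rw [ContinuousLinearMap.det]; exact LinearMap.det_id
      rw [zero_add, add_sub_cancel, add_zero, h4, smul_eq_mul]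
    have hpos : ∀ᶠ n in atTop, |(L (τ n) x).det| = (L (τ n) x).det := by
      have hlim1 : Tendsto (fun n => C2 * τ n) atTop (𝓝 0) := by simpa using hτlim.const_mul C2
      filter_upwards [hev, hlim1.eventually (gt_mem_nhds one_pos)] with n hn hn2
      have := hdx n hn
      exact abs_of_pos (by linarith [(abs_le.1 this).1])
    have h1 : Tendsto (fun n => ((τ n)⁻¹ * ((L (τ n) x).det - 1)) * h (γ x (τ n)) +
        (τ n)⁻¹ * (h (γ x (τ n)) - h x)) atTop (𝓝 (T (fderiv ℝ V x) * h x + hV' x)) := by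
      refine (hdetlim.mul hγlim).add ?_
      have h2 := ((hderiv x hxD 0).hasFDerivAt.hasFDerivWithinAt (s := univ)).lim
        (c := fun n => (τ n)⁻¹) (d := τ) (v := (1 : ℝ)) hτlim
        (Eventually.of_forall fun _ => mem_univ _)
        (tendsto_const_nhds.congr fun n => by simp [(hτ0 n).ne'])
      simpa [hγ.zero x hxD] using h2
    rw [show hV' x + h x * T (fderiv ℝ V x) = T (fderiv ℝ V x) * h x + hV' x by ring]
    refine h1.congr' ?_
    filter_upwards [hpos] with n hn
    rw [hFeq, hn]; ring
  have hfin : IsFiniteMeasure (μ.restrict D) := ⟨by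
    rw [Measure.restrict_apply_univ]; exact hD.measure_lt_top⟩
  -- the difference quotients converge boundedly, and their integrals vanish
  have hlimint := tendsto_integral_filter_of_dominated_convergence
    (fun _ => C2 * |H| + M) (Eventually.of_forall hFmeas) hFb (integrable_const _) hFlim
  have hF0 : ∀ᶠ n in atTop, ∫ x in D, F n x ∂μ = 0 := by
    filter_upwards [hFb] with n hn
    have hFi : Integrable (F n) (μ.restrict D) :=
      Integrable.of_bound (hFmeas n) _ hn
    have hi1 : Integrable (fun x => |(L (τ n) x).det| * h (γ x (τ n))) (μ.restrict D) := by
      refine ((hFi.const_mul (τ n)).add hhint).congr (ae_of_all _ fun x => ?_)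
      simp only [F, Pi.add_apply]
      rw [mul_inv_cancel_left₀ (hτ0 n).ne']; ring
    simp only [F]
    rw [integral_const_mul, integral_sub hi1 hhint,
      setIntegral_eq_of_lipschitzOn_bijOn μ hDm (hlip (τ n)) (hbij (τ n)) h, sub_self, mul_zero]
  have hzero : ∫ x in D, (hV' x + h x * T (fderiv ℝ V x)) ∂μ = 0 :=
    tendsto_nhds_unique hlimint (tendsto_const_nhds.congr' (hF0.mono fun n hn => hn.symm))
  have hti : IntegrableOn (fun x => h x * T (fderiv ℝ V x)) D μ :=
    (hc.mul (T.continuous.comp hDVc).continuousOn).integrableOn_compact hD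
  have hmeasV : AEStronglyMeasurable hV' (μ.restrict D) := by
    have h1 := aestronglyMeasurable_of_tendsto_ae atTop hFmeas hFlim
    refine (h1.sub hti.aestronglyMeasurable).congr (ae_of_all _ fun x => ?_)
    simp
  have hVi : IntegrableOn hV' D μ :=
    Integrable.of_bound hmeasV M ((ae_restrict_mem hDm).mono fun x hx => hb x hx)
  refine ⟨hVi, ?_⟩
  rw [integral_add hVi hti] at hzero
  linarith

end FlowIntegral

/-! ### Counting points of finite configurations -/
section Counting

variable {d : ℕ} {D : Set (Sp d)}

/-- The number of points of a finite configuration in the set `A`. -/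
noncomputable def FinConf.num (A : Set (Sp d)) (B : FinConf D) : ℕ := ((B.1 : Set (Sp d)) ∩ A).ncard

open Classical in
theorem FinConf.num_eq_card_filter (A : Set (Sp d)) (B : FinConf D) :
    B.num A = (B.1.filter (· ∈ A)).card := by
  rw [FinConf.num, ← Set.ncard_coe_finset]
  congr 1
  ext x; simp

theorem FinConf.num_univ (B : FinConf D) : B.num univ = B.1.card := by
  classical
  rw [FinConf.num_eq_card_filter]; simp

theorem FinConf.num_inter_right (A : Set (Sp d)) (B : FinConf D) : B.num (A ∩ D) = B.num A := by
  rw [FinConf.num, FinConf.num, ← inter_assoc, inter_right_comm,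
    inter_eq_self_of_subset_left B.2]

theorem FinConf.num_eq_zero_iff (A : Set (Sp d)) (B : FinConf D) :
    B.num A = 0 ↔ ∀ x ∈ B.1, x ∉ A := by
  classical
  rw [FinConf.num_eq_card_filter]; simp [Finset.filter_eq_empty_iff]

theorem FinConf.num_mono {A A' : Set (Sp d)} (h : A ⊆ A') (B : FinConf D) : B.num A ≤ B.num A' := by
  classical
  rw [FinConf.num_eq_card_filter, FinConf.num_eq_card_filter]
  exact Finset.card_le_card (fun x hx => by
    rw [Finset.mem_filter] at hx ⊢; exact ⟨hx.1, h hx.2⟩)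

theorem FinConf.coe_num_eq_sum (A : Set (Sp d)) (B : FinConf D) :
    (B.num A : ℝ≥0∞) = ∑ x ∈ B.1, A.indicator 1 x := by
  classical
  rw [FinConf.num_eq_card_filter, Finset.card_filter]
  push_cast
  refine Finset.sum_congr rfl fun x _ => ?_
  by_cases h : x ∈ A <;> simp [h]

/-- The points of a configuration, distributed over the fibres of a map to a finite set. -/
theorem FinConf.sum_num_preimage {κ : Type*} [Fintype κ] (c : Sp d → κ) (A : Set (Sp d))
    (B : FinConf D) : ∑ s, B.num (A ∩ c ⁻¹' {s}) = B.num A := by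
  classical
  simp only [FinConf.num_eq_card_filter]
  rw [Finset.card_eq_sum_card_fiberwise (f := c) (t := Finset.univ) (fun _ _ => by simp)]
  refine Finset.sum_congr rfl fun s _ => ?_
  rw [Finset.filter_filter]
  congr 1
  ext a; simp

theorem FinConf.num_le_one_of_injOn {κ : Type*} (c : Sp d → κ) (A : Set (Sp d))
    (B : FinConf D) (h : InjOn c B.1) (s : κ) : B.num (A ∩ c ⁻¹' {s}) ≤ 1 := by
  classical
  rw [FinConf.num_eq_card_filter, Finset.card_le_one]
  intro x hx y hy
  simp only [Finset.mem_filter, mem_inter_iff, mem_preimage, mem_singleton_iff] at hx hy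
  exact h (by simpa using hx.1) (by simpa using hy.1) (hx.2.2.trans hy.2.2.symm)

/-- The counts of points in Borel sets are measurable. -/
theorem FinConf.measurable_num (hD : IsCompact D) {A : Set (Sp d)} (hA : MeasurableSet A) :
    Measurable (FinConf.num A : FinConf D → ℕ) := by
  have hcl : ∀ C : Set (Sp d), IsClosed C → Measurable (FinConf.num C : FinConf D → ℕ) := by
    intro C hC
    refine measurable_to_countable' fun m => ?_
    refine MeasurableSpace.measurableSet_generateFrom
      ⟨C ∩ D, m, inter_subset_right, hD.inter_left hC, ?_⟩
    ext B
    simp only [mem_preimage, mem_singleton_iff, mem_ofPred_eq]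
    rw [← FinConf.num_inter_right]; rfl
  induction A, hA using MeasurableSpace.induction_on_inter
    (s := {s : Set (Sp d) | IsClosed s})
    ((BorelSpace.measurable_eq (α := Sp d)).trans borel_eq_generateFrom_isClosed)
    isPiSystem_isClosed with
  | empty =>
    have : (FinConf.num (∅ : Set (Sp d)) : FinConf D → ℕ) = fun _ => 0 := by
      funext B; simp [FinConf.num]
    rw [this]; exact measurable_const
  | basic C hC => exact hcl C hC
  | compl A hA ih =>
    have : (FinConf.num Aᶜ : FinConf D → ℕ) = fun B => B.num univ - B.num A := by
      funext B
      classical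
      rw [FinConf.num_univ, FinConf.num_eq_card_filter, FinConf.num_eq_card_filter,
        ← Finset.card_filter_add_card_filter_not (s := B.1) (· ∈ A)]
      simp
    rw [this]
    exact (hcl univ isClosed_univ).sub ih
  | iUnion f hdisj hf ih =>
    have h1 : Measurable (fun B : FinConf D => (B.num (⋃ i, f i) : ℝ≥0∞)) := by
      have : (fun B : FinConf D => (B.num (⋃ i, f i) : ℝ≥0∞)) =
          fun B => ∑' i, (B.num (f i) : ℝ≥0∞) := by
        funext B
        simp only [FinConf.coe_num_eq_sum]
        rw [Summable.tsum_finsetSum (fun _ _ => ENNReal.summable)]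
        refine Finset.sum_congr rfl fun x _ => ?_
        simp only [← Measure.dirac_apply' x (hf _),
          ← Measure.dirac_apply' x (MeasurableSet.iUnion hf)]
        exact measure_iUnion hdisj hf
      rw [this]
      exact Measurable.tsum fun i =>
        (measurable_from_top (f := fun n : ℕ => (n : ℝ≥0∞))).comp (ih i)
    refine measurable_to_countable' fun m => ?_
    have := h1 (measurableSet_singleton (m : ℝ≥0∞))
    convert! this using 1
    ext B; simp

end Counting

/-! ### Enumerating points of finite configurations -/
section Enumeration

variable {d : ℕ} {D : Set (Sp d)}

/-- The configuration of the points `x_1, …, x_n`, for pairwise distinct points of `D`; the empty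
configuration otherwise. -/
noncomputable def FinConf.ofPts (D : Set (Sp d)) (n : ℕ) (x : Fin n → Sp d) : FinConf D := by
  classical
  exact if h : x ∈ cube D n ∧ Injective x then
    ⟨Finset.univ.image x, by
      intro y hy
      simp only [Finset.coe_image, Finset.coe_univ, image_univ, mem_range] at hy
      obtain ⟨i, rfl⟩ := hy; exact h.1 i⟩
  else ⟨∅, by simp⟩

theorem FinConf.coe_ofPts {n : ℕ} {x : Fin n → Sp d} (h : x ∈ cube D n ∧ Injective x) :
    ((FinConf.ofPts D n x).1 : Set (Sp d)) = range x := by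
  classical
  simp [FinConf.ofPts, h]

theorem FinConf.card_ofPts {n : ℕ} {x : Fin n → Sp d} (h : x ∈ cube D n ∧ Injective x) :
    (FinConf.ofPts D n x).1.card = n := by
  classical
  have : (FinConf.ofPts D n x).1 = Finset.univ.image x := by
    rw [← Finset.coe_inj, FinConf.coe_ofPts h]; simp
  rw [this, Finset.card_image_of_injective _ h.2, Finset.card_fin]

theorem FinConf.num_ofPts {n : ℕ} {x : Fin n → Sp d} (h : x ∈ cube D n ∧ Injective x)
    (A : Set (Sp d)) : ((FinConf.ofPts D n x).num A : ℝ≥0∞) = ∑ i, A.indicator 1 (x i) := by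
  classical
  rw [FinConf.coe_num_eq_sum]
  have : (FinConf.ofPts D n x).1 = Finset.univ.image x := by
    rw [← Finset.coe_inj, FinConf.coe_ofPts h]; simp
  rw [this, Finset.sum_image (fun i _ j _ hij => h.2 hij)]

theorem measurableSet_cube (hD : MeasurableSet D) (n : ℕ) : MeasurableSet (cube D n) := by
  have : cube D n = univ.pi fun _ => D := by ext x; simp [cube]
  rw [this]
  exact MeasurableSet.univ_pi fun _ => hD

theorem measurableSet_injective (n : ℕ) : MeasurableSet {x : Fin n → Sp d | Injective x} := by
  have : {x : Fin n → Sp d | Injective x} = ⋂ i, ⋂ j, {x | x i = x j → i = j} := by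
    ext x; simp [Injective]
  rw [this]
  refine MeasurableSet.iInter fun i => MeasurableSet.iInter fun j => ?_
  by_cases hij : i = j
  · simp [hij]
  · have : {x : Fin n → Sp d | x i = x j → i = j} = {x | x i = x j}ᶜ := by
      ext x; simp [hij]
    rw [this]
    exact (measurableSet_eq_fun (measurable_pi_apply i) (measurable_pi_apply j)).compl

theorem FinConf.measurable_ofPts (hD : IsCompact D) (n : ℕ) :
    Measurable (FinConf.ofPts D n) := by
  classical
  have hG : MeasurableSet {x : Fin n → Sp d | x ∈ cube D n ∧ Injective x} :=
    (measurableSet_cube hD.measurableSet n).inter (measurableSet_injective n)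
  refine measurable_generateFrom ?_
  rintro _ ⟨C, m, hC, hCc, rfl⟩
  have h1 : FinConf.ofPts D n ⁻¹' {B : FinConf D | ((B.1 : Set (Sp d)) ∩ C).ncard = m} =
      ({x | x ∈ cube D n ∧ Injective x} ∩
        {x | ∑ i, C.indicator (1 : Sp d → ℝ≥0∞) (x i) = m}) ∪
      ({x | x ∈ cube D n ∧ Injective x}ᶜ ∩ {_x | 0 = m}) := by
    ext x
    by_cases hx : x ∈ cube D n ∧ Injective x
    · have := FinConf.num_ofPts hx C
      simp only [mem_preimage, mem_ofPred_eq, mem_union, mem_inter_iff, hx, true_and,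
        mem_compl_iff, not_true_eq_false, false_and, or_false, and_self]
      rw [← this, Nat.cast_inj]; rfl
    · simp [FinConf.ofPts, hx]
  rw [h1]
  refine MeasurableSet.union (hG.inter ?_) (hG.compl.inter (MeasurableSet.const _))
  refine measurableSet_eq_fun (Finset.measurable_sum _ fun i _ => ?_) measurable_const
  exact (measurable_one.indicator hCc.measurableSet).comp (measurable_pi_apply i)

theorem exists_perm_of_range_subset {α : Type*} {n : ℕ} {x y : Fin n → α} (hy : Injective y)
    (h : range y ⊆ range x) : ∃ τ : Equiv.Perm (Fin n), y = x ∘ τ := by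
  choose τ hτ using fun i => h (mem_range_self i)
  have hinj : Injective τ := fun i j hij => hy (by rw [← hτ i, ← hτ j, hij])
  exact ⟨Equiv.ofBijective τ (Finite.injective_iff_bijective.1 hinj), (funext hτ).symm⟩

/-- Without a symmetry assumption, `evalConf` evaluates `g n` at some ordering of the points. -/
theorem FinConf.exists_perm_evalConf (g : ∀ k : ℕ, (Fin k → Sp d) → ℝ) {B : FinConf D} {n : ℕ}
    {x : Fin n → Sp d} (hx : Injective x) (hB : (B.1 : Set (Sp d)) = range x) :
    ∃ τ : Equiv.Perm (Fin n), evalConf D g B = g n (x ∘ τ) := by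
  classical
  have hn : B.1.card = n := by
    have : B.1 = Finset.univ.image x := by rw [← Finset.coe_inj, hB]; simp
    rw [this, Finset.card_image_of_injective _ hx, Finset.card_fin]
  subst hn
  have hpts : Injective B.pts := Subtype.val_injective.comp B.1.equivFin.symm.injective
  obtain ⟨τ, hτ⟩ := exists_perm_of_range_subset (x := x) hpts (by
    rintro _ ⟨i, rfl⟩
    rw [← hB]
    exact (B.1.equivFin.symm i).2)
  exact ⟨τ, by rw [evalConf, hτ]⟩

theorem FinConf.exists_perm_evalConf_ofPts (g : ∀ k : ℕ, (Fin k → Sp d) → ℝ) {n : ℕ}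
    {x : Fin n → Sp d} (h : x ∈ cube D n ∧ Injective x) :
    ∃ τ : Equiv.Perm (Fin n), evalConf D g (FinConf.ofPts D n x) = g n (x ∘ τ) :=
  FinConf.exists_perm_evalConf g h.2 (FinConf.coe_ofPts h)

/-- The order statistics of a finite set of reals are determined by the counting function. -/
theorem orderEmbOfFin_le_iff (s : Finset ℝ) {n : ℕ} (h : s.card = n) (i : Fin n) (t : ℝ) :
    s.orderEmbOfFin h i ≤ t ↔ (i : ℕ) < (s.filter (· ≤ t)).card := by
  classical
  have hcard : (s.filter (· ≤ t)).card =
      (Finset.univ.filter fun j : Fin n => s.orderEmbOfFin h j ≤ t).card := by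
    have : s = Finset.univ.map (s.orderEmbOfFin h).toEmbedding := by
      simp
    conv_lhs => rw [this]
    rw [Finset.filter_map, Finset.card_map]
    rfl
  rw [hcard]
  constructor
  · intro hi
    have : Finset.Iic i ⊆ Finset.univ.filter fun j : Fin n => s.orderEmbOfFin h j ≤ t := by
      intro j hj
      simp only [Finset.mem_filter, Finset.mem_univ, true_and]
      exact ((s.orderEmbOfFin h).monotone (Finset.mem_Iic.1 hj)).trans hi
    have := Finset.card_le_card this
    rw [Fin.card_Iic] at this
    omega
  · intro hi
    by_contra hcon
    have : (Finset.univ.filter fun j : Fin n => s.orderEmbOfFin h j ≤ t) ⊆ Finset.Iio i := by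
      intro j hj
      simp only [Finset.mem_filter, Finset.mem_univ, true_and] at hj
      rw [Finset.mem_Iio]
      by_contra hji
      exact hcon (((s.orderEmbOfFin h).monotone (not_lt.1 hji)).trans hj)
    have := Finset.card_le_card this
    rw [Fin.card_Iio] at this
    omega

/-- The points of a finite configuration can be enumerated in a measurable way: the space is
Borel isomorphic to a subset of the line, where points can be listed in increasing order. Nothing is
claimed for the configurations whose number of points is not `n`. -/
theorem FinConf.exists_measurable_enumeration (hD : IsCompact D) (n : ℕ) :
    ∃ s : FinConf D → (Fin n → Sp d), Measurable s ∧
      ∀ B : FinConf D, B.1.card = n → Injective (s B) ∧ (B.1 : Set (Sp d)) = range (s B) := by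
  classical
  set e := embeddingReal (Sp d)
  have he : MeasurableEmbedding e := measurableEmbedding_embeddingReal (Sp d)
  obtain ⟨g, hg, hge⟩ := he.exists_measurable_extend (g := (id : Sp d → Sp d))
    measurable_id (fun _ => inferInstance)
  have hge' : ∀ x, g (e x) = x := fun x => congrFun hge x
  have hcard : ∀ B : FinConf D, B.1.card = n → (B.1.image e).card = n := fun B hB => by
    rw [Finset.card_image_of_injective _ he.injective, hB]
  let ψ : Fin n → FinConf D → ℝ := fun i B =>
    if h : B.1.card = n then (B.1.image e).orderEmbOfFin (hcard B h) i else 0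
  have hnum : ∀ {A : Set (Sp d)}, MeasurableSet A →
      Measurable (FinConf.num A : FinConf D → ℕ) := fun hA => FinConf.measurable_num hD hA
  have hψ : ∀ i, Measurable (ψ i) := by
    intro i
    refine measurable_of_Iic fun t => ?_
    have : ψ i ⁻¹' Iic t = ({B | B.num univ = n} ∩ {B | (i : ℕ) < B.num (e ⁻¹' Iic t)}) ∪
        ({B | B.num univ = n}ᶜ ∩ {_B | (0 : ℝ) ≤ t}) := by
      ext B
      simp only [mem_preimage, mem_Iic, mem_union, mem_inter_iff, mem_ofPred_eq, mem_compl_iff,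
        FinConf.num_univ, ψ]
      by_cases h : B.1.card = n
      · simp only [h, dif_pos, true_and, not_true_eq_false, false_and, or_false]
        rw [orderEmbOfFin_le_iff, FinConf.num_eq_card_filter, Finset.filter_image,
          Finset.card_image_of_injective _ he.injective]
        rfl
      · simp [h]
    rw [this]
    have h1 : MeasurableSet {B : FinConf D | B.num univ = n} :=
      hnum MeasurableSet.univ (measurableSet_singleton n)
    have h2 : MeasurableSet {B : FinConf D | (i : ℕ) < B.num (e ⁻¹' Iic t)} :=
      hnum (he.measurable measurableSet_Iic) (measurableSet_Ioi (a := (i : ℕ)))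
    exact (h1.inter h2).union (h1.compl.inter (MeasurableSet.const _))
  refine ⟨fun B i => g (ψ i B), measurable_pi_lambda _ fun i => hg.comp (hψ i), ?_⟩
  intro B hB
  have hψB : ∀ i, ψ i B = (B.1.image e).orderEmbOfFin (hcard B hB) i := fun i => by
    simp [ψ, hB]
  have hmem : ∀ i, ∃ x ∈ B.1, e x = ψ i B := by
    intro i
    have := (B.1.image e).orderEmbOfFin_mem (hcard B hB) i
    rw [← hψB] at this
    simpa using this
  constructor
  · intro i j hij
    obtain ⟨x, _, hx⟩ := hmem i
    obtain ⟨y, _, hy⟩ := hmem j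
    simp only at hij
    rw [← hx, ← hy, hge', hge'] at hij
    have : ψ i B = ψ j B := by rw [← hx, ← hy, hij]
    rw [hψB, hψB] at this
    exact ((B.1.image e).orderEmbOfFin (hcard B hB)).injective this
  · ext y
    simp only [Finset.mem_coe, mem_range]
    constructor
    · intro hy
      have : e y ∈ range ((B.1.image e).orderEmbOfFin (hcard B hB)) := by
        rw [Finset.range_orderEmbOfFin]; simpa using ⟨y, hy, rfl⟩
      obtain ⟨i, hi⟩ := this
      exact ⟨i, by rw [hψB, hi, hge']⟩
    · rintro ⟨i, rfl⟩
      obtain ⟨x, hxB, hx⟩ := hmem i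
      rw [← hx, hge']; exact hxB

/-- Almost sure properties of the configuration of the points `x_1, …, x_n` hold almost surely for
the image measure, without any measurability requirement, if the law of `(x_1, …, x_n)` is
invariant under permutations. -/
theorem FinConf.ae_map_ofPts (hD : IsCompact D) {n : ℕ} {m : Measure (Fin n → Sp d)}
    (hperm : ∀ σ : Equiv.Perm (Fin n), MeasurePreserving (fun x : Fin n → Sp d => x ∘ σ) m m)
    (hgood : ∀ᵐ x ∂m, x ∈ cube D n ∧ Injective x) {p : FinConf D → Prop}
    (hp : ∀ᵐ x ∂m, p (FinConf.ofPts D n x)) : ∀ᵐ B ∂m.map (FinConf.ofPts D n), p B := by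
  obtain ⟨s, hs, hs'⟩ := FinConf.exists_measurable_enumeration hD n
  have hp2 : ∀ᵐ x ∂m, (x ∈ cube D n ∧ Injective x) ∧ p (FinConf.ofPts D n x) := hgood.and hp
  obtain ⟨N, hN1, hN2, hN3⟩ := exists_measurable_superset_of_null (ae_iff.1 hp2)
  have hcardm : MeasurableSet {B : FinConf D | B.1.card = n} := by
    have := FinConf.measurable_num hD MeasurableSet.univ (measurableSet_singleton n)
    convert! this using 1
    ext B; simp [FinConf.num_univ]
  have hT : MeasurableSet ({B : FinConf D | B.1.card = n}ᶜ ∪ s ⁻¹' N) := hcardm.compl.union (hs hN2)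
  rw [ae_iff]
  -- outside a null set, the exceptional configurations have a measurable enumeration in `N`; for the
  -- configuration of `x_1, …, x_n`, this enumeration is a permutation of `x`
  refine measure_mono_null (t := {B : FinConf D | B.1.card = n}ᶜ ∪ s ⁻¹' N) ?_ ?_
  · intro B hB
    by_cases hc : B.1.card = n
    · right
      obtain ⟨h1, h2⟩ := hs' B hc
      refine hN1 fun hcon => hB ?_
      have : FinConf.ofPts D n (s B) = B := by
        apply Subtype.ext
        rw [← Finset.coe_inj, FinConf.coe_ofPts hcon.1, h2]
      rw [← this]; exact hcon.2
    · exact Or.inl hc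
  · rw [Measure.map_apply (FinConf.measurable_ofPts hD n) hT]
    refine measure_mono_null (t := {x | ¬ (x ∈ cube D n ∧ Injective x)} ∪
      ⋃ σ : Equiv.Perm (Fin n), (fun x : Fin n → Sp d => x ∘ σ) ⁻¹' N) ?_ ?_
    · intro x hx
      by_cases hg : x ∈ cube D n ∧ Injective x
      · right
        rcases hx with hx | hx
        · exact absurd (FinConf.card_ofPts hg) hx
        · obtain ⟨h1, h2⟩ := hs' _ (FinConf.card_ofPts hg)
          rw [FinConf.coe_ofPts hg] at h2
          obtain ⟨τ, hτ⟩ := exists_perm_of_range_subset h1 h2.symm.subset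
          refine mem_iUnion.2 ⟨τ, ?_⟩
          rw [mem_preimage, ← hτ]
          exact hx
      · exact Or.inl hg
    · refine measure_union_null (ae_iff.1 hgood) (measure_iUnion_null fun σ => ?_)
      rw [(hperm σ).measure_preimage hN2.nullMeasurableSet, hN3]

end Enumeration

/-! ### Laws determined by moments over disjoint sets -/
section Uniqueness

variable {d : ℕ} {D : Set (Sp d)}

/-- The cell of `x` in the `m`-th of a sequence of finite Borel partitions that separate points. -/
noncomputable def cell (d m : ℕ) (x : Sp d) : Fin m → Bool :=
  fun i => MeasurableSpace.mapNatBool (Sp d) x i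

theorem measurable_cell (m : ℕ) : Measurable (cell d m) :=
  measurable_pi_lambda _ fun i =>
    (measurable_pi_apply (i : ℕ)).comp (MeasurableSpace.measurable_mapNatBool (Sp d))

/-- The points of a finite set eventually lie in distinct cells. -/
theorem eventually_cell_injOn (B : Finset (Sp d)) :
    ∀ᶠ m in atTop, InjOn (cell d m) (B : Set (Sp d)) := by
  have h : ∀ x ∈ B, ∀ y ∈ B, ∀ᶠ m in atTop, cell d m x = cell d m y → x = y := by
    intro x _ y _
    by_cases hxy : x = y
    · exact Eventually.of_forall fun _ _ => hxy
    · have h1 : MeasurableSpace.mapNatBool (Sp d) x ≠ MeasurableSpace.mapNatBool (Sp d) y :=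
        fun hcon => hxy (MeasurableSpace.injective_mapNatBool (Sp d) hcon)
      obtain ⟨i, hi⟩ := Function.ne_iff.1 h1
      filter_upwards [eventually_gt_atTop i] with m hm hcon
      exact absurd (congrFun hcon ⟨i, hm⟩) hi
  have h2 : ∀ᶠ m in atTop, ∀ x ∈ B, ∀ y ∈ B, cell d m x = cell d m y → x = y :=
    (Finset.eventually_all B).2 fun x hx => (Finset.eventually_all B).2 fun y hy => h x hx y hy
  filter_upwards [h2] with m hm x hx y hy hxy
  exact hm x hx y hy hxy

/-- The sets `{no point in A}`. -/
def voidEvents (D : Set (Sp d)) : Set (Set (FinConf D)) :=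
  {V | ∃ A : Set (Sp d), MeasurableSet A ∧ V = {B : FinConf D | B.num A = 0}}

theorem isPiSystem_voidEvents : IsPiSystem (voidEvents D) := by
  rintro _ ⟨A, hA, rfl⟩ _ ⟨A', hA', rfl⟩ _
  refine ⟨A ∪ A', hA.union hA', ?_⟩
  ext B
  simp only [mem_inter_iff, mem_ofPred_eq, FinConf.num_eq_zero_iff, mem_union, not_or]
  exact ⟨fun h x hx => ⟨h.1 x hx, h.2 x hx⟩, fun h => ⟨fun x hx => (h x hx).1, fun x hx => (h x hx).2⟩⟩

theorem measurable_min_one {α : Type*} {m0 : MeasurableSpace α} {f : α → ℕ}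
    (h : MeasurableSet {a | f a = 0}) : Measurable fun a => min 1 (f a) := by
  have heq : (fun a => min 1 (f a)) = {a | f a = 0}ᶜ.indicator 1 := by
    funext a
    by_cases ha : f a = 0
    · simp [ha]
    · have : 1 ≤ f a := Nat.one_le_iff_ne_zero.2 ha
      simp [ha, this]
  rw [heq]
  exact measurable_one.indicator h.compl

/-- The void events generate the sigma-field of the configurations. -/
theorem generateFrom_voidEvents (hD : IsCompact D) :
    (inferInstance : MeasurableSpace (FinConf D)) = MeasurableSpace.generateFrom (voidEvents D) := by
  refine le_antisymm ?_ (MeasurableSpace.generateFrom_le ?_)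
  · refine MeasurableSpace.generateFrom_le ?_
    rintro _ ⟨C, k, hC, hCc, rfl⟩
    -- a count is the limit of the number of occupied cells
    have h1 : ∀ m : ℕ, @Measurable _ _ (MeasurableSpace.generateFrom (voidEvents D)) _
        (fun B : FinConf D => ∑ s : Fin m → Bool, min 1 (B.num (C ∩ cell d m ⁻¹' {s}))) := by
      intro m
      refine @Finset.measurable_sum _ _ _ _ _ _ (MeasurableSpace.generateFrom (voidEvents D)) _ _
        fun s _ => ?_
      have hv : @MeasurableSet _ (MeasurableSpace.generateFrom (voidEvents D))
          {B : FinConf D | B.num (C ∩ cell d m ⁻¹' {s}) = 0} :=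
        MeasurableSpace.measurableSet_generateFrom ⟨_, hCc.measurableSet.inter
          (measurable_cell m (measurableSet_singleton s)), rfl⟩
      exact @measurable_min_one _ (MeasurableSpace.generateFrom (voidEvents D)) _ hv
    have h2 : @Measurable _ _ (MeasurableSpace.generateFrom (voidEvents D)) _
        (FinConf.num C : FinConf D → ℕ) := by
      refine @measurable_of_tendsto_metrizable _ _ (MeasurableSpace.generateFrom (voidEvents D))
        _ _ _ _ _ _ h1 ?_
      refine tendsto_pi_nhds.2 fun B => ?_
      refine tendsto_nhds_of_eventually_eq ?_
      filter_upwards [eventually_cell_injOn B.1] with m hm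
      rw [← FinConf.sum_num_preimage (cell d m) C B]
      refine Finset.sum_congr rfl fun s _ => ?_
      exact min_eq_right (FinConf.num_le_one_of_injOn _ _ _ hm s)
    exact h2 (measurableSet_singleton k)
  · rintro _ ⟨A, hA, rfl⟩
    exact FinConf.measurable_num hD hA (measurableSet_singleton 0)

theorem measurable_coe_num (hD : IsCompact D) {A : Set (Sp d)} (hA : MeasurableSet A) :
    Measurable (fun B : FinConf D => (B.num A : ℝ≥0∞)) :=
  (measurable_from_top (f := fun n : ℕ => (n : ℝ≥0∞))).comp (FinConf.measurable_num hD hA)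

theorem measurable_coe_num_real (hD : IsCompact D) {A : Set (Sp d)} (hA : MeasurableSet A) :
    Measurable (fun B : FinConf D => (B.num A : ℝ)) :=
  (measurable_from_top (f := fun n : ℕ => (n : ℝ))).comp (FinConf.measurable_num hD hA)

/-- The two laws have the same moments `E ∏ N(A_i)` over disjoint Borel sets. -/
def SameDisjointMoments (P Q : Measure (FinConf D)) : Prop :=
  ∀ (k : ℕ) (A : Fin k → Set (Sp d)), (∀ i, MeasurableSet (A i)) → Pairwise (Disjoint on A) →
    ∫⁻ B, ∏ i, (B.num (A i) : ℝ≥0∞) ∂P = ∫⁻ B, ∏ i, (B.num (A i) : ℝ≥0∞) ∂Q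

theorem SameDisjointMoments.finset {P Q : Measure (FinConf D)} (h : SameDisjointMoments P Q)
    {κ : Type*} (t : Finset κ) (A : κ → Set (Sp d)) (hA : ∀ i, MeasurableSet (A i))
    (hd : Pairwise (Disjoint on A)) :
    ∫⁻ B, ∏ i ∈ t, (B.num (A i) : ℝ≥0∞) ∂P = ∫⁻ B, ∏ i ∈ t, (B.num (A i) : ℝ≥0∞) ∂Q := by
  have e : ∀ B : FinConf D, ∏ i ∈ t, (B.num (A i) : ℝ≥0∞) =
      ∏ i, (B.num (A (t.equivFin.symm i)) : ℝ≥0∞) := by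
    intro B
    rw [← Finset.prod_coe_sort t]
    exact (Equiv.prod_comp t.equivFin.symm (fun i : t => (B.num (A i) : ℝ≥0∞))).symm
  simp only [e]
  refine h _ _ (fun i => hA _) fun i j hij => hd fun hcon => hij ?_
  exact t.equivFin.symm.injective (Subtype.ext hcon)

theorem FinConf.prod_num_le {κ : Type*} [Fintype κ] (c : Sp d → κ) (A : Set (Sp d)) (t : Finset κ)
    (B : FinConf D) : ∏ s ∈ t, (B.num (A ∩ c ⁻¹' {s})) ≤ 2 ^ B.num univ := by
  calc ∏ s ∈ t, (B.num (A ∩ c ⁻¹' {s})) ≤ ∏ s ∈ t, 2 ^ (B.num (A ∩ c ⁻¹' {s})) :=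
        Finset.prod_le_prod' fun s _ => Nat.lt_two_pow_self.le
    _ ≤ ∏ s, 2 ^ (B.num (A ∩ c ⁻¹' {s})) :=
        Finset.prod_le_prod_of_subset_of_one_le' (Finset.subset_univ _)
          fun _ _ _ => Nat.one_le_two_pow
    _ = 2 ^ B.num A := by rw [Finset.prod_pow_eq_pow_sum, FinConf.sum_num_preimage]
    _ ≤ 2 ^ B.num univ := Nat.pow_le_pow_right two_pos (FinConf.num_mono (subset_univ _) B)

/-- `2^N` is the limit of the products `∏ (1 + N(cell))`, whose means only involve moments over
disjoint sets. -/
theorem SameDisjointMoments.lintegral_two_pow_le (hD : IsCompact D) {P Q : Measure (FinConf D)}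
    (h : SameDisjointMoments P Q) :
    ∫⁻ B : FinConf D, (2 : ℝ≥0∞) ^ B.num univ ∂P ≤ ∫⁻ B : FinConf D, (2 : ℝ≥0∞) ^ B.num univ ∂Q := by
  classical
  let f : ℕ → FinConf D → ℝ≥0∞ := fun m B =>
    ∏ s : Fin m → Bool, (1 + (B.num (univ ∩ cell d m ⁻¹' {s}) : ℝ≥0∞))
  have hAm : ∀ m (s : Fin m → Bool), MeasurableSet (univ ∩ cell d m ⁻¹' {s}) := fun m s =>
    MeasurableSet.univ.inter (measurable_cell m (measurableSet_singleton s))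
  have hfm : ∀ m, Measurable (f m) := fun m =>
    Finset.measurable_prod _ fun s _ => (measurable_coe_num hD (hAm m s)).const_add 1
  have hdisj : ∀ m, Pairwise (Disjoint on fun s : Fin m → Bool => univ ∩ cell d m ⁻¹' {s}) := by
    intro m s s' hss
    refine Disjoint.mono inter_subset_right inter_subset_right ?_
    exact (disjoint_singleton.2 hss).preimage _
  have hfeq : ∀ m, ∫⁻ B, f m B ∂P = ∫⁻ B, f m B ∂Q := by
    intro m
    have e : ∀ B : FinConf D, f m B = ∑ t ∈ Finset.univ.powerset,
        ∏ s ∈ t, (B.num (univ ∩ cell d m ⁻¹' {s}) : ℝ≥0∞) := fun B => Finset.prod_one_add _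
    simp only [e]
    rw [lintegral_finsetSum _ (fun t _ => Finset.measurable_prod _ fun s _ =>
        measurable_coe_num hD (hAm m s)), lintegral_finsetSum _ (fun t _ =>
        Finset.measurable_prod _ fun s _ => measurable_coe_num hD (hAm m s))]
    exact Finset.sum_congr rfl fun t _ => h.finset t _ (hAm m) (hdisj m)
  have hle : ∀ m B, f m B ≤ (2 : ℝ≥0∞) ^ B.num univ := by
    intro m B
    rw [← FinConf.sum_num_preimage (cell d m) univ B, ← Finset.prod_pow_eq_pow_sum]
    refine Finset.prod_le_prod' fun s _ => ?_
    have : 1 + B.num (univ ∩ cell d m ⁻¹' {s}) ≤ 2 ^ B.num (univ ∩ cell d m ⁻¹' {s}) := by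
      rw [add_comm]; exact Nat.lt_two_pow_self
    exact_mod_cast this
  have hlim : ∀ B, liminf (fun m => f m B) atTop = (2 : ℝ≥0∞) ^ B.num univ := by
    intro B
    refine Tendsto.liminf_eq (tendsto_nhds_of_eventually_eq ?_)
    filter_upwards [eventually_cell_injOn B.1] with m hm
    rw [← FinConf.sum_num_preimage (cell d m) univ B, ← Finset.prod_pow_eq_pow_sum]
    refine Finset.prod_congr rfl fun s _ => ?_
    have := FinConf.num_le_one_of_injOn _ univ _ hm s
    interval_cases B.num (univ ∩ cell d m ⁻¹' {s}) <;> norm_num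
  calc ∫⁻ B : FinConf D, (2 : ℝ≥0∞) ^ B.num univ ∂P = ∫⁻ B, liminf (fun m => f m B) atTop ∂P := by
        simp only [hlim]
    _ ≤ liminf (fun m => ∫⁻ B, f m B ∂P) atTop := lintegral_liminf_le hfm
    _ ≤ liminf (fun _ : ℕ => ∫⁻ B : FinConf D, (2 : ℝ≥0∞) ^ B.num univ ∂Q) atTop := by
        refine liminf_le_liminf (Eventually.of_forall fun m => ?_)
        simp only [hfeq]
        exact lintegral_mono (hle m)
    _ = _ := liminf_const _

/-- Two laws of finite configurations with the same moments `E ∏ N(A_i)` over disjoint sets agree,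
if `2^N` is integrable: `∏ (1 - N(A ∩ cell))` tends to the indicator of the event that `A` contains
no point, and these events determine the law. -/
theorem SameDisjointMoments.eq (hD : IsCompact D) {P Q : Measure (FinConf D)}
    [IsProbabilityMeasure P] [IsProbabilityMeasure Q] (h : SameDisjointMoments P Q)
    (hQ : ∫⁻ B : FinConf D, (2 : ℝ≥0∞) ^ B.num univ ∂Q ≠ ∞) : P = Q := by
  classical
  refine ext_of_generate_finite _ (generateFrom_voidEvents hD) isPiSystem_voidEvents ?_ (by simp)
  rintro _ ⟨A, hA, rfl⟩
  -- `2^N` dominates the alternating products, under both laws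
  have hP : ∫⁻ B : FinConf D, (2 : ℝ≥0∞) ^ B.num univ ∂P ≠ ∞ :=
    ne_top_of_le_ne_top hQ (h.lintegral_two_pow_le hD)
  have h2m : Measurable (fun B : FinConf D => (2 : ℝ) ^ B.num univ) :=
    (measurable_from_top (f := fun n : ℕ => (2 : ℝ) ^ n)).comp
      (FinConf.measurable_num hD MeasurableSet.univ)
  have hint : ∀ ξ : Measure (FinConf D), ∫⁻ B : FinConf D, (2 : ℝ≥0∞) ^ B.num univ ∂ξ ≠ ∞ →
      Integrable (fun B : FinConf D => (2 : ℝ) ^ B.num univ) ξ := by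
    intro ξ hξ
    refine ⟨h2m.aestronglyMeasurable, ?_⟩
    rw [hasFiniteIntegral_iff_ofReal (ae_of_all _ fun B => by positivity)]
    refine lt_of_eq_of_lt (lintegral_congr fun B => ?_) hξ.lt_top
    rw [ENNReal.ofReal_pow (by norm_num)]; norm_num
  have hAm : ∀ m (s : Fin m → Bool), MeasurableSet (A ∩ cell d m ⁻¹' {s}) := fun m s =>
    hA.inter (measurable_cell m (measurableSet_singleton s))
  have hdisj : ∀ m, Pairwise (Disjoint on fun s : Fin m → Bool => A ∩ cell d m ⁻¹' {s}) := by
    intro m s s' hss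
    refine Disjoint.mono inter_subset_right inter_subset_right ?_
    exact (disjoint_singleton.2 hss).preimage _
  let f : ℕ → FinConf D → ℝ := fun m B =>
    ∏ s : Fin m → Bool, (1 + -(B.num (A ∩ cell d m ⁻¹' {s}) : ℝ))
  have hpm : ∀ m (t : Finset (Fin m → Bool)), Measurable
      (fun B : FinConf D => ∏ s ∈ t, (B.num (A ∩ cell d m ⁻¹' {s}) : ℝ)) := fun m t =>
    Finset.measurable_prod _ fun s _ => measurable_coe_num_real hD (hAm m s)
  have hpi : ∀ ξ : Measure (FinConf D), ∫⁻ B : FinConf D, (2 : ℝ≥0∞) ^ B.num univ ∂ξ ≠ ∞ → ∀ m t,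
      Integrable (fun B : FinConf D => ∏ s ∈ t, (B.num (A ∩ cell d m ⁻¹' {s}) : ℝ)) ξ := by
    intro ξ hξ m t
    refine (hint ξ hξ).mono' (hpm m t).aestronglyMeasurable (ae_of_all _ fun B => ?_)
    rw [Real.norm_of_nonneg (by positivity)]
    exact_mod_cast FinConf.prod_num_le (cell d m) A t B
  have hfe : ∀ m B, f m B = ∑ t ∈ Finset.univ.powerset,
      (-1) ^ t.card * ∏ s ∈ t, (B.num (A ∩ cell d m ⁻¹' {s}) : ℝ) := by
    intro m B
    simp only [f]
    rw [Finset.prod_one_add]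
    refine Finset.sum_congr rfl fun t _ => ?_
    rw [Finset.prod_neg]
  have hpeq : ∀ m (t : Finset (Fin m → Bool)),
      ∫ B, ∏ s ∈ t, (B.num (A ∩ cell d m ⁻¹' {s}) : ℝ) ∂P =
      ∫ B, ∏ s ∈ t, (B.num (A ∩ cell d m ⁻¹' {s}) : ℝ) ∂Q := by
    intro m t
    have e : ∀ B : FinConf D, ENNReal.ofReal (∏ s ∈ t, (B.num (A ∩ cell d m ⁻¹' {s}) : ℝ)) =
        ∏ s ∈ t, (B.num (A ∩ cell d m ⁻¹' {s}) : ℝ≥0∞) := by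
      intro B
      rw [ENNReal.ofReal_prod_of_nonneg (fun _ _ => Nat.cast_nonneg _)]
      simp
    rw [integral_eq_lintegral_of_nonneg_ae (ae_of_all _ fun B => by positivity)
      (hpm m t).aestronglyMeasurable, integral_eq_lintegral_of_nonneg_ae
      (ae_of_all _ fun B => by positivity) (hpm m t).aestronglyMeasurable]
    simp only [e]
    rw [h.finset t _ (hAm m) (hdisj m)]
  have hfeq : ∀ m, ∫ B, f m B ∂P = ∫ B, f m B ∂Q := by
    intro m
    simp only [hfe]
    rw [integral_finsetSum _ (fun t _ => (hpi P hP m t).const_mul _),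
      integral_finsetSum _ (fun t _ => (hpi Q hQ m t).const_mul _)]
    refine Finset.sum_congr rfl fun t _ => ?_
    rw [integral_const_mul, integral_const_mul, hpeq]
  have hfm : ∀ m, Measurable (f m) := fun m =>
    Finset.measurable_prod _ fun s _ => (measurable_coe_num_real hD (hAm m s)).neg.const_add 1
  have hVm : MeasurableSet {B : FinConf D | B.num A = 0} :=
    FinConf.measurable_num hD hA (measurableSet_singleton 0)
  -- once all the points are in distinct cells, some factor vanishes unless `A` contains no point
  have hlim : ∀ ξ : Measure (FinConf D), ∫⁻ B : FinConf D, (2 : ℝ≥0∞) ^ B.num univ ∂ξ ≠ ∞ →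
      Tendsto (fun m => ∫ B, f m B ∂ξ) atTop
        (𝓝 (∫ B, {B : FinConf D | B.num A = 0}.indicator (1 : FinConf D → ℝ) B ∂ξ)) := by
    intro ξ hξ
    refine tendsto_integral_of_dominated_convergence _ (fun m => (hfm m).aestronglyMeasurable)
      (hint ξ hξ) (fun m => ae_of_all _ fun B => ?_) (ae_of_all _ fun B => ?_)
    · simp only [f]
      rw [norm_prod]
      have h1 : (2 : ℝ) ^ B.num A ≤ 2 ^ B.num univ :=
        pow_le_pow_right₀ one_le_two (FinConf.num_mono (subset_univ _) B)
      refine le_trans ?_ h1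
      rw [← FinConf.sum_num_preimage (cell d m) A B, ← Finset.prod_pow_eq_pow_sum]
      refine Finset.prod_le_prod (fun _ _ => norm_nonneg _) fun s _ => ?_
      have h2 : B.num (A ∩ cell d m ⁻¹' {s}) + 1 ≤ 2 ^ B.num (A ∩ cell d m ⁻¹' {s}) :=
        Nat.lt_two_pow_self
      have h3 : (B.num (A ∩ cell d m ⁻¹' {s}) : ℝ) + 1 ≤ 2 ^ B.num (A ∩ cell d m ⁻¹' {s}) := by
        exact_mod_cast h2
      refine (norm_add_le _ _).trans ?_
      rw [norm_neg, norm_one, Real.norm_of_nonneg (Nat.cast_nonneg _)]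
      linarith
    · refine tendsto_nhds_of_eventually_eq ?_
      filter_upwards [eventually_cell_injOn B.1] with m hm
      have hle := FinConf.num_le_one_of_injOn (cell d m) A B hm
      by_cases hB : B.num A = 0
      · have h0 : ∀ s, B.num (A ∩ cell d m ⁻¹' {s}) = 0 := fun s =>
          Nat.le_zero.1 (hB ▸ FinConf.num_mono inter_subset_left B)
        simp [f, h0, hB]
      · rw [← FinConf.sum_num_preimage (cell d m) A B] at hB
        have : ∃ s, B.num (A ∩ cell d m ⁻¹' {s}) ≠ 0 := by
          by_contra hcon; push Not at hcon; exact hB (by simp [hcon])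
        obtain ⟨s, hs⟩ := this
        have hs1 : B.num (A ∩ cell d m ⁻¹' {s}) = 1 := by have := hle s; omega
        rw [FinConf.sum_num_preimage (cell d m) A B] at hB
        have hz : f m B = 0 := Finset.prod_eq_zero (Finset.mem_univ s) (by rw [hs1]; simp)
        rw [hz]
        simp [hB]
  have hfin : ∫ B, {B : FinConf D | B.num A = 0}.indicator (1 : FinConf D → ℝ) B ∂P =
      ∫ B, {B : FinConf D | B.num A = 0}.indicator (1 : FinConf D → ℝ) B ∂Q :=
    tendsto_nhds_unique (hlim P hP) ((hlim Q hQ).congr fun m => (hfeq m).symm)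
  rw [integral_indicator_one hVm, integral_indicator_one hVm] at hfin
  exact (measureReal_eq_measureReal_iff).1 hfin

end Uniqueness

/-! ### Slater determinants -/
section Slater

variable {α ι : Type*} [MeasurableSpace α] {ν : Measure α}

/-- The Slater determinant `det (φ_{a_i}(x_j))`. -/
noncomputable def slater (φ : ι → Lp ℂ 2 ν) {n : ℕ} (a : Fin n → ι) (x : Fin n → α) : ℂ :=
  Matrix.det (Matrix.of fun i j => φ (a i) (x j))

theorem measurable_slater (φ : ι → Lp ℂ 2 ν) {n : ℕ} (a : Fin n → ι) :
    Measurable (slater φ a) := by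
  unfold slater
  simp only [Matrix.det_apply]
  refine Finset.measurable_sum _ fun σ _ => Measurable.const_smul ?_ _
  refine Finset.measurable_prod _ fun i _ => ?_
  exact (Lp.stronglyMeasurable (φ (a (σ i)))).measurable.comp (measurable_pi_apply i)

theorem enorm_slater_comp_perm_right (φ : ι → Lp ℂ 2 ν) {n : ℕ} (a : Fin n → ι)
    (σ : Equiv.Perm (Fin n)) (x : Fin n → α) : ‖slater φ a (x ∘ σ)‖ₑ = ‖slater φ a x‖ₑ := by
  have h : slater φ a (x ∘ σ) = Equiv.Perm.sign σ * slater φ a x :=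
    Matrix.det_permute' σ (Matrix.of fun i j => φ (a i) (x j))
  rw [h, enorm_mul]
  rcases Int.units_eq_one_or (Equiv.Perm.sign σ) with h | h <;> simp [h]

theorem slater_eq_zero_of_not_injective_left (φ : ι → Lp ℂ 2 ν) {n : ℕ} {a : Fin n → ι}
    (h : ¬ Injective a) (x : Fin n → α) : slater φ a x = 0 := by
  simp only [Injective, not_forall] at h
  obtain ⟨i, j, hij, hne⟩ := h
  exact Matrix.det_zero_of_row_eq hne (by ext k; simp [hij])

theorem slater_eq_zero_of_not_injective_right (φ : ι → Lp ℂ 2 ν) {n : ℕ} (a : Fin n → ι)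
    {x : Fin n → α} (h : ¬ Injective x) : slater φ a x = 0 := by
  simp only [Injective, not_forall] at h
  obtain ⟨i, j, hij, hne⟩ := h
  exact Matrix.det_zero_of_column_eq hne (by intro k; simp [hij])

theorem lintegral_enorm_sq_Lp (f : Lp ℂ 2 ν) : ∫⁻ y, ‖f y‖ₑ ^ 2 ∂ν = ‖f‖ₑ ^ 2 := by
  have h := eLpNorm_nnreal_pow_eq_lintegral (f := f) (μ := ν) (p := 2) two_ne_zero
  have h2 : ‖f‖ₑ = eLpNorm f 2 ν := by
    rw [Lp.enorm_def]
  rw [h2]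
  simp only [NNReal.coe_ofNat, ENNReal.coe_ofNat, ENNReal.rpow_ofNat] at h
  exact h.symm

/-- Parseval's identity for a finite orthonormal family in `L²`. -/
theorem lintegral_enorm_sq_sum {φ : ι → Lp ℂ 2 ν} (hφ : Orthonormal ℂ φ) {n : ℕ} {a : Fin n → ι}
    (ha : Injective a) (z : Fin n → ℂ) :
    ∫⁻ y, ‖∑ j, z j * φ (a j) y‖ₑ ^ 2 ∂ν = ∑ j, ‖z j‖ₑ ^ 2 := by
  have hae : (fun y => ∑ j, z j * φ (a j) y) =ᵐ[ν] ⇑(∑ j, z j • φ (a j)) := by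
    have h1 := Lp.coeFn_finsetSum Finset.univ (fun j => z j • φ (a j))
    have h2 : ∀ᵐ y ∂ν, ∀ j, (z j • φ (a j) : Lp ℂ 2 ν) y = z j * φ (a j) y :=
      ae_all_iff.2 fun j => by
        filter_upwards [Lp.coeFn_smul (z j) (φ (a j))] with y hy
        rw [hy]; rfl
    filter_upwards [h1, h2] with y hy1 hy2
    rw [hy1, Finset.sum_apply]
    exact Finset.sum_congr rfl fun j _ => (hy2 j).symm
  have e1 : ∫⁻ y, ‖∑ j, z j * φ (a j) y‖ₑ ^ 2 ∂ν =
      ∫⁻ y, ‖(∑ j, z j • φ (a j) : Lp ℂ 2 ν) y‖ₑ ^ 2 ∂ν :=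
    lintegral_congr_ae (hae.mono fun y hy => by simp only [hy])
  have horth := hφ.comp a ha
  have hn : ‖(∑ j, z j • φ (a j) : Lp ℂ 2 ν)‖ ^ 2 = ∑ j, ‖z j‖ ^ 2 := by
    have h1 := horth.inner_sum z z Finset.univ
    rw [inner_self_eq_norm_sq_to_K] at h1
    have h2 : ∀ j, conj (z j) * z j = ((‖z j‖ ^ 2 : ℝ) : ℂ) := fun j => by
      rw [Complex.conj_mul']; push_cast; rfl
    simp only [h2] at h1
    rw [← Complex.ofReal_sum] at h1
    have h3 : ((‖(∑ j, z j • φ (a j) : Lp ℂ 2 ν)‖ ^ 2 : ℝ) : ℂ) = ((∑ j, ‖z j‖ ^ 2 : ℝ) : ℂ) := by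
      rw [← h1]; push_cast; rfl
    exact_mod_cast h3
  rw [e1, lintegral_enorm_sq_Lp, ← ofReal_norm, ← ENNReal.ofReal_pow (norm_nonneg _), hn,
    ENNReal.ofReal_sum_of_nonneg (fun _ _ => by positivity)]
  refine Finset.sum_congr rfl fun j _ => ?_
  rw [ENNReal.ofReal_pow (norm_nonneg _), ofReal_norm]

/-- Integrating out the last point of a squared Slater determinant: expand along the last column
and use orthonormality. -/
theorem lintegral_slater_snoc {φ : ι → Lp ℂ 2 ν} (hφ : Orthonormal ℂ φ) {n : ℕ}
    {a : Fin (n + 1) → ι} (ha : Injective a) (x : Fin n → α) :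
    ∫⁻ y, ‖slater φ a (Fin.snoc x y)‖ₑ ^ 2 ∂ν = ∑ j : Fin (n + 1), ‖slater φ (a ∘ j.succAbove) x‖ₑ ^ 2 := by
  have h : ∀ y, slater φ a (Fin.snoc x y) =
      ∑ j : Fin (n + 1), ((-1) ^ ((j : ℕ) + (Fin.last n : ℕ)) * slater φ (a ∘ j.succAbove) x) * φ (a j) y := by
    intro y
    rw [slater, Matrix.det_succ_column _ (Fin.last n)]
    refine Finset.sum_congr rfl fun j _ => ?_
    have : (Matrix.of fun i j => φ (a i) ((Fin.snoc x y : Fin (n + 1) → α) j)).submatrix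
        j.succAbove (Fin.last n).succAbove = Matrix.of fun i k => φ ((a ∘ j.succAbove) i) (x k) := by
      ext i k; simp
    rw [this, Matrix.of_apply, Fin.snoc_last, slater]
    ring
  simp only [h]
  rw [lintegral_enorm_sq_sum hφ ha]
  refine Finset.sum_congr rfl fun j _ => ?_
  rw [enorm_mul, enorm_pow, enorm_neg, enorm_one, one_pow, one_mul]

end Slater

/-! ### The Cauchy–Binet formula and determinants of kernels -/
section CauchyBinet

variable {ι : Type*}

/-- The Cauchy–Binet formula, as a sum over all tuples of indices. -/
theorem factorial_mul_det_sum_mul {n : ℕ} (s : Finset ι) (u w : Fin n → ι → ℂ) :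
    (n.factorial : ℂ) * Matrix.det (Matrix.of fun i j => ∑ l ∈ s, u i l * w j l) =
      ∑ a ∈ Fintype.piFinset fun _ : Fin n => s,
        Matrix.det (Matrix.of fun i j => u j (a i)) * Matrix.det (Matrix.of fun i j => w j (a i)) := by
  classical
  set W : (Fin n → ι) → ℂ := fun a => Matrix.det (Matrix.of fun i j => w j (a i))
  have h1 : Matrix.det (Matrix.of fun i j => ∑ l ∈ s, u i l * w j l) =
      ∑ a ∈ Fintype.piFinset fun _ : Fin n => s, (∏ i, u i (a i)) * W a := by
    have h2 : Matrix.det (Matrix.of fun i j => ∑ l ∈ s, u i l * w j l) =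
        (Matrix.detRowAlternating (n := Fin n) (R := ℂ)).toMultilinearMap
          (fun i => ∑ l ∈ s, u i l • (fun j => w j l)) := by
      change Matrix.det _ = Matrix.det _
      congr 1
      ext i j
      simp [Finset.sum_apply]
    rw [h2, MultilinearMap.map_sum_finset]
    refine Finset.sum_congr rfl fun a _ => ?_
    rw [MultilinearMap.map_smul_univ]
    rfl
  -- relabel the tuples by each permutation, and average
  have hperm : ∀ σ : Equiv.Perm (Fin n), ∑ a ∈ Fintype.piFinset fun _ : Fin n => s,
      (∏ i, u i (a i)) * W a = ∑ a ∈ Fintype.piFinset fun _ : Fin n => s,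
        (Equiv.Perm.sign σ • ∏ i, u i (a (σ i))) * W a := by
    intro σ
    refine (Finset.sum_equiv (σ.arrowCongr (Equiv.refl ι)).symm ?_ ?_).symm
    · intro a
      simp only [Fintype.mem_piFinset]
      constructor
      · intro h i; exact h _
      · intro h i; simpa using h (σ.symm i)
    · intro a _
      have e1 : ((σ.arrowCongr (Equiv.refl ι)).symm a) = a ∘ σ := by ext i; simp
      have e2 : W (a ∘ σ) = Equiv.Perm.sign σ * W a :=
        Matrix.det_permute σ (Matrix.of fun i j => w j (a i))
      rw [e1, e2, Units.smul_def, zsmul_eq_mul]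
      simp only [Function.comp_apply]
      ring
  have h3 : (n.factorial : ℂ) * ∑ a ∈ Fintype.piFinset fun _ : Fin n => s, (∏ i, u i (a i)) * W a =
      ∑ σ : Equiv.Perm (Fin n), ∑ a ∈ Fintype.piFinset fun _ : Fin n => s,
        (Equiv.Perm.sign σ • ∏ i, u i (a (σ i))) * W a := by
    rw [← Finset.sum_congr rfl fun σ _ => hperm σ, Finset.sum_const, Finset.card_univ,
      Fintype.card_perm, Fintype.card_fin, nsmul_eq_mul]
  rw [h1, h3, Finset.sum_comm]
  refine Finset.sum_congr rfl fun a _ => ?_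
  rw [← Finset.sum_mul]
  congr 1
  rw [Matrix.det_apply]
  rfl

end CauchyBinet

section Expansion

variable {α ι : Type*} [MeasurableSpace α] {ν : Measure α}

/-- The determinant of a kernel with nonnegative eigenvalues is a superposition of squared Slater
determinants. -/
theorem factorial_mul_ofReal_det_eq_tsum (φ : ι → Lp ℂ 2 ν) (q : ι → NNReal) {k : α → α → ℂ}
    {n : ℕ} {x : Fin n → α}
    (h : ∀ i j, HasSum (fun l => ((q l : ℝ) : ℂ) * φ l (x i) * conj (φ l (x j))) (k (x i) (x j))) :
    (n.factorial : ℝ≥0∞) * ENNReal.ofReal (Matrix.det (Matrix.of fun i j => k (x i) (x j))).re =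
        ∑' a : Fin n → ι, (∏ i, (q (a i) : ℝ≥0∞)) * ‖slater φ a x‖ₑ ^ 2 ∧
      0 ≤ (Matrix.det (Matrix.of fun i j => k (x i) (x j))).re := by
  classical
  -- the formula holds for partial sums of the kernel; then pass to the limit
  have hfin : ∀ s : Finset ι, (n.factorial : ℂ) * Matrix.det (Matrix.of fun i j =>
      ∑ l ∈ s, ((q l : ℝ) : ℂ) * φ l (x i) * conj (φ l (x j))) =
      ((∑ a ∈ Fintype.piFinset fun _ : Fin n => s,
        (∏ i, (q (a i) : ℝ)) * ‖slater φ a x‖ ^ 2 : ℝ) : ℂ) := by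
    intro s
    rw [factorial_mul_det_sum_mul s (fun i l => ((q l : ℝ) : ℂ) * φ l (x i))
      (fun j l => conj (φ l (x j)))]
    push_cast
    refine Finset.sum_congr rfl fun a _ => ?_
    have e1 : Matrix.det (Matrix.of fun i j => ((q (a i) : ℝ) : ℂ) * φ (a i) (x j)) =
        (∏ i, ((q (a i) : ℝ) : ℂ)) * slater φ a x :=
      Matrix.det_mul_column (fun i => ((q (a i) : ℝ) : ℂ)) (Matrix.of fun i j => φ (a i) (x j))
    have e2 : Matrix.det (Matrix.of fun i j => conj (φ (a i) (x j))) = conj (slater φ a x) := by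
      rw [slater, RingHom.map_det]; rfl
    rw [e1, e2, mul_assoc, Complex.mul_conj']
  have hlim : Tendsto (fun s : Finset ι => Matrix.det (Matrix.of fun i j =>
      ∑ l ∈ s, ((q l : ℝ) : ℂ) * φ l (x i) * conj (φ l (x j)))) atTop
      (𝓝 (Matrix.det (Matrix.of fun i j => k (x i) (x j)))) := by
    have hc : Continuous fun M : Matrix (Fin n) (Fin n) ℂ => M.det :=
      Continuous.matrix_det continuous_id
    refine (hc.tendsto _).comp ?_
    refine tendsto_pi_nhds.2 fun i => tendsto_pi_nhds.2 fun j => ?_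
    exact h i j
  have hre : Tendsto (fun s : Finset ι => ∑ a ∈ Fintype.piFinset fun _ : Fin n => s,
        (∏ i, (q (a i) : ℝ)) * ‖slater φ a x‖ ^ 2) atTop
      (𝓝 ((n.factorial : ℝ) * (Matrix.det (Matrix.of fun i j => k (x i) (x j))).re)) := by
    have h1 := (Complex.continuous_re.tendsto _).comp (hlim.const_mul (n.factorial : ℂ))
    have h2 : ((n.factorial : ℂ) * Matrix.det (Matrix.of fun i j => k (x i) (x j))).re =
        (n.factorial : ℝ) * (Matrix.det (Matrix.of fun i j => k (x i) (x j))).re := by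
      rw [← Complex.ofReal_natCast, Complex.re_ofReal_mul]
    rw [h2] at h1
    refine h1.congr fun s => ?_
    rw [Function.comp_apply, hfin s, Complex.ofReal_re]
  have hpos : 0 ≤ (Matrix.det (Matrix.of fun i j => k (x i) (x j))).re := by
    have h1 : 0 ≤ (n.factorial : ℝ) * (Matrix.det (Matrix.of fun i j => k (x i) (x j))).re :=
      ge_of_tendsto' hre fun s => Finset.sum_nonneg fun a _ => by positivity
    exact nonneg_of_mul_nonneg_right h1 (by positivity)
  refine ⟨?_, hpos⟩
  have hatTop : Tendsto (fun s : Finset ι => Fintype.piFinset fun _ : Fin n => s) atTop atTop := by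
    refine tendsto_atTop_finset_of_monotone (fun s t hst => Fintype.piFinset_subset _ _ fun _ => hst)
      fun a => ⟨Finset.univ.image a, ?_⟩
    simp [Fintype.mem_piFinset]
  have hE := (ENNReal.summable (f := fun a : Fin n → ι =>
    (∏ i, (q (a i) : ℝ≥0∞)) * ‖slater φ a x‖ₑ ^ 2)).hasSum.comp hatTop
  have hre' := (ENNReal.continuous_ofReal.tendsto _).comp hre
  rw [ENNReal.ofReal_mul (by positivity), ENNReal.ofReal_natCast] at hre'
  refine tendsto_nhds_unique hre' (hE.congr fun s => ?_)
  rw [Function.comp_apply, Function.comp_apply, ENNReal.ofReal_sum_of_nonneg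
    (fun a _ => by positivity)]
  refine Finset.sum_congr rfl fun a _ => ?_
  rw [ENNReal.ofReal_mul (by positivity), ENNReal.ofReal_pow (norm_nonneg _), ofReal_norm,
    ENNReal.ofReal_prod_of_nonneg (fun _ _ => NNReal.coe_nonneg _)]
  simp

end Expansion

/-! ### Partition functions -/
section AvoidSum

variable {ι : Type*} [DecidableEq ι]

/-- `∑ q_{i_1} ⋯ q_{i_m}` over the tuples of pairwise distinct indices outside `L`. -/
noncomputable def avoidSum (q : ι → ℝ≥0∞) : ℕ → Finset ι → ℝ≥0∞
  | 0, _ => 1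
  | m + 1, L => ∑' i, if i ∈ L then 0 else q i * avoidSum q m (insert i L)

theorem avoidSum_le (q : ι → ℝ≥0∞) (m : ℕ) (L : Finset ι) :
    avoidSum q m L ≤ (∑' i, q i) ^ m := by
  induction m generalizing L with
  | zero => simp [avoidSum]
  | succ m ih =>
    rw [avoidSum, pow_succ', ← ENNReal.tsum_mul_right]
    refine ENNReal.tsum_le_tsum fun i => ?_
    split_ifs
    · exact bot_le
    · gcongr; exact ih _

/-- Tuples outside `L` either avoid a further index `i`, or take this value exactly once. -/
theorem avoidSum_succ_eq (q : ι → ℝ≥0∞) (m : ℕ) {L : Finset ι} {i : ι} (hi : i ∉ L) :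
    avoidSum q (m + 1) L =
      avoidSum q (m + 1) (insert i L) + (m + 1) * q i * avoidSum q m (insert i L) := by
  induction m generalizing L with
  | zero =>
    simp only [avoidSum, mul_one]
    rw [ENNReal.tsum_eq_add_tsum_ite i, if_neg hi, add_comm]
    simp only [Nat.cast_zero, zero_add, one_mul]
    congr 1
    refine tsum_congr fun l => ?_
    by_cases hl : l = i <;> simp [hl]
  | succ m ih =>
    have h0 : avoidSum q (m + 1 + 1) L = q i * avoidSum q (m + 1) (insert i L) +
        ∑' l, if l = i then 0 else if l ∈ L then 0 else q l * avoidSum q (m + 1) (insert l L) := by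
      rw [avoidSum, ENNReal.tsum_eq_add_tsum_ite i, if_neg hi]
      congr 1
      refine tsum_congr fun l => ?_
      by_cases hl : l = i <;> simp [hl]
    have h1 : ∀ l, (if l = i then 0 else if l ∈ L then 0 else q l * avoidSum q (m + 1) (insert l L)) =
        (if l ∈ insert i L then 0 else q l * avoidSum q (m + 1) (insert l (insert i L))) +
          (m + 1) * q i * (if l ∈ insert i L then 0 else q l * avoidSum q m (insert l (insert i L))) := by
      intro l
      by_cases hl : l = i
      · simp [hl]
      · by_cases hlL : l ∈ L
        · simp [hl, hlL]
        · simp only [hl, hlL, if_false, Finset.mem_insert, or_self]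
          rw [ih (L := insert l L) (by simp [hi, Ne.symm hl]), Finset.insert_comm i l L]
          ring
    rw [h0]
    simp only [h1]
    rw [ENNReal.tsum_add, ENNReal.tsum_mul_left]
    have e1 : (∑' l, if l ∈ insert i L then 0 else q l * avoidSum q (m + 1) (insert l (insert i L)))
        = avoidSum q (m + 1 + 1) (insert i L) := rfl
    have e2 : (∑' l, if l ∈ insert i L then 0 else q l * avoidSum q m (insert l (insert i L)))
        = avoidSum q (m + 1) (insert i L) := rfl
    rw [e1, e2]
    push_cast
    ring

/-- The partition function `∏_{i ∉ L} (1 + q_i)`, as a sum over the number of occupied indices. -/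
noncomputable def partitionSum (q : ι → ℝ≥0∞) (L : Finset ι) : ℝ≥0∞ :=
  ∑' m : ℕ, avoidSum q m L / (m.factorial : ℝ≥0∞)

/-- The recursion that identifies the partition function as the product of the `1 + q_i`. -/
theorem partitionSum_eq (q : ι → ℝ≥0∞) {L : Finset ι} {i : ι} (hi : i ∉ L) :
    partitionSum q L = (1 + q i) * partitionSum q (insert i L) := by
  have h0 : ∀ L, partitionSum q L = 1 + ∑' m : ℕ, avoidSum q (m + 1) L / ((m + 1).factorial : ℝ≥0∞) := by
    intro L
    rw [partitionSum, tsum_eq_zero_add' ENNReal.summable]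
    simp [avoidSum]
  have h1 : ∀ m : ℕ, avoidSum q (m + 1) L / ((m + 1).factorial : ℝ≥0∞) =
      avoidSum q (m + 1) (insert i L) / ((m + 1).factorial : ℝ≥0∞) +
        q i * (avoidSum q m (insert i L) / (m.factorial : ℝ≥0∞)) := by
    intro m
    rw [avoidSum_succ_eq q m hi, ENNReal.add_div]
    congr 1
    rw [Nat.factorial_succ, Nat.cast_mul, mul_assoc, Nat.cast_add, Nat.cast_one,
      ENNReal.mul_div_mul_left _ _ (by positivity)
        (by exact_mod_cast ENNReal.natCast_ne_top (m + 1)), mul_div_assoc]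
  rw [h0 L]
  simp only [h1]
  rw [ENNReal.tsum_add, ENNReal.tsum_mul_left, ← add_assoc, ← h0, ← partitionSum]
  ring

theorem partitionSum_empty_eq (q : ι → ℝ≥0∞) (L : Finset ι) :
    partitionSum q ∅ = (∏ i ∈ L, (1 + q i)) * partitionSum q L := by
  induction L using Finset.induction_on with
  | empty => simp
  | insert i L hi ih =>
    rw [ih, partitionSum_eq q hi, Finset.prod_insert hi]; ring

theorem one_le_partitionSum (q : ι → ℝ≥0∞) (L : Finset ι) : 1 ≤ partitionSum q L := by
  refine le_trans ?_ (ENNReal.le_tsum 0)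
  simp [avoidSum]

/-- The exponential generating series of the sums `avoidSum` is entire. -/
theorem tsum_pow_mul_avoidSum_ne_top {q : ι → ℝ≥0∞} (hq : ∑' i, q i ≠ ∞) (L : Finset ι)
    (t : NNReal) :
    ∑' m : ℕ, (t : ℝ≥0∞) ^ m * (avoidSum q m L / (m.factorial : ℝ≥0∞)) ≠ ∞ := by
  lift ∑' i, q i to NNReal using hq with C hC
  have h1 : ∀ m : ℕ, (t : ℝ≥0∞) ^ m * (avoidSum q m L / (m.factorial : ℝ≥0∞)) ≤
      (((t * C) ^ m / (m.factorial : NNReal) : NNReal) : ℝ≥0∞) := by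
    intro m
    rw [ENNReal.coe_div (by positivity), mul_pow, ENNReal.coe_mul, mul_div_assoc, ENNReal.coe_pow,
      ENNReal.coe_pow, ENNReal.coe_natCast, hC]
    gcongr
    exact avoidSum_le q m L
  refine ne_top_of_le_ne_top ?_ (ENNReal.tsum_le_tsum h1)
  rw [ENNReal.tsum_coe_ne_top_iff_summable, ← NNReal.summable_coe]
  simpa using Real.summable_pow_div_factorial ((t : ℝ) * C)

theorem partitionSum_ne_top {q : ι → ℝ≥0∞} (hq : ∑' i, q i ≠ ∞) (L : Finset ι) :
    partitionSum q L ≠ ∞ := by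
  have := tsum_pow_mul_avoidSum_ne_top hq L 1
  simpa [partitionSum] using this

end AvoidSum

/-! ### Weighted sums of squared Slater determinants -/
section SlaterSum

variable {α ι : Type*} [MeasurableSpace α] {ν : Measure α} [DecidableEq ι]

/-- The weight of a tuple of indices in `slaterSum`, after `r` further points have been integrated
out. -/
noncomputable def tupleWeight (q : ι → ℝ≥0∞) (r : ℕ) {n : ℕ} (a : Fin n → ι) : ℝ≥0∞ := by
  classical
  exact if Injective a then (∏ i, q (a i)) * avoidSum q r (Finset.univ.image a) else 0

theorem insertNth_injective_iff {n : ℕ} (p : Fin (n + 1)) (i : ι) (b : Fin n → ι) :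
    Injective (p.insertNth i b : Fin (n + 1) → ι) ↔ i ∉ Finset.univ.image b ∧ Injective b := by
  simp only [Injective, Fin.forall_iff_succAbove p, Fin.insertNth_apply_same,
    Fin.insertNth_apply_succAbove, Finset.mem_image, Finset.mem_univ, true_and, not_exists]
  constructor
  · rintro ⟨⟨_, h1⟩, h2⟩
    refine ⟨fun j hj => ?_, fun j k hjk => p.succAbove_right_injective ((h2 j).2 k hjk)⟩
    exact absurd (h1 j hj.symm) (Fin.succAbove_ne p j).symm
  · rintro ⟨h1, h2⟩
    refine ⟨⟨fun _ => trivial, fun j hj => absurd hj.symm (h1 j)⟩, fun j =>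
      ⟨fun hj => absurd hj (h1 j), fun k hjk => congrArg _ (h2 hjk)⟩⟩

/-- Summing over the index of one of `n + 1` points. -/
theorem tsum_tupleWeight_insertNth (q : ι → ℝ≥0∞) (r : ℕ) {n : ℕ} (p : Fin (n + 1))
    (b : Fin n → ι) :
    ∑' i, tupleWeight q r (p.insertNth i b : Fin (n + 1) → ι) = tupleWeight q (r + 1) b := by
  classical
  by_cases hb : Injective b
  · rw [tupleWeight, if_pos hb, avoidSum, ← ENNReal.tsum_mul_left]
    refine tsum_congr fun i => ?_
    rw [tupleWeight]
    by_cases hi : i ∈ Finset.univ.image b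
    · rw [if_neg (fun h => ((insertNth_injective_iff p i b).1 h).1 hi), if_pos hi, mul_zero]
    · rw [if_pos ((insertNth_injective_iff p i b).2 ⟨hi, hb⟩), if_neg hi,
        Fin.prod_univ_succAbove _ p]
      simp only [Fin.insertNth_apply_same, Fin.insertNth_apply_succAbove]
      have : Finset.univ.image (p.insertNth i b : Fin (n + 1) → ι) =
          insert i (Finset.univ.image b) := by
        ext l
        simp [Fin.exists_iff_succAbove p, eq_comm]
      rw [this]; ring
  · rw [tupleWeight, if_neg hb]
    refine ENNReal.tsum_eq_zero.2 fun i => ?_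
    rw [tupleWeight, if_neg (fun h => hb ((insertNth_injective_iff p i b).1 h).2)]

/-- The sum of the squared Slater determinants `|det (φ_{a_i}(x_j))|²` with the weights
`tupleWeight q r`. For `r = 0` it is proportional to the determinant of the kernel with the
eigenfunctions `φ` and eigenvalues `q`, see `factorial_mul_ofReal_det_eq_tsum`. -/
noncomputable def slaterSum (φ : ι → Lp ℂ 2 ν) (q : ι → ℝ≥0∞) (r n : ℕ) (x : Fin n → α) : ℝ≥0∞ :=
  ∑' a : Fin n → ι, tupleWeight q r a * ‖slater φ a x‖ₑ ^ 2

theorem measurable_slaterSum [Countable ι] (φ : ι → Lp ℂ 2 ν) (q : ι → ℝ≥0∞) (r n : ℕ) :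
    Measurable (slaterSum φ q r n) :=
  Measurable.tsum fun a => ((measurable_slater φ a).enorm.pow_const 2).const_mul _

/-- The tuples with a repeated index may be included, as their Slater determinants vanish. -/
theorem slaterSum_zero_eq (φ : ι → Lp ℂ 2 ν) (q : ι → ℝ≥0∞) (n : ℕ) (x : Fin n → α) :
    slaterSum φ q 0 n x = ∑' a : Fin n → ι, (∏ i, q (a i)) * ‖slater φ a x‖ₑ ^ 2 := by
  refine tsum_congr fun a => ?_
  by_cases ha : Injective a
  · simp [tupleWeight, ha, avoidSum]
  · simp [slater_eq_zero_of_not_injective_left φ ha]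

theorem slaterSum_comp_perm (φ : ι → Lp ℂ 2 ν) (q : ι → ℝ≥0∞) (r n : ℕ) (σ : Equiv.Perm (Fin n))
    (x : Fin n → α) : slaterSum φ q r n (x ∘ σ) = slaterSum φ q r n x := by
  simp only [slaterSum, enorm_slater_comp_perm_right]

theorem slaterSum_eq_zero (φ : ι → Lp ℂ 2 ν) (q : ι → ℝ≥0∞) (r : ℕ) {n : ℕ} {x : Fin n → α}
    (h : ¬ Injective x) : slaterSum φ q r n x = 0 := by
  simp [slaterSum, slater_eq_zero_of_not_injective_right φ _ h]

theorem measurable_snoc {n : ℕ} (x : Fin n → α) :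
    Measurable fun y => (Fin.snoc x y : Fin (n + 1) → α) := by
  refine measurable_pi_lambda _ fun i => ?_
  refine Fin.lastCases ?_ (fun j => ?_) i
  · simpa using measurable_id'
  · simp

/-- Integrating out one point. -/
theorem lintegral_slaterSum_snoc [Countable ι] {φ : ι → Lp ℂ 2 ν} (hφ : Orthonormal ℂ φ)
    (q : ι → ℝ≥0∞) (r n : ℕ) (x : Fin n → α) :
    ∫⁻ y, slaterSum φ q r (n + 1) (Fin.snoc x y) ∂ν = (n + 1) * slaterSum φ q (r + 1) n x := by
  have hmeas : ∀ a : Fin (n + 1) → ι, AEMeasurable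
      (fun y => tupleWeight q r a * ‖slater φ a (Fin.snoc x y)‖ₑ ^ 2) ν := fun a =>
    ((((measurable_slater φ a).enorm.pow_const 2).const_mul _).comp
      (measurable_snoc x)).aemeasurable
  simp only [slaterSum]
  rw [lintegral_tsum hmeas]
  have h1 : ∀ a : Fin (n + 1) → ι,
      ∫⁻ y, tupleWeight q r a * ‖slater φ a (Fin.snoc x y)‖ₑ ^ 2 ∂ν =
        ∑ j : Fin (n + 1), tupleWeight q r a * ‖slater φ (a ∘ j.succAbove) x‖ₑ ^ 2 := by
    intro a
    have h6 : Measurable fun y => ‖slater φ a (Fin.snoc x y)‖ₑ ^ 2 :=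
      ((measurable_slater φ a).comp (measurable_snoc x)).enorm.pow_const 2
    rw [lintegral_const_mul _ h6]
    by_cases ha : Injective a
    · rw [lintegral_slater_snoc hφ ha, Finset.mul_sum]
    · have : tupleWeight q r a = 0 := by rw [tupleWeight, if_neg ha]
      simp [this]
  simp only [h1]
  rw [Summable.tsum_finsetSum fun _ _ => ENNReal.summable]
  have h2 : ∀ j : Fin (n + 1),
      ∑' a : Fin (n + 1) → ι, tupleWeight q r a * ‖slater φ (a ∘ j.succAbove) x‖ₑ ^ 2 =
        ∑' b : Fin n → ι, tupleWeight q (r + 1) b * ‖slater φ b x‖ₑ ^ 2 := by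
    intro j
    rw [← (Fin.insertNthEquiv (fun _ => ι) j).tsum_eq, ENNReal.tsum_prod', ENNReal.tsum_comm]
    refine tsum_congr fun b => ?_
    rw [← tsum_tupleWeight_insertNth q r j b, ← ENNReal.tsum_mul_right]
    refine tsum_congr fun i => ?_
    have : ((Fin.insertNthEquiv (fun _ => ι) j) (i, b) ∘ j.succAbove) = b := by
      ext k; simp
    rw [this]; rfl
  simp only [h2]
  rw [Finset.sum_const, Finset.card_univ, Fintype.card_fin, nsmul_eq_mul]
  push_cast; rfl

theorem lintegral_pi_snoc [SigmaFinite ν] {n : ℕ} {F : (Fin (n + 1) → α) → ℝ≥0∞}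
    (hF : Measurable F) :
    ∫⁻ x, F x ∂(Measure.pi fun _ : Fin (n + 1) => ν) =
      ∫⁻ x, ∫⁻ y, F (Fin.snoc x y) ∂ν ∂(Measure.pi fun _ : Fin n => ν) := by
  have h := measurePreserving_piFinSuccAbove (fun _ : Fin (n + 1) => ν) (Fin.last n)
  have h1 := h.symm.lintegral_comp hF
  have h2 : AEMeasurable (fun a : α × (Fin n → α) =>
      F ((MeasurableEquiv.piFinSuccAbove (fun _ => α) (Fin.last n)).symm a))
      (ν.prod (Measure.pi fun _ => ν)) := (hF.comp (MeasurableEquiv.measurable _)).aemeasurable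
  rw [← h1, lintegral_prod_symm _ h2]
  refine lintegral_congr fun x => lintegral_congr fun y => ?_
  congr 1
  simp [MeasurableEquiv.piFinSuccAbove, Fin.insertNthEquiv, Fin.insertNth_last']

/-- Integrating out all points but the first `k`. -/
theorem lintegral_mul_slaterSum [SigmaFinite ν] [Countable ι] {φ : ι → Lp ℂ 2 ν}
    (hφ : Orthonormal ℂ φ) (q : ι → ℝ≥0∞) (k m r : ℕ) {G : (Fin k → α) → ℝ≥0∞} (hG : Measurable G) :
    (k.factorial : ℝ≥0∞) * ∫⁻ x, G (x ∘ Fin.castAdd m) * slaterSum φ q r (k + m) x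
        ∂(Measure.pi fun _ : Fin (k + m) => ν) =
      ((k + m).factorial : ℝ≥0∞) * ∫⁻ x, G x * slaterSum φ q (r + m) k x
        ∂(Measure.pi fun _ : Fin k => ν) := by
  induction m generalizing r with
  | zero => rfl
  | succ m ih =>
    have hGm : ∀ m', Measurable fun x : Fin (k + m') → α => G (x ∘ Fin.castAdd m') := fun m' =>
      hG.comp (measurable_pi_lambda _ fun i => measurable_pi_apply _)
    have h1 : ∫⁻ x, G (x ∘ Fin.castAdd (m + 1)) * slaterSum φ q r (k + (m + 1)) x
        ∂(Measure.pi fun _ : Fin (k + (m + 1)) => ν) =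
        ((k + m : ℕ) + 1) * ∫⁻ x, G (x ∘ Fin.castAdd m) * slaterSum φ q (r + 1) (k + m) x
          ∂(Measure.pi fun _ : Fin (k + m) => ν) := by
      have h2 := lintegral_pi_snoc (ν := ν) (n := k + m)
        (F := fun x => G (x ∘ Fin.castAdd (m + 1)) * slaterSum φ q r (k + m + 1) x)
        ((hGm (m + 1)).mul (measurable_slaterSum φ q r _))
      refine h2.trans ?_
      have h5 : Measurable fun x : Fin (k + m) → α =>
          G (x ∘ Fin.castAdd m) * slaterSum φ q (r + 1) (k + m) x :=
        (hGm m).mul (measurable_slaterSum φ q _ _)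
      rw [← lintegral_const_mul _ h5]
      refine lintegral_congr fun x => ?_
      have h3 : ∀ y, (Fin.snoc x y : Fin (k + m + 1) → α) ∘ Fin.castAdd (m + 1) =
          x ∘ Fin.castAdd m := by
        intro y; ext i
        exact Fin.snoc_castSucc (α := fun _ => α) y x (Fin.castAdd m i)
      simp only [h3]
      have h6 : Measurable fun y => slaterSum φ q r (k + m + 1) (Fin.snoc x y) :=
        (measurable_slaterSum φ q r (k + m + 1)).comp (measurable_snoc x)
      rw [lintegral_const_mul _ h6, lintegral_slaterSum_snoc hφ]
      ring
    rw [h1, ← mul_assoc, mul_comm (k.factorial : ℝ≥0∞), mul_assoc, ih (r + 1), ← mul_assoc]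
    have h4 : ((k + m : ℕ) + 1 : ℝ≥0∞) * ((k + m).factorial : ℝ≥0∞) =
        ((k + (m + 1)).factorial : ℝ≥0∞) := by
      rw [← add_assoc, Nat.factorial_succ]; push_cast; rfl
    rw [h4, add_assoc, add_comm 1 m]

end SlaterSum

/-! ### Laws given by Janossy measures -/
theorem measurePreserving_comp_perm {α : Type*} [MeasurableSpace α] (ν : Measure α) [SigmaFinite ν]
    {n : ℕ} (σ : Equiv.Perm (Fin n)) :
    MeasurePreserving (fun x : Fin n → α => x ∘ σ) (Measure.pi fun _ => ν)
      (Measure.pi fun _ => ν) := by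
  have h := measurePreserving_piCongrLeft (fun _ : Fin n => ν) σ.symm
  convert h using 1
  ext x i
  have := MeasurableEquiv.piCongrLeft_apply_apply (β := fun _ : Fin n => α) σ.symm x (σ i)
  simpa using this.symm

theorem MeasurePreserving.withDensity_of_comp_eq {α : Type*} [MeasurableSpace α] {m : Measure α}
    {f : α → α} (hf : MeasurePreserving f m m) {g : α → ℝ≥0∞} (hg : Measurable g)
    (hgf : ∀ x, g (f x) = g x) : MeasurePreserving f (m.withDensity g) (m.withDensity g) := by
  refine ⟨hf.measurable, Measure.ext fun s hs => ?_⟩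
  rw [Measure.map_apply hf.measurable hs, withDensity_apply _ (hf.measurable hs),
    withDensity_apply _ hs, ← hf.setLIntegral_comp_preimage hs hg]
  simp only [hgf]

section Janossy

variable {d : ℕ} {D : Set (Sp d)} {μ : Measure (Sp d)} {ι : Type*} [DecidableEq ι]

/-- The Janossy measure of order `n`, on ordered `n`-tuples, of the determinantal process whose
local interaction operator has eigenfunctions `φ` and eigenvalues `q`; it is normalised so that its
image is the part of the law carried by the configurations of `n` points. One factor `1 / n!` turns
`slaterSum` into a determinant, the other one accounts for the orderings of the points. -/
noncomputable def janossy (φ : ι → Lp ℂ 2 (μ.restrict D)) (q : ι → ℝ≥0∞) (n : ℕ) :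
    Measure (Fin n → Sp d) :=
  (Measure.pi fun _ => μ.restrict D).withDensity fun x =>
    (partitionSum q ∅)⁻¹ * ((n.factorial : ℝ≥0∞)⁻¹ * (n.factorial : ℝ≥0∞)⁻¹) * slaterSum φ q 0 n x

/-- The law with the Janossy measures `janossy φ q n`. -/
noncomputable def janossyLaw (φ : ι → Lp ℂ 2 (μ.restrict D)) (q : ι → ℝ≥0∞) :
    Measure (FinConf D) :=
  Measure.sum fun n => (janossy φ q n).map (FinConf.ofPts D n)

variable {φ : ι → Lp ℂ 2 (μ.restrict D)} {q : ι → ℝ≥0∞}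

/-- Summing over the number of unobserved points turns the eigenvalues `q` into `q / (1 + q)`. -/
theorem tsum_slaterSum_div_factorial (hq : ∑' i, q i ≠ ∞) (k : ℕ) (x : Fin k → Sp d) :
    (partitionSum q ∅)⁻¹ * ∑' m : ℕ, slaterSum φ q m k x / (m.factorial : ℝ≥0∞) =
      slaterSum φ (fun i => q i / (1 + q i)) 0 k x := by
  classical
  rw [slaterSum_zero_eq]
  simp only [slaterSum, div_eq_mul_inv, ← ENNReal.tsum_mul_right]
  rw [ENNReal.tsum_comm, ← ENNReal.tsum_mul_left]
  refine tsum_congr fun a => ?_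
  by_cases ha : Injective a
  · have h1 : ∀ m : ℕ, tupleWeight q m a * ‖slater φ a x‖ₑ ^ 2 * (m.factorial : ℝ≥0∞)⁻¹ =
        ((∏ i, q (a i)) * ‖slater φ a x‖ₑ ^ 2) *
          (avoidSum q m (Finset.univ.image a) / (m.factorial : ℝ≥0∞)) := by
      intro m
      rw [tupleWeight, if_pos ha, div_eq_mul_inv]; ring
    simp only [h1]
    rw [ENNReal.tsum_mul_left, ← partitionSum, partitionSum_empty_eq q (Finset.univ.image a),
      Finset.prod_image fun i _ j _ h => ha h]
    set Z := partitionSum q (Finset.univ.image a)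
    have hZ0 : Z ≠ 0 := (lt_of_lt_of_le one_pos (one_le_partitionSum _ _)).ne'
    have hZ : Z ≠ ∞ := partitionSum_ne_top hq _
    have hqi : ∀ i, q i ≠ ∞ := fun i => ne_top_of_le_ne_top hq (ENNReal.le_tsum i)
    rw [ENNReal.mul_inv (Or.inr hZ) (Or.inr hZ0), Finset.prod_mul_distrib]
    have h2 : (∏ i, (1 + q (a i)))⁻¹ = ∏ i, (1 + q (a i))⁻¹ :=
      ENNReal.prod_inv_distrib (by
        intro i _ j _ _
        exact Or.inl (by simp))
    rw [h2]
    calc (∏ i, (1 + q (a i))⁻¹) * Z⁻¹ * ((∏ i, q (a i)) * ‖slater φ a x‖ₑ ^ 2 * Z)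
        = (Z * Z⁻¹) * (((∏ i, q (a i)) * ∏ i, (1 + q (a i))⁻¹) * ‖slater φ a x‖ₑ ^ 2) := by ring
      _ = _ := by rw [ENNReal.mul_inv_cancel hZ0 hZ, one_mul]
  · simp [slater_eq_zero_of_not_injective_left φ ha]

variable [Countable ι]

theorem measurable_janossyDensity (φ : ι → Lp ℂ 2 (μ.restrict D)) (q : ι → ℝ≥0∞) (n : ℕ) :
    Measurable fun x : Fin n → Sp d =>
      (partitionSum q ∅)⁻¹ * ((n.factorial : ℝ≥0∞)⁻¹ * (n.factorial : ℝ≥0∞)⁻¹) *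
        slaterSum φ q 0 n x :=
  (measurable_slaterSum φ q 0 n).const_mul _

theorem lintegral_janossy {n : ℕ} {G : (Fin n → Sp d) → ℝ≥0∞} (hG : Measurable G) :
    ∫⁻ x, G x ∂(janossy φ q n) =
      (partitionSum q ∅)⁻¹ * ((n.factorial : ℝ≥0∞)⁻¹ * (n.factorial : ℝ≥0∞)⁻¹) *
        ∫⁻ x, G x * slaterSum φ q 0 n x ∂(Measure.pi fun _ => μ.restrict D) := by
  have hm : Measurable fun x => G x * slaterSum φ q 0 n x := hG.mul (measurable_slaterSum φ q _ _)
  rw [janossy, lintegral_withDensity_eq_lintegral_mul _ (measurable_janossyDensity φ q _) hG,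
    ← lintegral_const_mul _ hm]
  refine lintegral_congr fun x => ?_
  simp only [Pi.mul_apply]
  ring

theorem ae_pi_restrict_mem_cube (μ : Measure (Sp d)) [SigmaFinite (μ.restrict D)]
    (hD : MeasurableSet D) (n : ℕ) :
    ∀ᵐ x ∂(Measure.pi fun _ : Fin n => μ.restrict D), x ∈ cube D n := by
  refine ae_all_iff.2 fun i => ?_
  exact (Measure.quasiMeasurePreserving_eval (μ := fun _ : Fin n => μ.restrict D) i).ae
    (ae_restrict_mem hD)

theorem ae_janossy_mem (hD : MeasurableSet D) [SigmaFinite (μ.restrict D)] (n : ℕ) :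
    ∀ᵐ x ∂(janossy φ q n), x ∈ cube D n ∧ Injective x := by
  rw [janossy, ae_withDensity_iff (measurable_janossyDensity φ q n)]
  filter_upwards [ae_pi_restrict_mem_cube μ hD n] with x hx h
  refine ⟨hx, ?_⟩
  by_contra hinj
  exact h (by rw [slaterSum_eq_zero φ q 0 hinj, mul_zero])

theorem janossy_measurePreserving [SigmaFinite (μ.restrict D)] {n : ℕ} (σ : Equiv.Perm (Fin n)) :
    MeasurePreserving (fun x : Fin n → Sp d => x ∘ σ) (janossy φ q n) (janossy φ q n) := by
  refine MeasurePreserving.withDensity_of_comp_eq (measurePreserving_comp_perm _ σ)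
    (measurable_janossyDensity φ q n) fun x => ?_
  rw [slaterSum_comp_perm]

/-- Every `k`-tuple of distinct indices is, up to a permutation, the tuple of the first `k`. -/
theorem exists_perm_castAdd {k m : ℕ} (f : Fin k ↪ Fin (k + m)) :
    ∃ σ : Equiv.Perm (Fin (k + m)), ∀ i, σ (Fin.castAdd m i) = f i := by
  classical
  let e : {x // x ∈ range (Fin.castAdd m : Fin k → Fin (k + m))} ≃ {x // x ∈ range f} :=
    (Equiv.ofInjective _ (Fin.castAdd_injective k m)).symm.trans (Equiv.ofInjective _ f.injective)
  refine ⟨e.extendSubtype, fun i => ?_⟩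
  rw [Equiv.extendSubtype_apply_of_mem e _ (mem_range_self i)]
  have : (Equiv.ofInjective _ (Fin.castAdd_injective k m)).symm ⟨Fin.castAdd m i, mem_range_self i⟩
      = i := (Equiv.symm_apply_eq _).2 (by ext; simp)
  simp [e, this]

/-- The sum over ordered `k`-tuples of distinct points of a configuration. -/
theorem prod_sum_indicator_eq {k n : ℕ} {A : Fin k → Set (Sp d)} (hd : Pairwise (Disjoint on A))
    (x : Fin n → Sp d) :
    ∏ i, ∑ j, (A i).indicator (1 : Sp d → ℝ≥0∞) (x j) =
      ∑ f : Fin k ↪ Fin n, (univ.pi A).indicator 1 (x ∘ f) := by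
  classical
  have h1 : ∀ y : Fin k → Sp d, ∏ i, (A i).indicator (1 : Sp d → ℝ≥0∞) (y i) =
      (univ.pi A).indicator 1 y := by
    intro y
    by_cases hy : y ∈ univ.pi A
    · rw [indicator_of_mem hy]
      exact Finset.prod_eq_one fun i _ => by rw [indicator_of_mem (hy i (mem_univ i))]; rfl
    · rw [indicator_of_notMem hy]
      simp only [Set.mem_pi, mem_univ, true_imp_iff, not_forall] at hy
      obtain ⟨i, hi⟩ := hy
      exact Finset.prod_eq_zero (Finset.mem_univ i) (indicator_of_notMem hi _)
  rw [Finset.prod_univ_sum, Fintype.piFinset_univ]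
  have h2 : ∀ f : Fin k → Fin n, ∏ i, (A i).indicator (1 : Sp d → ℝ≥0∞) (x (f i)) =
      (univ.pi A).indicator 1 (x ∘ f) := fun f => h1 (x ∘ f)
  simp only [h2]
  symm
  refine Finset.sum_of_injOn (fun f : Fin k ↪ Fin n => (f : Fin k → Fin n))
    (fun f _ g _ h => DFunLike.coe_injective h) (fun _ _ => Finset.mem_coe.2 (Finset.mem_univ _)) ?_ (fun _ _ => rfl)
  intro f _ hf
  refine indicator_of_notMem (fun hmem => hf ?_) _
  refine ⟨⟨f, fun i j hij => ?_⟩, by simp, rfl⟩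
  by_contra hne
  have hj := hmem j (mem_univ j)
  have hi := hmem i (mem_univ i)
  simp only [comp_apply, hij] at hi hj
  exact Set.disjoint_left.1 (hd hne) hi hj

/-- The part of the moments that comes from the configurations of `k + m` points: by symmetry, each
of the ordered `k`-tuples of points contributes as much as the first `k` points. -/
theorem lintegral_prod_num_janossy (hD : IsCompact D) [SigmaFinite (μ.restrict D)]
    (hφ : Orthonormal ℂ φ) {k m : ℕ} {A : Fin k → Set (Sp d)} (hA : ∀ i, MeasurableSet (A i))
    (hd : Pairwise (Disjoint on A)) :
    ∫⁻ B, ∏ i, (B.num (A i) : ℝ≥0∞) ∂((janossy φ q (k + m)).map (FinConf.ofPts D (k + m))) =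
      (partitionSum q ∅)⁻¹ * (k.factorial : ℝ≥0∞)⁻¹ *
        ∫⁻ x in univ.pi A, slaterSum φ q m k x / (m.factorial : ℝ≥0∞)
          ∂(Measure.pi fun _ => μ.restrict D) := by
  classical
  have hpi : MeasurableSet (univ.pi A) := MeasurableSet.univ_pi hA
  have hG : Measurable ((univ.pi A).indicator (1 : (Fin k → Sp d) → ℝ≥0∞)) :=
    measurable_one.indicator hpi
  have hprod : Measurable fun B : FinConf D => ∏ i, (B.num (A i) : ℝ≥0∞) :=
    Finset.measurable_prod _ fun i _ => measurable_coe_num hD (hA i)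
  rw [lintegral_map hprod (FinConf.measurable_ofPts hD _)]
  have h1 : ∫⁻ x, ∏ i, (((FinConf.ofPts D (k + m) x).num (A i) : ℕ) : ℝ≥0∞) ∂(janossy φ q (k + m)) =
      ∫⁻ x, ∑ f : Fin k ↪ Fin (k + m), (univ.pi A).indicator 1 (x ∘ f) ∂(janossy φ q (k + m)) := by
    refine lintegral_congr_ae ?_
    filter_upwards [ae_janossy_mem (φ := φ) (q := q) hD.measurableSet (k + m)] with x hx
    rw [← prod_sum_indicator_eq hd]
    exact Finset.prod_congr rfl fun i _ => FinConf.num_ofPts hx _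
  have hcomp : ∀ f : Fin k → Fin (k + m), Measurable fun x : Fin (k + m) → Sp d =>
      (univ.pi A).indicator (1 : (Fin k → Sp d) → ℝ≥0∞) (x ∘ f) := fun f =>
    hG.comp (measurable_pi_lambda _ fun i => measurable_pi_apply _)
  rw [h1, lintegral_finsetSum _ fun (f : Fin k ↪ Fin (k + m)) _ => hcomp f]
  have h2 : ∀ f : Fin k ↪ Fin (k + m),
      ∫⁻ x, (univ.pi A).indicator 1 (x ∘ f) ∂(janossy φ q (k + m)) =
      ∫⁻ x, (univ.pi A).indicator 1 (x ∘ Fin.castAdd m) ∂(janossy φ q (k + m)) := by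
    intro f
    obtain ⟨σ, hσ⟩ := exists_perm_castAdd f
    rw [← (janossy_measurePreserving σ).lintegral_comp (hcomp (Fin.castAdd m))]
    refine lintegral_congr fun x => ?_
    congr 1
    ext1 i
    simp [hσ]
  simp only [h2]
  rw [Finset.sum_const, Finset.card_univ, Fintype.card_embedding_eq, Fintype.card_fin,
    Fintype.card_fin, nsmul_eq_mul, lintegral_janossy (hcomp _)]
  have h4 := lintegral_mul_slaterSum hφ q k m 0 hG
  have h5 : ∫⁻ x, (univ.pi A).indicator (1 : (Fin k → Sp d) → ℝ≥0∞) x * slaterSum φ q (0 + m) k x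
      ∂(Measure.pi fun _ => μ.restrict D) =
      ∫⁻ x in univ.pi A, slaterSum φ q m k x ∂(Measure.pi fun _ => μ.restrict D) := by
    rw [← lintegral_indicator hpi, zero_add]
    refine lintegral_congr fun x => ?_
    by_cases hx : x ∈ univ.pi A <;> simp [hx]
  rw [h5] at h4
  simp only [div_eq_mul_inv]
  rw [lintegral_mul_const _ (measurable_slaterSum φ q m k)]
  set I := ∫⁻ x, (univ.pi A).indicator (1 : (Fin k → Sp d) → ℝ≥0∞) (x ∘ Fin.castAdd m) *
    slaterSum φ q 0 (k + m) x ∂(Measure.pi fun _ => μ.restrict D)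
  set I' := ∫⁻ x in univ.pi A, slaterSum φ q m k x ∂(Measure.pi fun _ => μ.restrict D)
  have hf : ∀ j : ℕ, (j.factorial : ℝ≥0∞) ≠ 0 := fun j => by
    exact_mod_cast Nat.factorial_ne_zero j
  have hf' : ∀ j : ℕ, (j.factorial : ℝ≥0∞) ≠ ∞ := fun j => ENNReal.natCast_ne_top _
  have hI : I = (k.factorial : ℝ≥0∞)⁻¹ * (((k + m).factorial : ℝ≥0∞) * I') := by
    rw [← h4, ← mul_assoc, ENNReal.inv_mul_cancel (hf k) (hf' k), one_mul]
  have hdesc : (((k + m).descFactorial k : ℕ) : ℝ≥0∞) =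
      ((k + m).factorial : ℝ≥0∞) * (m.factorial : ℝ≥0∞)⁻¹ := by
    have := Nat.factorial_mul_descFactorial (Nat.le_add_right k m)
    rw [Nat.add_sub_cancel_left] at this
    rw [← this, Nat.cast_mul, mul_comm (m.factorial : ℝ≥0∞), mul_assoc,
      ENNReal.mul_inv_cancel (hf m) (hf' m), mul_one]
  rw [hI, hdesc]
  have hcan := ENNReal.mul_inv_cancel (hf (k + m)) (hf' (k + m))
  set F := ((k + m).factorial : ℝ≥0∞)
  calc F * (m.factorial : ℝ≥0∞)⁻¹ * ((partitionSum q ∅)⁻¹ * (F⁻¹ * F⁻¹) *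
        ((k.factorial : ℝ≥0∞)⁻¹ * (F * I')))
      = (F * F⁻¹) * (F * F⁻¹) * ((partitionSum q ∅)⁻¹ * (k.factorial : ℝ≥0∞)⁻¹ *
          (I' * (m.factorial : ℝ≥0∞)⁻¹)) := by ring
    _ = _ := by rw [hcan]; ring

theorem lintegral_prod_num_janossy_of_lt (hD : IsCompact D) [SigmaFinite (μ.restrict D)]
    {k n : ℕ} (hn : n < k) {A : Fin k → Set (Sp d)} (hA : ∀ i, MeasurableSet (A i))
    (hd : Pairwise (Disjoint on A)) :
    ∫⁻ B, ∏ i, (B.num (A i) : ℝ≥0∞) ∂((janossy φ q n).map (FinConf.ofPts D n)) = 0 := by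
  have hprod : Measurable fun B : FinConf D => ∏ i, (B.num (A i) : ℝ≥0∞) :=
    Finset.measurable_prod _ fun i _ => measurable_coe_num hD (hA i)
  rw [lintegral_map hprod (FinConf.measurable_ofPts hD _)]
  refine lintegral_eq_zero_of_ae_eq_zero ?_
  filter_upwards [ae_janossy_mem (φ := φ) (q := q) hD.measurableSet n] with x hx
  have : ∏ i, (((FinConf.ofPts D n x).num (A i) : ℕ) : ℝ≥0∞) =
      ∏ i, ∑ j, (A i).indicator (1 : Sp d → ℝ≥0∞) (x j) :=
    Finset.prod_congr rfl fun i _ => FinConf.num_ofPts hx _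
  rw [this, prod_sum_indicator_eq hd]
  have : IsEmpty (Fin k ↪ Fin n) := ⟨fun f => by
    have := Fintype.card_le_of_embedding f
    simp at this; omega⟩
  simp

/-- The law with Janossy measures built from the eigenvalues `q` has the moments of a determinantal
process with eigenvalues `q / (1 + q)`. -/
theorem lintegral_prod_num_janossyLaw (hD : IsCompact D) [SigmaFinite (μ.restrict D)]
    (hφ : Orthonormal ℂ φ) (hq : ∑' i, q i ≠ ∞) {k : ℕ} {A : Fin k → Set (Sp d)}
    (hA : ∀ i, MeasurableSet (A i)) (hd : Pairwise (Disjoint on A)) :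
    ∫⁻ B, ∏ i, (B.num (A i) : ℝ≥0∞) ∂(janossyLaw φ q) =
      (k.factorial : ℝ≥0∞)⁻¹ * ∫⁻ x in univ.pi A, slaterSum φ (fun i => q i / (1 + q i)) 0 k x
          ∂(Measure.pi fun _ => μ.restrict D) := by
  rw [janossyLaw, lintegral_sum_measure,
    ← (add_right_injective k).tsum_eq (f := fun n => ∫⁻ B, ∏ i, (B.num (A i) : ℝ≥0∞)
      ∂((janossy φ q n).map (FinConf.ofPts D n)))]
  · simp only [lintegral_prod_num_janossy hD hφ hA hd]
    rw [ENNReal.tsum_mul_left, ← lintegral_tsum fun m =>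
      ((measurable_slaterSum φ q m k).div_const _).aemeasurable, mul_comm (partitionSum q ∅)⁻¹,
      mul_assoc, ← lintegral_const_mul _ (Measurable.tsum fun m =>
      ((measurable_slaterSum φ q m k).div_const _))]
    simp only [tsum_slaterSum_div_factorial hq]
  · intro n hn
    by_contra hnk
    refine hn (lintegral_prod_num_janossy_of_lt hD ?_ hA hd)
    by_contra hlt
    exact hnk ⟨n - k, by simp only []; omega⟩

theorem isProbabilityMeasure_janossyLaw (hD : IsCompact D) [SigmaFinite (μ.restrict D)]
    (hφ : Orthonormal ℂ φ) (hq : ∑' i, q i ≠ ∞) : IsProbabilityMeasure (janossyLaw φ q) := by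
  constructor
  have h := lintegral_prod_num_janossyLaw hD hφ hq (k := 0) (A := fun _ => ∅)
    (fun i => i.elim0) (fun i => i.elim0)
  simpa [slaterSum, tupleWeight, avoidSum, slater, Function.injective_of_subsingleton] using h

theorem janossy_univ [SigmaFinite (μ.restrict D)] (hφ : Orthonormal ℂ φ) (n : ℕ) :
    janossy φ q n univ = (partitionSum q ∅)⁻¹ * (avoidSum q n ∅ / (n.factorial : ℝ≥0∞)) := by
  have h := lintegral_mul_slaterSum hφ q 0 n 0 (G := fun _ => 1) measurable_one
  simp only [one_mul] at h
  rw [Nat.zero_add] at h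
  have h2 : ∫⁻ x, slaterSum φ q n 0 x ∂(Measure.pi fun _ : Fin 0 => μ.restrict D) =
      avoidSum q n ∅ := by
    simp [slaterSum, tupleWeight, slater, Function.injective_of_subsingleton]
  rw [h2, Nat.factorial_zero, Nat.cast_one, one_mul] at h
  rw [janossy, withDensity_apply _ MeasurableSet.univ, Measure.restrict_univ,
    lintegral_const_mul _ (measurable_slaterSum φ q 0 n), h]
  have hf : (n.factorial : ℝ≥0∞) ≠ 0 := by exact_mod_cast Nat.factorial_ne_zero n
  have hf' : (n.factorial : ℝ≥0∞) ≠ ∞ := ENNReal.natCast_ne_top _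
  rw [div_eq_mul_inv]
  calc _ = (partitionSum q ∅)⁻¹ * (avoidSum q n ∅ * (n.factorial : ℝ≥0∞)⁻¹) *
      ((n.factorial : ℝ≥0∞) * (n.factorial : ℝ≥0∞)⁻¹) := by ring
    _ = _ := by rw [ENNReal.mul_inv_cancel hf hf', mul_one]

/-- The exponential moment required for `SameDisjointMoments.eq`. -/
theorem lintegral_two_pow_janossyLaw_ne_top (hD : IsCompact D) [SigmaFinite (μ.restrict D)]
    (hφ : Orthonormal ℂ φ) (hq : ∑' i, q i ≠ ∞) :
    ∫⁻ B : FinConf D, (2 : ℝ≥0∞) ^ B.num univ ∂(janossyLaw φ q) ≠ ∞ := by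
  have hm : Measurable fun B : FinConf D => (2 : ℝ≥0∞) ^ B.num univ :=
    (measurable_from_top (f := fun n : ℕ => (2 : ℝ≥0∞) ^ n)).comp
      (FinConf.measurable_num hD MeasurableSet.univ)
  have h1 : ∀ n, ∫⁻ B : FinConf D, (2 : ℝ≥0∞) ^ B.num univ ∂((janossy φ q n).map (FinConf.ofPts D n)) =
      (partitionSum q ∅)⁻¹ * (((2 : NNReal) : ℝ≥0∞) ^ n * (avoidSum q n ∅ / (n.factorial : ℝ≥0∞))) := by
    intro n
    rw [lintegral_map hm (FinConf.measurable_ofPts hD n)]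
    have : ∫⁻ x, (2 : ℝ≥0∞) ^ (FinConf.ofPts D n x).num univ ∂(janossy φ q n) =
        ∫⁻ _, (2 : ℝ≥0∞) ^ n ∂(janossy φ q n) := by
      refine lintegral_congr_ae ?_
      filter_upwards [ae_janossy_mem (φ := φ) (q := q) hD.measurableSet n] with x hx
      rw [FinConf.num_univ, FinConf.card_ofPts hx]
    rw [this, lintegral_const, janossy_univ hφ]
    simp only [ENNReal.coe_ofNat]
    ring
  rw [janossyLaw, lintegral_sum_measure]
  simp only [h1]
  rw [ENNReal.tsum_mul_left]
  refine ENNReal.mul_ne_top ?_ (tsum_pow_mul_avoidSum_ne_top hq ∅ 2)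
  exact ENNReal.inv_ne_top.2 (lt_of_lt_of_le one_pos (one_le_partitionSum _ _)).ne'

end Janossy

/-! ### Operators with an eigenbasis -/
section Hilbert

variable {H : Type*} [NormedAddCommGroup H] [InnerProductSpace ℂ H]

local notation "⟪" x ", " y "⟫" => inner ℂ x y

theorem inner_map_eq_of_hilbertBasis {ι : Type*} (φ : HilbertBasis ι ℂ H) {T : H →L[ℂ] H}
    {a : ι → ℝ} (ha : ∀ i, T (φ i) = (a i : ℂ) • φ i) (i : ι) (f : H) :
    ⟪φ i, T f⟫ = a i * ⟪φ i, f⟫ := by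
  have h1 := ((φ.hasSum_repr f).mapL T).mapL (innerSL ℂ (φ i))
  have h2 : HasSum (fun j => (innerSL ℂ (φ i)) (T (φ.repr f j • φ j))) (a i * ⟪φ i, f⟫) := by
    have h3 : ∀ j, j ≠ i → (innerSL ℂ (φ i)) (T (φ.repr f j • φ j)) = 0 := by
      intro j hj
      simp [ha, φ.orthonormal.2 hj.symm]
    have h4 := hasSum_single (f := fun j => (innerSL ℂ (φ i)) (T (φ.repr f j • φ j))) i h3
    convert h4 using 1
    simp [ha, φ.repr_apply_apply, φ.orthonormal.1 i, mul_comm]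
  exact h1.unique h2

theorem hasSum_inner_map_of_hilbertBasis {ι : Type*} (φ : HilbertBasis ι ℂ H) {T : H →L[ℂ] H}
    {a : ι → ℝ} (ha : ∀ i, T (φ i) = (a i : ℂ) • φ i) (f g : H) :
    HasSum (fun i => (a i : ℂ) * (⟪f, φ i⟫ * ⟪φ i, g⟫)) ⟪f, T g⟫ := by
  convert! φ.hasSum_inner_mul_inner f (T g) using 2 with i
  rw [inner_map_eq_of_hilbertBasis φ ha]; ring

theorem inner_map_comm_of_hilbertBasis {ι : Type*} (φ : HilbertBasis ι ℂ H) {T : H →L[ℂ] H}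
    {a : ι → ℝ} (ha : ∀ i, T (φ i) = (a i : ℂ) • φ i) (f g : H) : ⟪T f, g⟫ = ⟪f, T g⟫ := by
  have h1 := hasSum_inner_map_of_hilbertBasis φ ha f g
  have h2 := (hasSum_inner_map_of_hilbertBasis φ ha g f).map (starRingEnd ℂ) Complex.continuous_conj
  rw [inner_conj_symm] at h2
  refine h2.unique ?_
  convert! h1 using 2 with i
  simp [inner_conj_symm, mul_comm]

/-- `M` is a symmetric idempotent, that is, an orthogonal projection. -/
theorem norm_sq_eq_re_inner_of_idem {M : H → H} (hM : ∀ f g, ⟪M f, g⟫ = ⟪f, M g⟫)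
    (hMM : ∀ f, M (M f) = M f) (f : H) : ⟪f, M f⟫ = ((‖M f‖ ^ 2 : ℝ) : ℂ) := by
  rw [← hMM f, ← hM, hMM, inner_self_eq_norm_sq_to_K]
  simp

theorem norm_le_of_idem {M : H → H} (hM : ∀ f g, ⟪M f, g⟫ = ⟪f, M g⟫)
    (hMM : ∀ f, M (M f) = M f) (f : H) : ‖M f‖ ≤ ‖f‖ := by
  have h1 := norm_sq_eq_re_inner_of_idem hM hMM f
  have h2 := norm_inner_le_norm (𝕜 := ℂ) f (M f)
  rw [h1, Complex.norm_real, Real.norm_of_nonneg (by positivity), sq] at h2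
  by_contra! hlt
  have : 0 < ‖M f‖ := lt_of_le_of_lt (norm_nonneg _) hlt
  nlinarith

/-- The trace of the compression of a trace class operator by a projection `M` does not depend on
the eigenbasis in which it is computed. -/
theorem tsum_mul_norm_sq_eq {ι κ : Type*} (φ : HilbertBasis ι ℂ H) (ψ : HilbertBasis κ ℂ H)
    {T : H →L[ℂ] H} {a : ι → ℝ} {b : κ → ℝ} (ha : ∀ i, T (φ i) = (a i : ℂ) • φ i)
    (hb : ∀ j, T (ψ j) = (b j : ℂ) • ψ j) (hsa : Summable fun i => |a i|)
    {M : H → H} (hM : ∀ f g, ⟪M f, g⟫ = ⟪f, M g⟫) (hMM : ∀ f, M (M f) = M f) :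
    ∑' i, a i * ‖M (φ i)‖ ^ 2 = ∑' j, b j * ‖M (ψ j)‖ ^ 2 := by
  have hab : ∀ i j, (a i : ℂ) * ⟪φ i, ψ j⟫ = b j * ⟪φ i, ψ j⟫ := by
    intro i j
    rw [← inner_map_eq_of_hilbertBasis φ ha, hb, inner_smul_right]
  let u : ι → κ → ℂ := fun i j => a i * (⟪φ i, ψ j⟫ * ⟪ψ j, M (φ i)⟫)
  have hrow : ∀ i, HasSum (u i) ((a i * ‖M (φ i)‖ ^ 2 : ℝ) : ℂ) := by
    intro i
    have := (ψ.hasSum_inner_mul_inner (φ i) (M (φ i))).mul_left (a i : ℂ)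
    rw [norm_sq_eq_re_inner_of_idem hM hMM] at this
    simpa [u] using this
  have hcol : ∀ j, HasSum (fun i => u i j) ((b j * ‖M (ψ j)‖ ^ 2 : ℝ) : ℂ) := by
    intro j
    have := (φ.hasSum_inner_mul_inner (M (ψ j)) (ψ j)).mul_left (b j : ℂ)
    rw [hM, norm_sq_eq_re_inner_of_idem hM hMM] at this
    convert! this using 2 with i
    · simp only [u]
      rw [← mul_assoc, hab, ← hM]; ring
    · simp
  -- both sides are iterated sums of the absolutely summable family `u`
  have hsum : Summable (uncurry u) := by
    refine Summable.of_norm ?_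
    have hbd : ∀ p : ι × κ, ‖uncurry u p‖ ≤
        |a p.1| * ((‖⟪φ p.1, ψ p.2⟫‖ ^ 2 + ‖⟪ψ p.2, M (φ p.1)⟫‖ ^ 2) / 2) := by
      rintro ⟨i, j⟩
      simp only [uncurry, u, norm_mul, Complex.norm_real, Real.norm_eq_abs]
      gcongr
      nlinarith [sq_nonneg (‖⟪φ i, ψ j⟫‖ - ‖⟪ψ j, M (φ i)⟫‖)]
    have hP : ∀ f : H, HasSum (fun j => ‖⟪ψ j, f⟫‖ ^ 2) (‖f‖ ^ 2) := by
      intro f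
      have h := (Complex.hasSum_re (ψ.hasSum_inner_mul_inner f f))
      rw [inner_self_eq_norm_sq_to_K] at h
      convert h using 1
      · funext j
        rw [← inner_conj_symm f (ψ j), Complex.conj_mul']
        norm_cast
      · norm_cast
    have hrow2 : ∀ i, HasSum (fun j => |a i| * ((‖⟪φ i, ψ j⟫‖ ^ 2 + ‖⟪ψ j, M (φ i)⟫‖ ^ 2) / 2))
        (|a i| * ((‖φ i‖ ^ 2 + ‖M (φ i)‖ ^ 2) / 2)) := by
      intro i
      refine HasSum.mul_left _ (HasSum.div_const (HasSum.add ?_ (hP _)) _)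
      convert! hP (φ i) using 2 with j
      rw [norm_inner_symm]
    refine Summable.of_nonneg_of_le (fun _ => norm_nonneg _) hbd ?_
    rw [summable_prod_of_nonneg (fun p => by positivity)]
    refine ⟨fun i => (hrow2 i).summable, ?_⟩
    refine Summable.of_nonneg_of_le (fun i => tsum_nonneg fun j => by positivity) (fun i => ?_) hsa
    rw [(hrow2 i).tsum_eq]
    have h1 : ‖φ i‖ = 1 := φ.orthonormal.1 i
    have h2 := norm_le_of_idem hM hMM (φ i)
    rw [h1] at h2 ⊢
    have h3 : ‖M (φ i)‖ ^ 2 ≤ 1 := pow_le_one₀ (norm_nonneg _) h2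
    nlinarith [abs_nonneg (a i)]
  have h := Summable.tsum_comm' hsum (fun i => (hrow i).summable) (fun j => (hcol j).summable)
  simp only [(hrow _).tsum_eq, (hcol _).tsum_eq] at h
  exact_mod_cast h.symm

/-- A self-adjoint operator with spectrum in `[0, 1)` is positive and, the spectrum being compact,
has norm less than one. -/
theorem exists_lt_one_of_spectrum_subset [CompleteSpace H] {T : H →L[ℂ] H} (hT : IsSelfAdjoint T)
    (hs : spectrum ℂ T ⊆ (fun r : ℝ => (r : ℂ)) '' Set.Ico 0 1) :
    (∀ f, 0 ≤ (⟪f, T f⟫).re) ∧ ‖T‖ < 1 := by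
  constructor
  · have h0 : 0 ≤ T := by
      rw [StarOrderedRing.nonneg_iff_spectrum_nonneg (R := ℝ) T hT]
      intro x hx
      rw [← spectrum.preimage_algebraMap ℂ] at hx
      obtain ⟨r, hr, hrx⟩ := hs hx
      have : r = x := Complex.ofReal_injective hrx
      rw [← this]; exact hr.1
    intro f
    have h1 := ((ContinuousLinearMap.nonneg_iff_isPositive T).1 h0).inner_nonneg_right f
    exact (Complex.nonneg_iff.1 h1).1
  · rcases subsingleton_or_nontrivial H with h | h
    · rw [Subsingleton.elim T 0, norm_zero]; exact one_pos
    · have h1 := spectrum.spectralRadius_lt_of_forall_lt T (r := 1) (by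
        intro z hz
        obtain ⟨r, hr, rfl⟩ := hs hz
        rw [← NNReal.coe_lt_coe]
        simp [abs_of_nonneg hr.1, hr.2])
      rw [hT.spectralRadius_eq_nnnorm] at h1
      exact_mod_cast h1

end Hilbert

/-! ### Kernels of trace class operators -/
section SummableFunctions

variable {α ι E : Type*} [MeasurableSpace α] {m : Measure α} [Countable ι]
  [NormedAddCommGroup E] [CompleteSpace E]

theorem ae_summable_of_tsum_lintegral_ne_top {F : ι → α → E}
    (hF : ∀ i, AEStronglyMeasurable (F i) m) (h : ∑' i, ∫⁻ x, ‖F i x‖ₑ ∂m ≠ ∞) :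
    ∀ᵐ x ∂m, Summable fun i => F i x := by
  rw [← lintegral_tsum fun i => (hF i).enorm] at h
  filter_upwards [ae_lt_top' (AEMeasurable.tsum fun i => (hF i).enorm) h] with x hx
  refine Summable.of_nnnorm (ENNReal.tsum_coe_ne_top_iff_summable.1 ?_)
  exact hx.ne

theorem integrable_tsum_of_tsum_lintegral_ne_top {F : ι → α → E}
    (hF : ∀ i, AEStronglyMeasurable (F i) m) (h : ∑' i, ∫⁻ x, ‖F i x‖ₑ ∂m ≠ ∞) :
    Integrable (fun x => ∑' i, F i x) m := by
  have h1 := ae_summable_of_tsum_lintegral_ne_top hF h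
  constructor
  · refine aestronglyMeasurable_of_tendsto_ae (atTop : Filter (Finset ι))
      (f := fun s x => ∑ i ∈ s, F i x) (fun s => Finset.aestronglyMeasurable_fun_sum _ fun i _ => hF i) ?_
    filter_upwards [h1] with x hx using hx.hasSum
  · refine lt_of_le_of_lt ?_ h.lt_top
    rw [← lintegral_tsum fun i => (hF i).enorm]
    exact lintegral_mono fun x => enorm_tsum_le_tsum_enorm

end SummableFunctions

section Kernel

variable {α : Type*} [MeasurableSpace α] {ν : Measure α}

/-- Two integrable functions on a product with the same integrals over rectangles agree. -/
theorem ae_eq_of_forall_setIntegral_prod_eq [IsFiniteMeasure ν] {f g : α × α → ℂ}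
    (hf : Integrable f (ν.prod ν)) (hg : Integrable g (ν.prod ν))
    (h : ∀ A B : Set α, MeasurableSet A → MeasurableSet B →
      ∫ p in A ×ˢ B, f p ∂(ν.prod ν) = ∫ p in A ×ˢ B, g p ∂(ν.prod ν)) :
    f =ᵐ[ν.prod ν] g := by
  have huniv : ∫ p, f p ∂(ν.prod ν) = ∫ p, g p ∂(ν.prod ν) := by
    simpa using h univ univ MeasurableSet.univ MeasurableSet.univ
  refine hf.ae_eq_of_forall_setIntegral_eq _ _ hg fun s hs _ => ?_
  refine MeasurableSpace.induction_on_inter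
    (C := fun s _ => ∫ p in s, f p ∂(ν.prod ν) = ∫ p in s, g p ∂(ν.prod ν))
    generateFrom_prod.symm isPiSystem_prod (by simp) ?_ ?_ ?_ s hs
  · rintro _ ⟨A, hA, B, hB, rfl⟩
    exact h A B hA hB
  · intro t ht hC
    rw [setIntegral_compl ht hf, setIntegral_compl ht hg, hC, huniv]
  · intro F hd hm hC
    rw [integral_iUnion hm hd hf.integrableOn, integral_iUnion hm hd hg.integrableOn]
    simp only [hC]

/-- Multiplication by an indicator function. -/
noncomputable def indicatorLp {A : Set α} (hA : MeasurableSet A) (f : Lp ℂ 2 ν) : Lp ℂ 2 ν :=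
  ((Lp.memLp f).indicator hA).toLp

theorem coeFn_indicatorLp {A : Set α} (hA : MeasurableSet A) (f : Lp ℂ 2 ν) :
    indicatorLp hA f =ᵐ[ν] A.indicator f :=
  MemLp.coeFn_toLp _

theorem indicatorLp_idem {A : Set α} (hA : MeasurableSet A) (f : Lp ℂ 2 ν) :
    indicatorLp hA (indicatorLp hA f) = indicatorLp hA f := by
  refine Lp.ext ?_
  filter_upwards [coeFn_indicatorLp hA (indicatorLp hA f), coeFn_indicatorLp hA f] with x h1 h2
  rw [h1]
  by_cases hx : x ∈ A
  · rw [indicator_of_mem hx]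
  · rw [indicator_of_notMem hx, h2, indicator_of_notMem hx]

theorem inner_indicatorLp_comm {A : Set α} (hA : MeasurableSet A) (f g : Lp ℂ 2 ν) :
    inner ℂ (indicatorLp hA f) g = inner ℂ f (indicatorLp hA g) := by
  rw [L2.inner_def, L2.inner_def]
  refine integral_congr_ae ?_
  filter_upwards [coeFn_indicatorLp hA f, coeFn_indicatorLp hA g] with x h1 h2
  rw [h1, h2]
  by_cases hx : x ∈ A
  · rw [indicator_of_mem hx, indicator_of_mem hx]
  · rw [indicator_of_notMem hx, indicator_of_notMem hx]; simp

theorem ofReal_norm_indicatorLp_sq {A : Set α} (hA : MeasurableSet A) (f : Lp ℂ 2 ν) :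
    ENNReal.ofReal (‖indicatorLp hA f‖ ^ 2) = ∫⁻ x in A, ‖f x‖ₑ ^ 2 ∂ν := by
  have h := eLpNorm_nnreal_pow_eq_lintegral (f := indicatorLp hA f) (μ := ν) (p := 2) two_ne_zero
  simp only [NNReal.coe_ofNat, ENNReal.coe_ofNat, ENNReal.rpow_ofNat] at h
  rw [ENNReal.ofReal_pow (norm_nonneg _), ofReal_norm, Lp.enorm_def, h, ← lintegral_indicator hA]
  refine lintegral_congr_ae ?_
  filter_upwards [coeFn_indicatorLp hA f] with x hx
  rw [hx]
  by_cases hxA : x ∈ A <;> simp [hxA]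

theorem lintegral_enorm_Lp_le [IsFiniteMeasure ν] (f : Lp ℂ 2 ν) :
    ∫⁻ x, ‖f x‖ₑ ∂ν ≤ ν univ + ENNReal.ofReal (‖f‖ ^ 2) := by
  have h := ofReal_norm_indicatorLp_sq MeasurableSet.univ f
  have h0 : indicatorLp MeasurableSet.univ f = f := by
    refine Lp.ext ?_
    filter_upwards [coeFn_indicatorLp MeasurableSet.univ f] with x hx
    rw [hx, indicator_univ]
  rw [h0, Measure.restrict_univ] at h
  rw [h]
  have h1 : ν univ = ∫⁻ _, 1 ∂ν := by simp
  rw [h1, ← lintegral_add_left measurable_const]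
  refine lintegral_mono fun x => ?_
  rcases le_total (‖f x‖ₑ) 1 with hx | hx
  · exact hx.trans le_self_add
  · refine le_trans ?_ le_add_self
    rw [sq]
    exact le_mul_of_one_le_left bot_le hx

variable {ι : Type*}

theorem aestronglyMeasurable_tensor (f : Lp ℂ 2 ν) (c : ℂ) [SFinite ν] :
    AEStronglyMeasurable (fun p : α × α => c * f p.1 * conj (f p.2)) (ν.prod ν) := by
  have hm : Measurable f := (Lp.stronglyMeasurable f).measurable
  exact (((hm.comp measurable_fst).const_mul c).mul
    (Complex.continuous_conj.measurable.comp (hm.comp measurable_snd))).aestronglyMeasurable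

theorem tsum_lintegral_tensor_ne_top [IsFiniteMeasure ν] {φ : ι → Lp ℂ 2 ν} (hφ : ∀ i, ‖φ i‖ = 1)
    {a : ι → ℝ} (ha : Summable fun i => |a i|) :
    ∑' i, ∫⁻ p, ‖(a i : ℂ) * φ i p.1 * conj (φ i p.2)‖ₑ ∂(ν.prod ν) ≠ ∞ := by
  have h1 : ∀ i, ∫⁻ p, ‖(a i : ℂ) * φ i p.1 * conj (φ i p.2)‖ₑ ∂(ν.prod ν) ≤
      ENNReal.ofReal |a i| * ((ν univ + 1) * (ν univ + 1)) := by
    intro i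
    have hm : Measurable (φ i) := (Lp.stronglyMeasurable (φ i)).measurable
    have h2 : ∀ p : α × α, ‖(a i : ℂ) * φ i p.1 * conj (φ i p.2)‖ₑ =
        ENNReal.ofReal |a i| * (‖φ i p.1‖ₑ * ‖φ i p.2‖ₑ) := by
      intro p
      have e1 : ‖conj (φ i p.2)‖ₑ = ‖φ i p.2‖ₑ := by
        rw [← ofReal_norm, ← ofReal_norm, RCLike.norm_conj]
      have e2 : ‖(a i : ℂ)‖ₑ = ENNReal.ofReal |a i| := by
        rw [← ofReal_norm, Complex.norm_real, Real.norm_eq_abs]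
      rw [enorm_mul, enorm_mul, e1, e2, mul_assoc]
    have hm2 : Measurable fun p : α × α => ‖φ i p.1‖ₑ * ‖φ i p.2‖ₑ :=
      (hm.comp measurable_fst).enorm.mul (hm.comp measurable_snd).enorm
    simp only [h2]
    rw [lintegral_const_mul _ hm2]
    have h3 := lintegral_prod_mul (μ := ν) (ν := ν) hm.enorm.aemeasurable hm.enorm.aemeasurable
    rw [h3]
    have h4 := lintegral_enorm_Lp_le (φ i)
    rw [hφ, one_pow, ENNReal.ofReal_one] at h4
    gcongr
  refine ne_top_of_le_ne_top ?_ (ENNReal.tsum_le_tsum h1)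
  rw [ENNReal.tsum_mul_right]
  refine ENNReal.mul_ne_top ?_ ?_
  · rw [← ENNReal.ofReal_tsum_of_nonneg (fun _ => abs_nonneg _) ha]
    exact ENNReal.ofReal_ne_top
  · have : ν univ + 1 ≠ ∞ := ENNReal.add_ne_top.2 ⟨measure_ne_top _ _, ENNReal.one_ne_top⟩
    exact ENNReal.mul_ne_top this this

/-- The integral of the eigenfunction expansion over a rectangle only depends on the operator. -/
theorem setIntegral_tensor_eq [Countable ι] [IsFiniteMeasure ν] (φ : HilbertBasis ι ℂ (Lp ℂ 2 ν))
    {T : Lp ℂ 2 ν →L[ℂ] Lp ℂ 2 ν} {a : ι → ℝ} (hT : ∀ i, T (φ i) = (a i : ℂ) • φ i)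
    (ha : Summable fun i => |a i|) {A B : Set α} (hA : MeasurableSet A) (hB : MeasurableSet B) :
    ∫ p in A ×ˢ B, ∑' i, (a i : ℂ) * φ i p.1 * conj (φ i p.2) ∂(ν.prod ν) =
      inner ℂ (indicatorConstLp 2 hA (measure_ne_top ν A) (1 : ℂ))
        (T (indicatorConstLp 2 hB (measure_ne_top ν B) (1 : ℂ))) := by
  have hfin := tsum_lintegral_tensor_ne_top (fun i => φ.orthonormal.1 i) ha
  have hint : ∀ i, Integrable (fun p : α × α => (a i : ℂ) * φ i p.1 * conj (φ i p.2)) (ν.prod ν) :=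
    fun i => ⟨aestronglyMeasurable_tensor _ _, lt_top_iff_ne_top.2
      (ne_top_of_le_ne_top hfin (ENNReal.le_tsum i))⟩
  have hsum : Summable fun i => ∫ p in A ×ˢ B, ‖(a i : ℂ) * φ i p.1 * conj (φ i p.2)‖ ∂(ν.prod ν) := by
    have h1 : Summable fun i => ∫ p, ‖(a i : ℂ) * φ i p.1 * conj (φ i p.2)‖ ∂(ν.prod ν) := by
      have := ENNReal.summable_toReal hfin
      refine this.congr fun i => ?_
      rw [integral_norm_eq_lintegral_enorm (hint i).1]
    exact Summable.of_nonneg_of_le (fun i => integral_nonneg fun _ => norm_nonneg _)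
      (fun i => setIntegral_le_integral (hint i).norm (Eventually.of_forall fun _ => norm_nonneg _)) h1
  have h := hasSum_integral_of_summable_integral_norm (fun i => (hint i).restrict) hsum
  refine h.unique ?_
  convert! hasSum_inner_map_of_hilbertBasis φ hT _ _ using 2 with i
  have h2 : ∀ p : α × α, (a i : ℂ) * φ i p.1 * conj (φ i p.2) =
      ((a i : ℂ) * φ i p.1) * (fun y => conj (φ i y)) p.2 := fun p => rfl
  simp only [h2]
  rw [setIntegral_prod_mul (fun x => (a i : ℂ) * φ i x) (fun y => conj (φ i y)), integral_const_mul,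
    integral_conj, ← L2.inner_indicatorConstLp_one (𝕜 := ℂ) hA (measure_ne_top ν A),
    ← L2.inner_indicatorConstLp_one (𝕜 := ℂ) hB (measure_ne_top ν B), inner_conj_symm, mul_assoc]

theorem hasSum_mul_conj_of_summable {a : ι → ℝ} (ha : ∀ i, 0 ≤ a i) {z : ι → ℂ}
    (h : Summable fun i => (a i : ℂ) * z i * conj (z i)) :
    HasSum (fun i => (a i : ℂ) * z i * conj (z i))
      (((∑' i, ENNReal.ofReal (a i) * ‖z i‖ₑ ^ 2).toReal : ℝ) : ℂ) := by
  have h1 : ∀ i, (a i : ℂ) * z i * conj (z i) = ((a i * ‖z i‖ ^ 2 : ℝ) : ℂ) := by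
    intro i
    rw [mul_assoc, Complex.mul_conj, Complex.normSq_eq_norm_sq]; push_cast; rfl
  simp only [h1] at h ⊢
  rw [Complex.summable_ofReal] at h
  have h2 : ∀ i, ENNReal.ofReal (a i) * ‖z i‖ₑ ^ 2 = ENNReal.ofReal (a i * ‖z i‖ ^ 2) := by
    intro i
    rw [ENNReal.ofReal_mul (ha i), ENNReal.ofReal_pow (norm_nonneg _), ofReal_norm]
  simp only [h2]
  rw [← ENNReal.ofReal_tsum_of_nonneg (fun i => mul_nonneg (ha i) (by positivity)) h,
    ENNReal.toReal_ofReal (tsum_nonneg fun i => mul_nonneg (ha i) (by positivity)),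
    Complex.hasSum_ofReal]
  exact h.hasSum

theorem tsum_lintegral_diag_ne_top {φ : ι → Lp ℂ 2 ν} (hφ : ∀ i, ‖φ i‖ = 1)
    {a : ι → ℝ} (ha : Summable fun i => |a i|) :
    ∑' i, ∫⁻ x, ‖(a i : ℂ) * φ i x * conj (φ i x)‖ₑ ∂ν ≠ ∞ := by
  have h1 : ∀ i, ∫⁻ x, ‖(a i : ℂ) * φ i x * conj (φ i x)‖ₑ ∂ν = ENNReal.ofReal |a i| := by
    intro i
    have hm : Measurable (φ i) := (Lp.stronglyMeasurable (φ i)).measurable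
    have h2 : ∀ x, ‖(a i : ℂ) * φ i x * conj (φ i x)‖ₑ = ENNReal.ofReal |a i| * ‖φ i x‖ₑ ^ 2 := by
      intro x
      have e1 : ‖conj (φ i x)‖ₑ = ‖φ i x‖ₑ := by
        rw [← ofReal_norm, ← ofReal_norm, RCLike.norm_conj]
      have e2 : ‖(a i : ℂ)‖ₑ = ENNReal.ofReal |a i| := by
        rw [← ofReal_norm, Complex.norm_real, Real.norm_eq_abs]
      rw [enorm_mul, enorm_mul, e1, e2, mul_assoc, sq]
    simp only [h2]
    have h := ofReal_norm_indicatorLp_sq MeasurableSet.univ (φ i)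
    have h0 : indicatorLp MeasurableSet.univ (φ i) = φ i := by
      refine Lp.ext ?_
      filter_upwards [coeFn_indicatorLp MeasurableSet.univ (φ i)] with x hx
      rw [hx, indicator_univ]
    rw [h0, Measure.restrict_univ, hφ] at h
    rw [lintegral_const_mul _ (hm.enorm.pow_const 2), ← h]
    simp
  simp only [h1]
  rw [← ENNReal.ofReal_tsum_of_nonneg (fun _ => abs_nonneg _) ha]
  exact ENNReal.ofReal_ne_top

theorem measurable_mul_enorm_sq (f : Lp ℂ 2 ν) (c : ℝ≥0∞) : Measurable fun x => c * ‖f x‖ₑ ^ 2 :=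
  ((Lp.stronglyMeasurable f).measurable.enorm.pow_const 2).const_mul c

/-- The integral of the diagonal of the expansion over `A` is the trace of the compression of the
operator by the projection onto the functions carried by `A`. -/
theorem setLIntegral_diag_eq [Countable ι] (χ : HilbertBasis ι ℂ (Lp ℂ 2 ν)) {c : ι → ℝ}
    (hc : ∀ i, 0 ≤ c i) (hcs : Summable c) {A : Set α} (hA : MeasurableSet A) :
    ∫⁻ x in A, ∑' i, ENNReal.ofReal (c i) * ‖χ i x‖ₑ ^ 2 ∂ν =
      ENNReal.ofReal (∑' i, c i * ‖indicatorLp hA (χ i)‖ ^ 2) := by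
  rw [lintegral_tsum fun i => (measurable_mul_enorm_sq (χ i) _).aemeasurable,
    ENNReal.ofReal_tsum_of_nonneg (fun i => mul_nonneg (hc i) (by positivity))]
  · refine tsum_congr fun i => ?_
    rw [lintegral_const_mul _ ((Lp.stronglyMeasurable (χ i)).measurable.enorm.pow_const 2),
      ENNReal.ofReal_mul (hc i), ofReal_norm_indicatorLp_sq]
  · refine Summable.of_nonneg_of_le (fun i => mul_nonneg (hc i) (by positivity)) (fun i => ?_) hcs
    refine mul_le_of_le_one_right (hc i) (pow_le_one₀ (norm_nonneg _) ?_)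
    rw [← χ.orthonormal.1 i]
    exact norm_le_of_idem (inner_indicatorLp_comm hA) (indicatorLp_idem hA) _

/-- The proper version of the kernel of a positive trace class operator does not depend on the
eigenbasis. Off the diagonal the integrals over rectangles agree; on the diagonal, which is a null
set of pairs, the traces of the compressions to sets agree. -/
theorem hasSum_kernel_of_eigenbasis [Countable ι] [IsFiniteMeasure ν] {κ : Type*} [Countable κ]
    (φ : HilbertBasis ι ℂ (Lp ℂ 2 ν)) (ψ : HilbertBasis κ ℂ (Lp ℂ 2 ν))
    {T : Lp ℂ 2 ν →L[ℂ] Lp ℂ 2 ν} {a : ι → ℝ} {b : κ → ℝ} {k : α → α → ℂ}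
    (hTa : ∀ i, T (φ i) = (a i : ℂ) • φ i) (hTb : ∀ j, T (ψ j) = (b j : ℂ) • ψ j)
    (ha0 : ∀ i, 0 ≤ a i) (hb0 : ∀ j, 0 ≤ b j)
    (ha : Summable a) (hb : Summable b)
    (hk : ∀ᵐ p ∂(ν.prod ν), HasSum (fun j => (b j : ℂ) * ψ j p.1 * conj (ψ j p.2)) (k p.1 p.2))
    (hkd : ∀ᵐ x ∂ν, HasSum (fun j => (b j : ℂ) * ψ j x * conj (ψ j x)) (k x x)) :
    (∀ᵐ p ∂(ν.prod ν), HasSum (fun i => (a i : ℂ) * φ i p.1 * conj (φ i p.2)) (k p.1 p.2)) ∧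
    (∀ᵐ x ∂ν, HasSum (fun i => (a i : ℂ) * φ i x * conj (φ i x)) (k x x)) := by
  have ha' : Summable fun i => |a i| := by simpa only [abs_of_nonneg (ha0 _)] using ha
  have hb' : Summable fun i => |b i| := by simpa only [abs_of_nonneg (hb0 _)] using hb
  have hfa := tsum_lintegral_tensor_ne_top (fun i => φ.orthonormal.1 i) ha'
  have hfb := tsum_lintegral_tensor_ne_top (fun i => ψ.orthonormal.1 i) hb'
  constructor
  · have hia := integrable_tsum_of_tsum_lintegral_ne_top
      (fun i => aestronglyMeasurable_tensor (φ i) (a i)) hfa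
    have hib := integrable_tsum_of_tsum_lintegral_ne_top
      (fun i => aestronglyMeasurable_tensor (ψ i) (b i)) hfb
    have heq := ae_eq_of_forall_setIntegral_prod_eq hia hib fun A B hA hB => by
      rw [setIntegral_tensor_eq φ hTa ha' hA hB, setIntegral_tensor_eq ψ hTb hb' hA hB]
    filter_upwards [hk, heq, ae_summable_of_tsum_lintegral_ne_top
      (fun i => aestronglyMeasurable_tensor (φ i) (a i)) hfa] with p h1 h2 h3
    rw [← h1.tsum_eq, ← h2]
    exact h3.hasSum
  · have hfa2 := tsum_lintegral_diag_ne_top (fun i => φ.orthonormal.1 i) ha'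
    have hmeas : ∀ (f : Lp ℂ 2 ν) (c : ℂ),
        AEStronglyMeasurable (fun x => c * f x * conj (f x)) ν := by
      intro f c
      have hm : Measurable f := (Lp.stronglyMeasurable f).measurable
      exact ((hm.const_mul c).mul (Complex.continuous_conj.measurable.comp hm)).aestronglyMeasurable
    have heq : (fun x => ∑' i, ENNReal.ofReal (a i) * ‖φ i x‖ₑ ^ 2) =ᵐ[ν]
        fun x => ∑' j, ENNReal.ofReal (b j) * ‖ψ j x‖ₑ ^ 2 := by
      refine ae_eq_of_forall_setLIntegral_eq_of_sigmaFinite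
        (Measurable.tsum fun i => measurable_mul_enorm_sq (φ i) _) (Measurable.tsum fun i => measurable_mul_enorm_sq (ψ i) _)
        fun A hA _ => ?_
      rw [setLIntegral_diag_eq φ ha0 ha hA, setLIntegral_diag_eq ψ hb0 hb hA,
        tsum_mul_norm_sq_eq φ ψ hTa hTb ha' (inner_indicatorLp_comm hA) (indicatorLp_idem hA)]
    filter_upwards [hkd, heq, ae_summable_of_tsum_lintegral_ne_top
      (fun i => hmeas (φ i) (a i)) hfa2] with x h1 h2 h3
    have h4 := hasSum_mul_conj_of_summable ha0 h3
    have h5 := hasSum_mul_conj_of_summable hb0 h1.summable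
    rw [h1.unique h5, ← h2]
    exact h4

end Kernel

/-! ### The spectrum of the interaction operator -/
section ZeroExtension

variable {α : Type*} [MeasurableSpace α] {μ : Measure α} {C : Set α}

/-- Extension by zero. -/
noncomputable def zeroExt (hC : MeasurableSet C) (f : Lp ℂ 2 (μ.restrict C)) : Lp ℂ 2 μ :=
  ((memLp_indicator_iff_restrict hC).2 (Lp.memLp f)).toLp

theorem coeFn_zeroExt (hC : MeasurableSet C) (f : Lp ℂ 2 (μ.restrict C)) :
    zeroExt hC f =ᵐ[μ] C.indicator f :=
  MemLp.coeFn_toLp _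

theorem inner_zeroExt (hC : MeasurableSet C) (f : Lp ℂ 2 (μ.restrict C)) (g : Lp ℂ 2 μ) :
    inner ℂ (zeroExt hC f) g = ∫ x in C, inner ℂ (f x) (g x) ∂μ := by
  rw [L2.inner_def, ← integral_indicator hC]
  refine integral_congr_ae ?_
  filter_upwards [coeFn_zeroExt hC f] with x hx
  rw [hx]
  by_cases hxC : x ∈ C <;> simp [hxC]

theorem norm_zeroExt (hC : MeasurableSet C) (f : Lp ℂ 2 (μ.restrict C)) :
    ‖zeroExt hC f‖ = ‖f‖ := by
  have h : inner ℂ (zeroExt hC f) (zeroExt hC f) = inner ℂ f f := by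
    rw [inner_zeroExt, L2.inner_def]
    refine integral_congr_ae ?_
    filter_upwards [ae_restrict_of_ae (s := C) (coeFn_zeroExt hC f), ae_restrict_mem hC] with x hx hxC
    rw [hx, indicator_of_mem hxC]
  rw [inner_self_eq_norm_sq_to_K, inner_self_eq_norm_sq_to_K] at h
  have h2 : ‖zeroExt hC f‖ ^ 2 = ‖f‖ ^ 2 := by exact_mod_cast h
  exact (pow_left_inj₀ (norm_nonneg _) (norm_nonneg _) two_ne_zero).1 h2

theorem exists_zeroExt_eq (hC : MeasurableSet C) {f : Lp ℂ 2 μ} (hf : ∀ᵐ x ∂μ, x ∉ C → f x = 0) :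
    ∃ g : Lp ℂ 2 (μ.restrict C), zeroExt hC g = f := by
  refine ⟨((Lp.memLp f).restrict C).toLp, Lp.ext ?_⟩
  have h1 := (ae_restrict_iff' hC).1 (MemLp.coeFn_toLp ((Lp.memLp f).restrict C))
  filter_upwards [coeFn_zeroExt hC ((Lp.memLp f).restrict C).toLp, h1, hf] with x h2 h3 h4
  rw [h2]
  by_cases hx : x ∈ C
  · rw [indicator_of_mem hx, h3 hx]
  · rw [indicator_of_notMem hx, h4 hx]

end ZeroExtension

section Spectral

variable {d : ℕ} {S D : Set (Sp d)} {μ : Measure (Sp d)} {K J : Sp d → Sp d → ℂ}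

theorem IsIntegralOperator.unique {ν : Measure (Sp d)} {k : Sp d → Sp d → ℂ}
    {T T' : Lp ℂ 2 ν →L[ℂ] Lp ℂ 2 ν} (h : IsIntegralOperator ν k T)
    (h' : IsIntegralOperator ν k T') : T = T' :=
  ContinuousLinearMap.ext fun f => Lp.ext ((h f).trans (h' f).symm)

/-- The operator with kernel `K` on `S` acts on the square integrable functions of compact
support. -/
def IsKernelExtension (S : Set (Sp d)) (μ : Measure (Sp d)) (K : Sp d → Sp d → ℂ)
    (T : Lp ℂ 2 μ →L[ℂ] Lp ℂ 2 μ) : Prop :=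
  ∀ f : Lp ℂ 2 μ, (∃ C : Set (Sp d), C ⊆ S ∧ IsCompact C ∧ ∀ᵐ x ∂μ, x ∉ C → f x = 0) →
    (T f : Sp d → ℂ) =ᵐ[μ] fun x => ∫ y, K x y * f y ∂μ

/-- The operators `𝒦_C` are the compressions of the operator on `L²(S, μ)`. -/
theorem IsKernelExtension.inner_zeroExt {T : Lp ℂ 2 μ →L[ℂ] Lp ℂ 2 μ}
    (hT : IsKernelExtension S μ K T) {C : Set (Sp d)} (hCS : C ⊆ S) (hC : IsCompact C)
    {TC : Lp ℂ 2 (μ.restrict C) →L[ℂ] Lp ℂ 2 (μ.restrict C)}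
    (hTC : IsIntegralOperator (μ.restrict C) K TC) (f g : Lp ℂ 2 (μ.restrict C)) :
    inner ℂ (zeroExt hC.measurableSet f) (T (zeroExt hC.measurableSet g)) = inner ℂ f (TC g) := by
  rw [DPP.inner_zeroExt, L2.inner_def]
  refine integral_congr_ae ?_
  have h1 := coeFn_zeroExt hC.measurableSet g
  have h2 := hT (zeroExt hC.measurableSet g) ⟨C, hCS, hC, by
    filter_upwards [h1] with x hx hxC
    rw [hx, indicator_of_notMem hxC]⟩
  filter_upwards [ae_restrict_of_ae (s := C) h2, hTC g] with x hx hx'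
  rw [hx, hx']
  congr 1
  rw [← integral_indicator hC.measurableSet]
  refine integral_congr_ae ?_
  filter_upwards [h1] with y hy
  rw [hy]
  by_cases hyC : y ∈ C <;> simp [hyC]

/-- The square integrable functions that vanish outside a compact subset of `S`. -/
def compactSupportLp (S : Set (Sp d)) (μ : Measure (Sp d)) : Submodule ℂ (Lp ℂ 2 μ) where
  carrier := {f | ∃ C : Set (Sp d), C ⊆ S ∧ IsCompact C ∧ ∀ᵐ x ∂μ, x ∉ C → f x = 0}
  add_mem' := by
    rintro f g ⟨C, hCS, hC, hf⟩ ⟨C', hCS', hC', hg⟩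
    refine ⟨C ∪ C', union_subset hCS hCS', hC.union hC', ?_⟩
    filter_upwards [hf, hg, Lp.coeFn_add f g] with x h1 h2 h3 hx
    rw [mem_union, not_or] at hx
    refine h3.trans ?_
    rw [Pi.add_apply, h1 hx.1, h2 hx.2, add_zero]
  zero_mem' := ⟨∅, empty_subset _, isCompact_empty, by
    filter_upwards [Lp.coeFn_zero ℂ 2 μ] with x hx _
    exact hx⟩
  smul_mem' := by
    rintro c f ⟨C, hCS, hC, hf⟩
    refine ⟨C, hCS, hC, ?_⟩
    filter_upwards [hf, Lp.coeFn_smul c f] with x h1 h2 hx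
    simp [h2, h1 hx]

theorem dense_compactSupportLp (hS : IsOpen S) (hμS : μ Sᶜ = 0) :
    Dense (compactSupportLp S μ : Set (Lp ℂ 2 μ)) := by
  rw [Submodule.dense_iff_topologicalClosure_eq_top, Submodule.topologicalClosure_eq_top_iff,
    Submodule.eq_bot_iff]
  intro f hf
  have hC : ∀ C : Set (Sp d), C ⊆ S → IsCompact C → ∀ᵐ x ∂μ, x ∈ C → f x = 0 := by
    intro C hCS hC
    have hmem : indicatorLp hC.measurableSet f ∈ compactSupportLp S μ := ⟨C, hCS, hC, by
      filter_upwards [coeFn_indicatorLp hC.measurableSet f] with x hx hxC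
      rw [hx, indicator_of_notMem hxC]⟩
    have h1 := (Submodule.mem_orthogonal' _ f).1 hf _ hmem
    rw [norm_sq_eq_re_inner_of_idem (inner_indicatorLp_comm hC.measurableSet)
      (indicatorLp_idem hC.measurableSet)] at h1
    have h2 : indicatorLp hC.measurableSet f = 0 := by
      have : ‖indicatorLp hC.measurableSet f‖ ^ 2 = 0 := by exact_mod_cast h1
      simpa using this
    have h3 := coeFn_indicatorLp hC.measurableSet f
    rw [h2] at h3
    filter_upwards [h3, Lp.coeFn_zero ℂ 2 μ] with x h4 h5 hx
    rw [← indicator_of_mem hx f, ← h4, h5]; rfl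
  refine Lp.ext ?_
  have hnull : μ {x | x ∈ S ∧ f x ≠ 0} = 0 := by
    refine measure_null_of_locally_null _ fun x hx => ?_
    obtain ⟨C, hCc, hxC, hCS⟩ := exists_compact_subset hS hx.1
    refine ⟨{x | x ∈ S ∧ f x ≠ 0} ∩ C,
      inter_mem self_mem_nhdsWithin (mem_nhdsWithin_of_mem_nhds (mem_interior_iff_mem_nhds.1 hxC)), ?_⟩
    refine measure_mono_null ?_ (ae_iff.1 (hC C hCS hCc))
    rintro y ⟨hy, hyC⟩ h
    exact hy.2 (h hyC)
  have h1 : ∀ᵐ x ∂μ, x ∈ S := by rw [ae_iff]; exact hμS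
  have h2 : ∀ᵐ x ∂μ, ¬ (x ∈ S ∧ f x ≠ 0) := by rw [ae_iff]; simpa using hnull
  filter_upwards [h1, h2, Lp.coeFn_zero ℂ 2 μ] with x h3 h4 h5
  rw [h5]
  by_contra h
  exact h4 ⟨h3, h⟩

/-- The operator is symmetric on each compact set, as it has a real eigenbasis there, and so it is
on the dense subspace of the functions of compact support. -/
theorem IsKernelExtension.isSelfAdjoint (h1 : HypH1 S μ K) (hS : IsOpen S) (hμS : μ Sᶜ = 0)
    {T : Lp ℂ 2 μ →L[ℂ] Lp ℂ 2 μ} (hT : IsKernelExtension S μ K T) : IsSelfAdjoint T := by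
  rw [ContinuousLinearMap.isSelfAdjoint_iff_isSymmetric]
  have hd := dense_compactSupportLp hS hμS
  have key : ∀ f ∈ compactSupportLp S μ, ∀ g ∈ compactSupportLp S μ,
      inner ℂ (T f) g = inner ℂ f (T g) := by
    rintro f ⟨C, hCS, hC, hf⟩ g ⟨C', hCS', hC', hg⟩
    have hcc := hC.union hC'
    have hsub := union_subset hCS hCS'
    obtain ⟨TC, hTC, ι, _, φ, l, hl, -⟩ := h1.locTraceClass _ hsub hcc
    obtain ⟨f', rfl⟩ := exists_zeroExt_eq hcc.measurableSet (f := f) (by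
      filter_upwards [hf] with x hx hxC using hx fun h => hxC (Or.inl h))
    obtain ⟨g', rfl⟩ := exists_zeroExt_eq hcc.measurableSet (f := g) (by
      filter_upwards [hg] with x hx hxC using hx fun h => hxC (Or.inr h))
    rw [← inner_conj_symm, hT.inner_zeroExt hsub hcc hTC, hT.inner_zeroExt hsub hcc hTC,
      inner_conj_symm, inner_map_comm_of_hilbertBasis φ hl]
  intro f g
  have step1 : ∀ f ∈ compactSupportLp S μ, ∀ g, inner ℂ (T f) g = inner ℂ f (T g) := by
    intro f hf g
    have := Continuous.ext_on hd (f := fun g => inner ℂ (T f) g) (g := fun g => inner ℂ f (T g))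
      (by fun_prop) (by fun_prop) fun g hg => key f hf g hg
    exact congrFun this g
  have := Continuous.ext_on hd (f := fun f => inner ℂ (T f) g) (g := fun f => inner ℂ f (T g))
    (by fun_prop) (by fun_prop) fun f hf => step1 f hf g
  exact congrFun this f

/-- The interaction operator `𝒥` has eigenvalues `q ≥ 0`, and the eigenfunctions of `𝒥` expand both
its kernel and the kernel `K`, which has the eigenvalues `q / (1 + q)`. -/
theorem exists_common_eigenbasis (hS : IsOpen S) (hD : IsCompact D) (hDS : D ⊆ S)
    (hμS : μ Sᶜ = 0) [IsFiniteMeasure (μ.restrict D)] (h1 : HypH1 S μ K)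
    (hJ : IsInteractionKernel D μ K J) :
    ∃ (ι : Type) (_ : Countable ι) (φ : HilbertBasis ι ℂ (Lp ℂ 2 (μ.restrict D))) (q : ι → NNReal),
      Summable q ∧
      (∀ᵐ p ∂((μ.restrict D).prod (μ.restrict D)),
        HasSum (fun i => ((q i : ℝ) : ℂ) * φ i p.1 * conj (φ i p.2)) (J p.1 p.2)) ∧
      (∀ᵐ x ∂(μ.restrict D), HasSum (fun i => ((q i : ℝ) : ℂ) * φ i x * conj (φ i x)) (J x x)) ∧
      (∀ᵐ p ∂((μ.restrict D).prod (μ.restrict D)),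
        HasSum (fun i => (((q i / (1 + q i) : NNReal) : ℝ) : ℂ) * φ i p.1 * conj (φ i p.2))
          (K p.1 p.2)) ∧
      (∀ᵐ x ∂(μ.restrict D),
        HasSum (fun i => (((q i / (1 + q i) : NNReal) : ℝ) : ℂ) * φ i x * conj (φ i x)) (K x x)) := by
  obtain ⟨TS, hTS, hspec⟩ := h1.spectrum_subset
  obtain ⟨hpos, hnorm⟩ := exists_lt_one_of_spectrum_subset
    (IsKernelExtension.isSelfAdjoint h1 hS hμS hTS) hspec
  obtain ⟨-, T, hT, -, ι, hι, φ, l, hl, hls, hJp, hJd⟩ := hJ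
  obtain ⟨T', hT', κ, hκ, ψ, b, hb, hbs, hKp, hKd⟩ := h1.locTraceClass D hDS hD
  obtain rfl := hT.unique hT'
  have hcomp := IsKernelExtension.inner_zeroExt hTS hDS hD hT
  have hpos' : ∀ f, 0 ≤ (inner ℂ f (T f)).re := fun f => by
    rw [← hcomp]; exact hpos _
  -- `T` is a compression of `TS`, so its norm is at most that of `TS`, and `1 - T` is invertible
  have hle : ∀ f, ‖T f‖ ≤ ‖TS‖ * ‖f‖ := by
    intro f
    have h2 : ‖inner ℂ (T f) (T f)‖ ≤ ‖TS‖ * ‖f‖ * ‖T f‖ := by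
      rw [← hcomp]
      calc _ ≤ _ := norm_inner_le_norm (𝕜 := ℂ) _ _
        _ ≤ ‖T f‖ * (‖TS‖ * ‖f‖) := by
          rw [norm_zeroExt]
          gcongr
          exact (TS.le_opNorm _).trans (by rw [norm_zeroExt])
        _ = _ := by ring
    rw [inner_self_eq_norm_sq_to_K, norm_pow, RCLike.norm_ofReal,
      abs_norm, sq] at h2
    rcases (norm_nonneg (T f)).eq_or_lt with h3 | h3
    · rw [← h3]; positivity
    · exact le_of_mul_le_mul_right h2 h3
  have hTn : ‖T‖ < 1 := lt_of_le_of_lt (T.opNorm_le_bound (norm_nonneg _) hle) hnorm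
  have hunit := isUnit_one_sub_of_norm_lt_one hTn
  -- `𝒥 φ = l φ` with `𝒥 = (1 - T)⁻¹ T` means that `(1 + l) T φ = l φ`
  have heig : ∀ i, (1 + l i : ℂ) • T (φ i) = (l i : ℂ) • φ i := by
    intro i
    have h2 : (1 - T) * (Ring.inverse (1 - T) * T) = T := by
      rw [← mul_assoc, Ring.mul_inverse_cancel _ hunit, one_mul]
    have h3 : (1 - T) ((Ring.inverse (1 - T) * T) (φ i)) = T (φ i) := DFunLike.congr_fun h2 (φ i)
    rw [hl] at h3
    simp only [map_smul, sub_apply, one_apply_eq_self,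
      smul_sub] at h3
    rw [add_smul, one_smul]
    nth_rewrite 1 [← h3]
    abel
  have hφ1 : ∀ i, inner ℂ (φ i) (φ i) = (1 : ℂ) := fun i => by
    rw [inner_self_eq_norm_sq_to_K, φ.orthonormal.1 i]; simp
  have hval : ∀ i, (1 + l i) * (inner ℂ (φ i) (T (φ i))).re = l i := by
    intro i
    have h2 := congrArg (fun f => (inner ℂ (φ i) f).re) (heig i)
    simp only [inner_smul_right, hφ1] at h2
    have h3 : ((1 + l i : ℂ) * inner ℂ (φ i) (T (φ i))).re =
        (1 + l i) * (inner ℂ (φ i) (T (φ i))).re := by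
      rw [← Complex.re_ofReal_mul]; push_cast; rfl
    rw [← h3, h2]; simp
  -- `t = ⟨φ, T φ⟩` is in `[0, 1)` and `(1 + l) t = l`, whence `l ≥ 0`
  have hl0 : ∀ i, 0 ≤ l i := by
    intro i
    have h2 := hpos' (φ i)
    have h3 : (inner ℂ (φ i) (T (φ i))).re < 1 := by
      refine lt_of_le_of_lt ((Complex.re_le_norm _).trans (norm_inner_le_norm (𝕜 := ℂ) _ _)) ?_
      have := hle (φ i)
      rw [φ.orthonormal.1 i] at this ⊢
      linarith
    have h4 := hval i
    by_contra! hneg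
    nlinarith
  have hTφ : ∀ i, T (φ i) = ((l i / (1 + l i) : ℝ) : ℂ) • φ i := by
    intro i
    have h2 : (1 + l i : ℂ) ≠ 0 := by
      have : (1 + l i : ℝ) ≠ 0 := by linarith [hl0 i]
      exact_mod_cast this
    rw [← smul_right_injective _ h2 |>.eq_iff]
    simp only [heig, smul_smul]
    congr 1
    push_cast
    field_simp
  have hb0 : ∀ j, 0 ≤ b j := by
    intro j
    have h2 := hpos' (ψ j)
    rw [hb, inner_smul_right, inner_self_eq_norm_sq_to_K, ψ.orthonormal.1 j] at h2
    simpa using h2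
  have hls' : Summable l := by simpa only [abs_of_nonneg (hl0 _)] using hls
  have hbs' : Summable b := by simpa only [abs_of_nonneg (hb0 _)] using hbs
  have hlq : ∀ i, 0 ≤ l i / (1 + l i) := fun i => div_nonneg (hl0 i) (by linarith [hl0 i])
  have hker := hasSum_kernel_of_eigenbasis φ ψ hTφ hb hlq hb0
    (Summable.of_nonneg_of_le hlq (fun i => div_le_self (hl0 i) (by linarith [hl0 i])) hls') hbs'
    hKp hKd
  have hr : ∀ i, ((l i).toNNReal : ℝ) = l i := fun i => Real.coe_toNNReal _ (hl0 i)
  have hq : ∀ i, ((((l i).toNNReal / (1 + (l i).toNNReal) : NNReal) : ℝ) : ℂ) =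
      ((l i / (1 + l i) : ℝ) : ℂ) := fun i => by
    rw [NNReal.coe_div, NNReal.coe_add, hr]; rfl
  refine ⟨ι, hι, φ, fun i => (l i).toNNReal, ?_, ?_, ?_, ?_, ?_⟩
  · exact NNReal.summable_coe.1 (by simpa only [hr] using hls')
  · simp only [hr]; exact hJp
  · simp only [hr]; exact hJd
  · simp only [hq]; exact hker.1
  · simp only [hq]; exact hker.2

end Spectral

/-! ### The law of the determinantal process -/
section Pi

variable {α : Type*} [MeasurableSpace α] {ν : Measure α} [SigmaFinite ν]

theorem lintegral_pi_prod {n : ℕ} {f : Fin n → α → ℝ≥0∞} (hf : ∀ i, Measurable (f i)) :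
    ∫⁻ x, ∏ i, f i (x i) ∂(Measure.pi fun _ : Fin n => ν) = ∏ i, ∫⁻ y, f i y ∂ν := by
  induction n with
  | zero => simp
  | succ n ih =>
    have hm : Measurable fun x : Fin (n + 1) → α => ∏ i, f i (x i) :=
      Finset.measurable_prod _ fun i _ => (hf i).comp (measurable_pi_apply i)
    have hm' : Measurable fun x : Fin n → α => ∏ i : Fin n, f i.castSucc (x i) :=
      Finset.measurable_prod _ fun i _ => (hf _).comp (measurable_pi_apply i)
    rw [lintegral_pi_snoc hm]
    simp only [Fin.prod_univ_castSucc, Fin.snoc_castSucc, Fin.snoc_last]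
    have : ∀ x : Fin n → α, ∫⁻ y, (∏ i : Fin n, f i.castSucc (x i)) * f (Fin.last n) y ∂ν =
        (∏ i : Fin n, f i.castSucc (x i)) * ∫⁻ y, f (Fin.last n) y ∂ν := fun x =>
      lintegral_const_mul _ (hf _)
    simp only [this]
    rw [lintegral_mul_const _ hm', ih fun i => hf i.castSucc]

theorem pi_withDensity {n : ℕ} {r : α → ℝ≥0∞} (hr : Measurable r) [SigmaFinite (ν.withDensity r)] :
    (Measure.pi fun _ : Fin n => ν.withDensity r) =
      (Measure.pi fun _ : Fin n => ν).withDensity fun x => ∏ i, r (x i) := by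
  refine Measure.pi_eq fun s hs => ?_
  rw [withDensity_apply _ (MeasurableSet.univ_pi hs), ← lintegral_indicator (MeasurableSet.univ_pi hs)]
  have h1 : ∀ x : Fin n → α, (univ.pi s).indicator (fun x => ∏ i, r (x i)) x =
      ∏ i, (s i).indicator r (x i) := by
    intro x
    by_cases hx : x ∈ univ.pi s
    · rw [indicator_of_mem hx]
      exact Finset.prod_congr rfl fun i _ => (indicator_of_mem (hx i (mem_univ i)) _).symm
    · rw [indicator_of_notMem hx]
      simp only [Set.mem_pi, mem_univ, true_imp_iff, not_forall] at hx
      obtain ⟨i, hi⟩ := hx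
      exact (Finset.prod_eq_zero (Finset.mem_univ i) (indicator_of_notMem hi _)).symm
  simp only [h1]
  rw [lintegral_pi_prod fun i => hr.indicator (hs i)]
  refine Finset.prod_congr rfl fun i _ => ?_
  rw [lintegral_indicator (hs i), withDensity_apply _ (hs i)]

theorem pi_restrict {n : ℕ} (s : Fin n → Set α) :
    (Measure.pi fun i : Fin n => ν.restrict (s i)) =
      (Measure.pi fun _ : Fin n => ν).restrict (univ.pi s) := by
  refine Measure.pi_eq fun t ht => ?_
  rw [Measure.restrict_apply (MeasurableSet.univ_pi ht), ← Set.pi_inter_distrib, Measure.pi_pi]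
  exact Finset.prod_congr rfl fun i _ => (Measure.restrict_apply (ht i)).symm

/-- A property of almost all pairs and of almost all points of the diagonal holds for almost all
`n`-tuples. -/
theorem ae_pi_forall_pair {P : α → α → Prop} (h : ∀ᵐ p ∂(ν.prod ν), P p.1 p.2)
    (hd : ∀ᵐ x ∂ν, P x x) (n : ℕ) :
    ∀ᵐ x ∂(Measure.pi fun _ : Fin n => ν), ∀ i j, P (x i) (x j) := by
  refine ae_all_iff.2 fun i => ae_all_iff.2 fun j => ?_
  by_cases hij : i = j
  · subst hij
    exact (Measure.quasiMeasurePreserving_eval (μ := fun _ : Fin n => ν) i).ae hd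
  · obtain ⟨n, rfl⟩ : ∃ m, n = m + 1 := ⟨n - 1, by have := i.2; omega⟩
    obtain ⟨k, rfl⟩ := Fin.exists_succAbove_eq (Ne.symm hij)
    have h1 := (measurePreserving_piFinSuccAbove (fun _ : Fin (n + 1) => ν) i).quasiMeasurePreserving
    have h2 : Measure.QuasiMeasurePreserving (Prod.map id (Function.eval k))
        (ν.prod (Measure.pi fun _ : Fin n => ν)) (ν.prod ν) :=
      MeasureTheory.QuasiMeasurePreserving.prodMap (Measure.QuasiMeasurePreserving.id ν)
        (Measure.quasiMeasurePreserving_eval (μ := fun _ : Fin n => ν) k)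
    exact (h2.comp h1).ae h

end Pi

section Law

variable {d : ℕ} {S D : Set (Sp d)} {μ : Measure (Sp d)} {K J : Sp d → Sp d → ℂ} {ι : Type*}
  [DecidableEq ι]

/-- The determinants of a kernel with eigenfunctions `φ` and eigenvalues `q ≥ 0`. -/
theorem ae_slaterSum_eq {k : Sp d → Sp d → ℂ} [SigmaFinite (μ.restrict D)]
    (φ : ι → Lp ℂ 2 (μ.restrict D)) (q : ι → NNReal)
    (hp : ∀ᵐ p ∂((μ.restrict D).prod (μ.restrict D)),
      HasSum (fun i => ((q i : ℝ) : ℂ) * φ i p.1 * conj (φ i p.2)) (k p.1 p.2))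
    (hd : ∀ᵐ x ∂(μ.restrict D), HasSum (fun i => ((q i : ℝ) : ℂ) * φ i x * conj (φ i x)) (k x x))
    (n : ℕ) :
    ∀ᵐ x ∂(Measure.pi fun _ : Fin n => μ.restrict D),
      slaterSum φ (fun i => (q i : ℝ≥0∞)) 0 n x = n.factorial * ENNReal.ofReal (kdet k n x) ∧
        0 ≤ kdet k n x := by
  filter_upwards [ae_pi_forall_pair (P := fun x y =>
    HasSum (fun i => ((q i : ℝ) : ℂ) * φ i x * conj (φ i y)) (k x y)) hp hd n] with x hx
  have h := factorial_mul_ofReal_det_eq_tsum φ q hx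
  rw [slaterSum_zero_eq]
  exact ⟨h.1.symm, h.2⟩

/-- The law of the restriction of the determinantal process to `D` has Janossy densities
proportional to the determinants of the interaction kernel. -/
theorem lawD_eq_janossyLaw [Countable ι] (hD : IsCompact D) (hDS : D ⊆ S) [SigmaFinite μ]
    [IsFiniteMeasure (μ.restrict D)]
    {φ : ι → Lp ℂ 2 (μ.restrict D)} (hφ : Orthonormal ℂ φ) {q : ι → NNReal} (hq : Summable q)
    (hKp : ∀ᵐ p ∂((μ.restrict D).prod (μ.restrict D)),
      HasSum (fun i => (((q i / (1 + q i) : NNReal) : ℝ) : ℂ) * φ i p.1 * conj (φ i p.2))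
        (K p.1 p.2))
    (hKd : ∀ᵐ x ∂(μ.restrict D),
      HasSum (fun i => (((q i / (1 + q i) : NNReal) : ℝ) : ℂ) * φ i x * conj (φ i x)) (K x x))
    {Ω : Type*} [MeasurableSpace Ω] (P : Measure Ω) [IsProbabilityMeasure P]
    {X : Ω → LocFinConf S} (hX : IsDeterminantal S μ K P X) :
    lawD hD hDS P X = janossyLaw φ fun i => (q i : ℝ≥0∞) := by
  have hq' : ∑' i, (q i : ℝ≥0∞) ≠ ∞ := ENNReal.tsum_coe_ne_top_iff_summable.2 hq
  have hmeas : Measurable fun ω => LocFinConf.restrict hD hDS (X ω) :=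
    (LocFinConf.measurable_restrict hD hDS).comp hX.1
  have : IsProbabilityMeasure (lawD hD hDS P X) := Measure.isProbabilityMeasure_map hmeas.aemeasurable
  have : IsProbabilityMeasure (janossyLaw φ fun i => (q i : ℝ≥0∞)) :=
    isProbabilityMeasure_janossyLaw hD hφ hq'
  refine SameDisjointMoments.eq hD (fun k A hA hd => ?_)
    (lintegral_two_pow_janossyLaw_ne_top hD hφ hq')
  rcases Nat.eq_zero_or_pos k with rfl | hk
  · simp
  have hprod : Measurable fun B : FinConf D => ∏ i, (B.num (A i) : ℝ≥0∞) :=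
    Finset.measurable_prod _ fun i _ => measurable_coe_num hD (hA i)
  have hAD : ∀ i, MeasurableSet (A i ∩ D) := fun i => (hA i).inter hD.measurableSet
  rw [lintegral_prod_num_janossyLaw hD hφ hq' hA hd, lawD, lintegral_map hprod hmeas]
  have h1 : ∀ ω, ∏ i, (((LocFinConf.restrict hD hDS (X ω)).num (A i) : ℕ) : ℝ≥0∞) =
      ∏ i, (((X ω).1 ∩ (A i ∩ D)).encard : ℝ≥0∞) := by
    intro ω
    refine Finset.prod_congr rfl fun i _ => ?_
    have hset : ((LocFinConf.restrict hD hDS (X ω)).1 : Set (Sp d)) ∩ A i =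
        (X ω).1 ∩ (A i ∩ D) := by
      simp only [LocFinConf.restrict, Set.Finite.coe_toFinset]
      rw [inter_assoc, inter_comm D]
    have hfin : ((X ω).1 ∩ (A i ∩ D)).Finite :=
      ((X ω).2.2 D hDS hD).subset (inter_subset_inter_right _ inter_subset_right)
    rw [FinConf.num, hset, ← hfin.cast_ncard_eq]
    simp
  simp only [h1]
  rw [hX.2 k (fun i => A i ∩ D) hk hAD (fun i => inter_subset_right.trans hDS)
    fun i j hij => (hd hij).mono inter_subset_left inter_subset_left]
  have hrest : (Measure.pi fun _ : Fin k => μ).restrict (univ.pi fun i => A i ∩ D) =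
      (Measure.pi fun _ : Fin k => μ.restrict D).restrict (univ.pi A) := by
    rw [← pi_restrict, ← pi_restrict]
    simp only [Measure.restrict_restrict (hA _)]
  have hf : (k.factorial : ℝ≥0∞) ≠ 0 := by exact_mod_cast Nat.factorial_ne_zero k
  have hf' : (k.factorial : ℝ≥0∞) ≠ ∞ := ENNReal.natCast_ne_top _
  rw [hrest, ← lintegral_const_mul _ (measurable_slaterSum _ _ _ _)]
  refine lintegral_congr_ae (ae_restrict_of_ae ?_)
  filter_upwards [ae_slaterSum_eq φ (fun i => q i / (1 + q i)) hKp hKd k] with x hx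
  have hlam : (fun i => (q i : ℝ≥0∞) / (1 + q i)) = fun i => ((q i / (1 + q i) : NNReal) : ℝ≥0∞) := by
    funext i
    rw [ENNReal.coe_div (by positivity)]
    push_cast; rfl
  rw [hlam, hx.1, ← mul_assoc, ENNReal.inv_mul_cancel hf hf', one_mul]

theorem janossy_eq_withDensity [Countable ι] [SigmaFinite (μ.restrict D)]
    {φ : ι → Lp ℂ 2 (μ.restrict D)} {q : ι → NNReal}
    (hp : ∀ᵐ p ∂((μ.restrict D).prod (μ.restrict D)),
      HasSum (fun i => ((q i : ℝ) : ℂ) * φ i p.1 * conj (φ i p.2)) (J p.1 p.2))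
    (hd : ∀ᵐ x ∂(μ.restrict D), HasSum (fun i => ((q i : ℝ) : ℂ) * φ i x * conj (φ i x)) (J x x))
    (n : ℕ) :
    janossy φ (fun i => (q i : ℝ≥0∞)) n = (Measure.pi fun _ : Fin n => μ.restrict D).withDensity
      fun x => ((partitionSum (fun i => (q i : ℝ≥0∞)) ∅)⁻¹ * (n.factorial : ℝ≥0∞)⁻¹) *
        ENNReal.ofReal (kdet J n x) := by
  refine withDensity_congr_ae ?_
  filter_upwards [ae_slaterSum_eq φ q hp hd n] with x hx
  have hf : (n.factorial : ℝ≥0∞) ≠ 0 := by exact_mod_cast Nat.factorial_ne_zero n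
  have hf' : (n.factorial : ℝ≥0∞) ≠ ∞ := ENNReal.natCast_ne_top _
  rw [hx.1]
  calc _ = (partitionSum (fun i => (q i : ℝ≥0∞)) ∅)⁻¹ * (n.factorial : ℝ≥0∞)⁻¹ *
        ENNReal.ofReal (kdet J n x) * ((n.factorial : ℝ≥0∞)⁻¹ * (n.factorial : ℝ≥0∞)) := by ring
    _ = _ := by rw [ENNReal.inv_mul_cancel hf hf', mul_one]

theorem measurable_kdet (hJ : Measurable (uncurry J)) (n : ℕ) : Measurable (kdet J n) := by
  unfold kdet
  refine Complex.measurable_re.comp ?_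
  simp only [Matrix.det_apply]
  refine Finset.measurable_sum _ fun σ _ => Measurable.const_smul ?_ _
  refine Finset.measurable_prod _ fun i _ => ?_
  exact hJ.comp (f := fun x : Fin n → Sp d => (x (σ i), x i))
    ((measurable_pi_apply (σ i)).prodMk (measurable_pi_apply i))

/-- The reference measure on `D^n`, by its Lebesgue density. -/
theorem HypH2.pi_restrict_eq {ρ : Sp d → ℝ} (h2 : HypH2 S D μ ρ) (hD : MeasurableSet D)
    (hDS : D ⊆ S) (n : ℕ) :
    (Measure.pi fun _ : Fin n => μ.restrict D) =
      (volume.restrict (cube D n)).withDensity fun x => ∏ i, ENNReal.ofReal (ρ (x i)) := by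
  have hres : μ.restrict D = (volume.restrict D).withDensity fun x => ENNReal.ofReal (ρ x) := by
    conv_lhs => rw [h2.density]
    rw [restrict_withDensity hD, Measure.restrict_restrict_of_subset hDS]
  have hcube : cube D n = univ.pi fun _ : Fin n => D := by ext x; simp [cube]
  have hsf' : SigmaFinite ((volume.restrict D).withDensity fun x => ENNReal.ofReal (ρ x)) :=
    SigmaFinite.withDensity_ofReal _
  rw [hres, pi_withDensity h2.measurable.ennreal_ofReal, pi_restrict, hcube]
  rfl

/-- The law of the restriction to `D`, in terms of Lebesgue measure: its part on the configurations
of `n` points has the density `c_n det J[D](x_1, …, x_n) ρ(x_1) ⋯ ρ(x_n)`. -/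
theorem exists_lawD_eq_sum {ρ : Sp d → ℝ} (hS : IsOpen S) (hD : IsCompact D) (hDS : D ⊆ S)
    (hμS : μ Sᶜ = 0) (hμ : μ D < ∞) (h1 : HypH1 S μ K)
    (hJ : IsInteractionKernel D μ K J) (h2 : HypH2 S D μ ρ)
    {Ω : Type*} [MeasurableSpace Ω] (P : Measure Ω) [IsProbabilityMeasure P]
    {X : Ω → LocFinConf S} (hX : IsDeterminantal S μ K P X) :
    ∃ c : ℕ → ℝ, (∀ n, 0 < c n) ∧
      lawD hD hDS P X = Measure.sum (fun n =>
        ((volume.restrict (cube D n)).withDensity fun x =>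
          ENNReal.ofReal (c n * kdet J n x * ∏ i, ρ (x i))).map (FinConf.ofPts D n)) ∧
      ∀ n, (∀ᵐ x ∂(volume.restrict (cube D n)), 0 ≤ kdet J n x) ∧
        (∀ᵐ x ∂((volume.restrict (cube D n)).withDensity fun x =>
          ENNReal.ofReal (c n * kdet J n x * ∏ i, ρ (x i))), x ∈ cube D n ∧ Injective x) ∧
        ∀ σ : Equiv.Perm (Fin n), MeasurePreserving (fun x : Fin n → Sp d => x ∘ σ)
          ((volume.restrict (cube D n)).withDensity fun x =>
            ENNReal.ofReal (c n * kdet J n x * ∏ i, ρ (x i)))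
          ((volume.restrict (cube D n)).withDensity fun x =>
            ENNReal.ofReal (c n * kdet J n x * ∏ i, ρ (x i))) := by
  classical
  have hfin : IsFiniteMeasure (μ.restrict D) := ⟨by simpa using hμ⟩
  have hsf : SigmaFinite μ := by
    rw [h2.density]; infer_instance
  obtain ⟨ι, hι, φ, q, hq, hJp, hJd, hKp, hKd⟩ := exists_common_eigenbasis hS hD hDS hμS h1 hJ
  have hq' : ∑' i, (q i : ℝ≥0∞) ≠ ∞ := ENNReal.tsum_coe_ne_top_iff_summable.2 hq
  set Z := partitionSum (fun i => (q i : ℝ≥0∞)) ∅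
  have hZ0 : Z ≠ 0 := (lt_of_lt_of_le one_pos (one_le_partitionSum _ _)).ne'
  have hZ : Z ≠ ∞ := partitionSum_ne_top hq' _
  have hrho : Measurable fun x => ENNReal.ofReal (ρ x) := h2.measurable.ennreal_ofReal
  have hpi := h2.pi_restrict_eq hD.measurableSet hDS
  have hprodm : ∀ n, Measurable fun x : Fin n → Sp d => ∏ i, ENNReal.ofReal (ρ (x i)) := fun n =>
    Finset.measurable_prod _ fun i _ => hrho.comp (measurable_pi_apply i)
  have hpos : ∀ n, ∀ᵐ x ∂(volume.restrict (cube D n)), 0 ≤ kdet J n x := by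
    intro n
    have h3 := (ae_slaterSum_eq φ q hJp hJd n).mono fun x hx => hx.2
    rw [hpi, ae_withDensity_iff (hprodm n)] at h3
    filter_upwards [h3, ae_restrict_mem (measurableSet_cube hD.measurableSet n)] with x hx hxc
    refine hx (Finset.prod_ne_zero_iff.2 fun i _ => ?_)
    simpa using h2.pos _ (hxc i)
  have hjan : ∀ n, janossy φ (fun i => (q i : ℝ≥0∞)) n =
      (volume.restrict (cube D n)).withDensity fun x =>
          ENNReal.ofReal ((Z⁻¹ * (n.factorial : ℝ≥0∞)⁻¹).toReal * kdet J n x * ∏ i, ρ (x i)) := by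
    intro n
    have hmk : Measurable fun x => (partitionSum (fun i => (q i : ℝ≥0∞)) ∅)⁻¹ *
        ((n.factorial : ℝ≥0∞)⁻¹ * (n.factorial : ℝ≥0∞)⁻¹) *
          slaterSum φ (fun i => (q i : ℝ≥0∞)) 0 n x := measurable_janossyDensity _ _ n
    have hmk' : Measurable fun x : Fin n → Sp d => (Z⁻¹ * (n.factorial : ℝ≥0∞)⁻¹) *
        ENNReal.ofReal (kdet J n x) := by
      exact (measurable_kdet hJ.1 n).ennreal_ofReal.const_mul _
    rw [janossy_eq_withDensity hJp hJd n, hpi, ← withDensity_mul _ (hprodm n) hmk']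
    refine withDensity_congr_ae ?_
    filter_upwards [hpos n, ae_restrict_mem (measurableSet_cube hD.measurableSet n)] with x hx hxc
    have hr : ∀ i ∈ Finset.univ, 0 ≤ ρ (x i) := fun i _ => (h2.pos _ (hxc i)).le
    have hne : Z⁻¹ * (n.factorial : ℝ≥0∞)⁻¹ ≠ ∞ :=
      ENNReal.mul_ne_top (ENNReal.inv_ne_top.2 hZ0)
        (ENNReal.inv_ne_top.2 (by exact_mod_cast Nat.factorial_ne_zero n))
    simp only [Pi.mul_apply]
    rw [ENNReal.ofReal_mul (mul_nonneg ENNReal.toReal_nonneg hx),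
      ENNReal.ofReal_mul ENNReal.toReal_nonneg, ENNReal.ofReal_toReal hne,
      ENNReal.ofReal_prod_of_nonneg hr, mul_comm]
  refine ⟨fun n => (Z⁻¹ * (n.factorial : ℝ≥0∞)⁻¹).toReal, fun n => ?_, ?_, fun n => ⟨hpos n, ?_⟩⟩
  · refine ENNReal.toReal_pos (mul_ne_zero (ENNReal.inv_ne_zero.2 hZ)
      (ENNReal.inv_ne_zero.2 (ENNReal.natCast_ne_top _))) (ENNReal.mul_ne_top (ENNReal.inv_ne_top.2 hZ0)
        (ENNReal.inv_ne_top.2 (by exact_mod_cast Nat.factorial_ne_zero n)))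
  · rw [lawD_eq_janossyLaw hD hDS φ.orthonormal hq hKp hKd P hX, janossyLaw]
    simp only [hjan]
  · rw [← hjan]
    exact ⟨ae_janossy_mem hD.measurableSet n, fun σ => janossy_measurePreserving σ⟩

end Law

/-! ### Square integrable functionals of configurations -/
section ConfLaw

variable {d : ℕ} {D : Set (Sp d)}

/-- The measure on the configurations whose part on the configurations of `n` points is the image
of the measure `m n` on ordered `n`-tuples. -/
noncomputable def confLaw (D : Set (Sp d)) (m : ∀ n : ℕ, Measure (Fin n → Sp d)) :
    Measure (FinConf D) :=
  Measure.sum fun n => (m n).map (FinConf.ofPts D n)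

/-- The measures `m n` are symmetric and carried by the `n`-tuples of distinct points of `D`. -/
structure IsSymmFamily (D : Set (Sp d)) (m : ∀ n : ℕ, Measure (Fin n → Sp d)) : Prop where
  mem : ∀ n, ∀ᵐ x ∂(m n), x ∈ cube D n ∧ Injective x
  perm : ∀ (n : ℕ) (σ : Equiv.Perm (Fin n)),
    MeasurePreserving (fun x : Fin n → Sp d => x ∘ σ) (m n) (m n)

/-- The functions `g n` are symmetric, almost everywhere. -/
def IsAESymm (m : ∀ n : ℕ, Measure (Fin n → Sp d)) (g : ∀ k : ℕ, (Fin k → Sp d) → ℝ) : Prop :=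
  ∀ (n : ℕ) (σ : Equiv.Perm (Fin n)), ∀ᵐ x ∂(m n), g n (x ∘ σ) = g n x

variable {m : ∀ n : ℕ, Measure (Fin n → Sp d)} {g : ∀ k : ℕ, (Fin k → Sp d) → ℝ}

theorem IsSymmFamily.ae_confLaw (hm : IsSymmFamily D m) (hD : IsCompact D) {p : FinConf D → Prop}
    (h : ∀ n, ∀ᵐ x ∂(m n), p (FinConf.ofPts D n x)) : ∀ᵐ B ∂(confLaw D m), p B := by
  rw [confLaw, Measure.ae_sum_iff]
  exact fun n => FinConf.ae_map_ofPts hD (hm.perm n) (hm.mem n) (h n)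

theorem ae_of_ae_confLaw (hD : IsCompact D) {p : FinConf D → Prop}
    (h : ∀ᵐ B ∂(confLaw D m), p B) (n : ℕ) : ∀ᵐ x ∂(m n), p (FinConf.ofPts D n x) := by
  rw [confLaw, Measure.ae_sum_iff] at h
  exact ae_of_ae_map (FinConf.measurable_ofPts hD n).aemeasurable (h n)

theorem IsSymmFamily.evalConf_ofPts (hm : IsSymmFamily D m) (hg : IsAESymm m g) (n : ℕ) :
    ∀ᵐ x ∂(m n), evalConf D g (FinConf.ofPts D n x) = g n x := by
  filter_upwards [hm.mem n, ae_all_iff.2 (hg n)] with x hx hσ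
  obtain ⟨τ, hτ⟩ := FinConf.exists_perm_evalConf_ofPts g hx
  rw [hτ, hσ]

theorem IsSymmFamily.aestronglyMeasurable_evalConf (hm : IsSymmFamily D m) (hD : IsCompact D)
    (hg : IsAESymm m g) (hgm : ∀ n, AEStronglyMeasurable (g n) (m n)) :
    AEStronglyMeasurable (evalConf D g) (confLaw D m) := by
  choose s hs hs' using fun n => FinConf.exists_measurable_enumeration hD (d := d) n
  -- a measurable version of the functional, through a measurable enumeration of the points
  let F : ℕ × FinConf D → ℝ := fun p => (hgm p.1).mk (g p.1) (s p.1 p.2)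
  have hF : Measurable F := measurable_from_prod_countable_right fun n =>
    (hgm n).stronglyMeasurable_mk.measurable.comp (hs n)
  have hH : Measurable fun B : FinConf D => F (B.num univ, B) :=
    hF.comp ((FinConf.measurable_num hD MeasurableSet.univ).prodMk measurable_id)
  refine ⟨_, hH.stronglyMeasurable, hm.ae_confLaw hD fun n => ?_⟩
  have h1 : ∀ᵐ x ∂(m n), ∀ σ : Equiv.Perm (Fin n), g n (x ∘ σ) = (hgm n).mk (g n) (x ∘ σ) :=
    ae_all_iff.2 fun σ => (hm.perm n σ).quasiMeasurePreserving.ae (hgm n).ae_eq_mk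
  filter_upwards [hm.mem n, ae_all_iff.2 (hg n), h1, hm.evalConf_ofPts hg n] with x hx hσ h2 h3
  have hc := FinConf.card_ofPts hx
  rw [h3, FinConf.num_univ, hc]
  obtain ⟨h4, h5⟩ := hs' n _ hc
  have h6 : range (s n (FinConf.ofPts D n x)) = range x := by rw [← h5, FinConf.coe_ofPts hx]
  obtain ⟨τ, hτ⟩ := exists_perm_of_range_subset h4 h6.subset
  simp only [F]
  rw [hτ, ← h2, hσ]

theorem lintegral_confLaw (hD : IsCompact D) {f : FinConf D → ℝ≥0∞}
    (hf : AEMeasurable f (confLaw D m)) :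
    ∫⁻ B, f B ∂(confLaw D m) = ∑' n, ∫⁻ x, f (FinConf.ofPts D n x) ∂(m n) := by
  rw [confLaw, lintegral_sum_measure]
  refine tsum_congr fun n => ?_
  refine lintegral_map' (hf.mono_measure ?_) (FinConf.measurable_ofPts hD n).aemeasurable
  exact Measure.le_sum (fun n => (m n).map (FinConf.ofPts D n)) n

/-- Square integrability of a functional of at most `N` points. -/
theorem IsSymmFamily.memLp_evalConf (hm : IsSymmFamily D m) (hD : IsCompact D)
    (hg : IsAESymm m g) (hgm : ∀ n, MemLp (g n) 2 (m n)) {N : ℕ} (hN : ∀ n, N < n → g n = 0) :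
    MemLp (evalConf D g) 2 (confLaw D m) := by
  have hmeas := hm.aestronglyMeasurable_evalConf hD hg fun n => (hgm n).1
  refine ⟨hmeas, ?_⟩
  rw [eLpNorm_lt_top_iff_lintegral_rpow_enorm_lt_top two_ne_zero ENNReal.ofNat_ne_top,
    lintegral_confLaw hD (hmeas.enorm.pow_const _)]
  have h1 : ∀ n, ∫⁻ x, ‖evalConf D g (FinConf.ofPts D n x)‖ₑ ^ (2 : ℝ≥0∞).toReal ∂(m n) =
      ∫⁻ x, ‖g n x‖ₑ ^ (2 : ℝ≥0∞).toReal ∂(m n) := fun n =>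
    lintegral_congr_ae (by
      filter_upwards [hm.evalConf_ofPts hg n] with x hx
      rw [hx])
  simp only [h1]
  rw [tsum_eq_sum (s := Finset.range (N + 1))]
  · refine ENNReal.sum_lt_top.2 fun n _ => ?_
    exact (eLpNorm_lt_top_iff_lintegral_rpow_enorm_lt_top two_ne_zero ENNReal.ofNat_ne_top).1
      (hgm n).2
  · intro n hn
    rw [hN n (by simpa using hn)]
    simp

/-- The restriction of a square integrable functional to the configurations of `n` points, as a
function of ordered points. -/
noncomputable def compPts (hD : IsCompact D) (m : ∀ n : ℕ, Measure (Fin n → Sp d)) (n : ℕ) :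
    Lp ℝ 2 (confLaw D m) →L[ℝ] Lp ℝ 2 (m n) :=
  (Lp.compMeasurePreservingₗᵢ ℝ (FinConf.ofPts D n)
    ((FinConf.measurable_ofPts hD n).measurePreserving (m n))).toContinuousLinearMap ∘L
  LinearMap.mkContinuous
    { toFun := fun f => ((Lp.memLp f).mono_measure
        (Measure.le_sum (fun n => (m n).map (FinConf.ofPts D n)) n)).toLp
      map_add' := fun f g => by
        rw [← MemLp.toLp_add]
        exact MemLp.toLp_congr _ _ (ae_mono (Measure.le_sum
          (fun n => (m n).map (FinConf.ofPts D n)) n) (Lp.coeFn_add f g))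
      map_smul' := fun c f => by
        rw [RingHom.id_apply, ← MemLp.toLp_const_smul]
        exact MemLp.toLp_congr _ _ (ae_mono (Measure.le_sum
          (fun n => (m n).map (FinConf.ofPts D n)) n) (Lp.coeFn_smul c f)) }
    1 (fun f => by
      rw [one_mul]
      simp only [LinearMap.coe_mk, AddHom.coe_mk]
      rw [Lp.norm_toLp, Lp.norm_def]
      exact ENNReal.toReal_mono (Lp.eLpNorm_ne_top f) (eLpNorm_mono_measure _
        (Measure.le_sum (fun n => (m n).map (FinConf.ofPts D n)) n)))

theorem coeFn_compPts (hD : IsCompact D) (n : ℕ) (f : Lp ℝ 2 (confLaw D m)) :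
    compPts hD m n f =ᵐ[m n] fun x => f (FinConf.ofPts D n x) := by
  have hp := (FinConf.measurable_ofPts hD n).measurePreserving (m n)
  have h0 := (Lp.memLp f).mono_measure (Measure.le_sum (fun n => (m n).map (FinConf.ofPts D n)) n)
  have h1 := Lp.coeFn_compMeasurePreserving (h0.toLp) hp
  refine EventuallyEq.trans h1 ?_
  exact hp.quasiMeasurePreserving.ae_eq_comp h0.coeFn_toLp

theorem compPts_of_ae_eq (hm : IsSymmFamily D m) (hD : IsCompact D) (hg : IsAESymm m g) (n : ℕ)
    {f : Lp ℝ 2 (confLaw D m)} (hf : f =ᵐ[confLaw D m] evalConf D g) :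
    compPts hD m n f =ᵐ[m n] g n := by
  filter_upwards [coeFn_compPts hD n f, ae_of_ae_confLaw hD hf n, hm.evalConf_ofPts hg n]
    with x h1 h2 h3
  rw [h1, h2, h3]

theorem eq_zero_of_compPts_eq_zero (hm : IsSymmFamily D m) (hD : IsCompact D)
    {f : Lp ℝ 2 (confLaw D m)} (h : ∀ n, compPts hD m n f = 0) : f = 0 := by
  rw [Lp.eq_zero_iff_ae_eq_zero]
  refine hm.ae_confLaw hD fun n => ?_
  have h1 := coeFn_compPts hD n f
  rw [h n] at h1
  filter_upwards [h1, Lp.coeFn_zero ℝ 2 (m n)] with x h2 h3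
  rw [← h2, h3]; rfl

theorem hasSum_inner_compPts (hD : IsCompact D) (f g : Lp ℝ 2 (confLaw D m)) :
    HasSum (fun n => inner ℝ (compPts hD m n f) (compPts hD m n g)) (inner ℝ f g) := by
  have hi : Integrable (fun B => inner ℝ (f B) (g B)) (confLaw D m) := L2.integrable_inner f g
  have h := hasSum_integral_measure (μ := fun n => (m n).map (FinConf.ofPts D n)) hi
  rw [L2.inner_def]
  convert! h using 1
  funext n
  have hi' : AEStronglyMeasurable (fun B => inner ℝ (f B) (g B)) ((m n).map (FinConf.ofPts D n)) :=
    hi.1.mono_measure (Measure.le_sum (fun n => (m n).map (FinConf.ofPts D n)) n)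
  rw [integral_map (FinConf.measurable_ofPts hD n).aemeasurable hi', L2.inner_def]
  refine integral_congr_ae ?_
  filter_upwards [coeFn_compPts hD n f, coeFn_compPts hD n g] with x h1 h2
  rw [h1, h2]

end ConfLaw

/-! ### The weighted divergence theorem -/
section WeightedDivergence

variable {E : Type*} [NormedAddCommGroup E] [NormedSpace ℝ E]

/-- A `C¹` function on a compact set has bounded derivatives, even where they are not unique. -/
theorem ContDiffOn.exists_bound_hasFDerivWithinAt {s : Set E} (hs : IsCompact s) {f : E → ℝ}
    (hf : ContDiffOn ℝ 1 f s) :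
    ∃ M : ℝ, ∀ x ∈ s, ∃ f' : E →L[ℝ] ℝ, HasFDerivWithinAt f f' s x ∧ ‖f'‖ ≤ M := by
  refine hs.induction_on (p := fun t => ∃ M : ℝ, ∀ x ∈ t, ∃ f' : E →L[ℝ] ℝ,
    HasFDerivWithinAt f f' s x ∧ ‖f'‖ ≤ M) ⟨0, by simp⟩ ?_ ?_ ?_
  · rintro t u htu ⟨M, hM⟩
    exact ⟨M, fun x hx => hM x (htu hx)⟩
  · rintro t u ⟨M, hM⟩ ⟨M', hM'⟩
    refine ⟨max M M', fun x hx => ?_⟩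
    rcases hx with hx | hx
    · obtain ⟨f', h1, h2⟩ := hM x hx
      exact ⟨f', h1, h2.trans (le_max_left _ _)⟩
    · obtain ⟨f', h1, h2⟩ := hM' x hx
      exact ⟨f', h1, h2.trans (le_max_right _ _)⟩
  · intro x hx
    have h0 : ContDiffWithinAt ℝ (0 + 1) f s x := by simpa using hf x hx
    obtain ⟨u, hu, -, -, f', hf', hc⟩ :=
      (contDiffWithinAt_succ_iff_hasFDerivWithinAt' (by simp)).1 h0
    rw [insert_eq_of_mem hx] at hu
    have h1 : ∀ᶠ y in 𝓝[s] x, ‖f' y‖ < ‖f' x‖ + 1 :=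
      hc.continuousWithinAt.norm.eventually_lt_const (lt_add_one _)
    refine ⟨u ∩ {y | ‖f' y‖ < ‖f' x‖ + 1}, inter_mem hu h1, ‖f' x‖ + 1, fun y hy => ?_⟩
    exact ⟨f' y, hf' y hy.1, le_of_lt hy.2⟩

variable [FiniteDimensional ℝ E] [MeasurableSpace E] [BorelSpace E]

/-- The divergence theorem for `h V` with respect to the weight `W`, on a flow-invariant set. The
derivative `DW` of the weight along `V` need not come from a unique derivative. -/
theorem IsFlowOn.integral_weighted_divergence_eq_zero (μ : Measure E) [μ.IsAddHaarMeasure]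
    {s : Set E} (hs : IsCompact s) {V : E → E} (hV : ContDiff ℝ 2 V) {γ : E → ℝ → E}
    (hγ : IsFlowOn s V γ) {W DW h : E → ℝ} (hW : ContDiffOn ℝ 1 W s)
    (hDW : ∀ x ∈ s, ∃ W' : E →L[ℝ] ℝ, HasFDerivWithinAt W W' s x ∧ DW x = W' (V x))
    (hh : ContDiff ℝ 1 h) :
    ∫ x in s, (fderiv ℝ h x (V x) * W x + h x * (DW x + W x * traceCLM E (fderiv ℝ V x))) ∂μ
      = 0 := by
  have hhW : ContDiffOn ℝ 1 (fun x => h x * W x) s := hh.contDiffOn.mul hW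
  have hder : ∀ x ∈ s, ∀ L : E →L[ℝ] ℝ, HasFDerivWithinAt (fun x => h x * W x) L s x →
      HasDerivAt (fun t => h (γ x t) * W (γ x t)) (L (V x)) 0 := by
    intro x hx L hL
    have h1 := hγ.deriv x hx 0
    have h0 := hγ.zero x hx
    rw [h0] at h1
    exact HasFDerivWithinAt.comp_hasDerivAt (l := fun x => h x * W x) (f := γ x) 0
      (by rw [h0]; exact hL) h1 (Eventually.of_forall (hγ.mem x hx))
  have hd : ∀ x ∈ s, HasDerivAt (fun t => h (γ x t) * W (γ x t))
      (fderiv ℝ h x (V x) * W x + h x * DW x) 0 := by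
    intro x hx
    obtain ⟨W', hW', hDWx⟩ := hDW x hx
    have h1 := ((hh.differentiable one_ne_zero x).hasFDerivAt.hasFDerivWithinAt (s := s)).mul hW'
    convert hder x hx _ h1 using 1
    rw [hDWx]
    simp [mul_comm, add_comm]
  obtain ⟨M, hM⟩ := ContDiffOn.exists_bound_hasFDerivWithinAt hs hhW
  obtain ⟨MV, hMV⟩ := hs.exists_bound_of_continuousOn hV.continuous.continuousOn
  have hb : ∀ x ∈ s, |fderiv ℝ h x (V x) * W x + h x * DW x| ≤ M * MV := by
    intro x hx
    obtain ⟨L, hL, hLM⟩ := hM x hx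
    rw [(hd x hx).unique (hder x hx L hL), ← Real.norm_eq_abs]
    exact (L.le_opNorm _).trans (mul_le_mul hLM (hMV x hx) (norm_nonneg _)
      ((norm_nonneg L).trans hLM))
  obtain ⟨hint, heq⟩ := hγ.integral_deriv_add_trace μ hs hV hhW.continuousOn hd hb
  have htr : Continuous fun x => traceCLM E (fderiv ℝ V x) :=
    (traceCLM E).continuous.comp (hV.continuous_fderiv two_ne_zero)
  have hint2 : IntegrableOn (fun x => h x * W x * traceCLM E (fderiv ℝ V x)) s μ :=
    (hhW.continuousOn.mul htr.continuousOn).integrableOn_compact hs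
  have h2 : ∀ x, fderiv ℝ h x (V x) * W x + h x * (DW x + W x * traceCLM E (fderiv ℝ V x)) =
      (fderiv ℝ h x (V x) * W x + h x * DW x) + h x * W x * traceCLM E (fderiv ℝ V x) :=
    fun x => by ring
  simp only [h2]
  rw [integral_add hint hint2, heq]
  ring

/-- The divergence theorem for `h V` with respect to the weight `W`, for `h` supported in the
interior of `s`. -/
theorem integral_weighted_divergence_eq_zero_of_tsupport_subset (μ : Measure E)
    [μ.IsAddHaarMeasure] {s : Set E} {V : E → E} (hV : ContDiff ℝ 2 V)
    {W DW h : E → ℝ} (hW : ContDiffOn ℝ 1 W s)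
    (hDW : ∀ x ∈ s, ∃ W' : E →L[ℝ] ℝ, HasFDerivWithinAt W W' s x ∧ DW x = W' (V x))
    (hh : ContDiff ℝ 1 h) (hc : HasCompactSupport h) (hsupp : tsupport h ⊆ interior s) :
    ∫ x in s, (fderiv ℝ h x (V x) * W x + h x * (DW x + W x * traceCLM E (fderiv ℝ V x))) ∂μ
      = 0 := by
  have hev : ∀ x, x ∉ tsupport h → ∀ᶠ y in 𝓝 x, h y = 0 := fun x hx =>
    notMem_tsupport_iff_eventuallyEq.1 hx
  have hφ : ContDiff ℝ 1 fun x => h x * W x := by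
    refine contDiff_iff_contDiffAt.2 fun x => ?_
    by_cases hx : x ∈ tsupport h
    · exact hh.contDiffAt.mul (hW.contDiffAt (mem_interior_iff_mem_nhds.1 (hsupp hx)))
    · refine (contDiffAt_const (c := (0 : ℝ))).congr_of_eventuallyEq ?_
      filter_upwards [hev x hx] with y hy
      rw [hy, zero_mul]
  have h1 := integral_fderiv_apply_eq_neg_of_hasCompactSupport μ hφ hc.mul_right
    (hV.of_le one_le_two)
  have h2 : ∀ x, x ∉ tsupport h → fderiv ℝ h x = 0 := fun x hx => by
    rw [EventuallyEq.fderiv_eq (f := fun _ => (0 : ℝ)) (hev x hx)]; simp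
  have h3 : ∀ x, fderiv ℝ (fun x => h x * W x) x (V x) =
      s.indicator (fun x => fderiv ℝ h x (V x) * W x + h x * DW x) x := by
    intro x
    by_cases hx : x ∈ tsupport h
    · have hxs := interior_subset (hsupp hx)
      obtain ⟨W', hW', hDWx⟩ := hDW x hxs
      have h4 := (hh.differentiable one_ne_zero x).hasFDerivAt.mul
        (hW'.hasFDerivAt (mem_interior_iff_mem_nhds.1 (hsupp hx)))
      have h5 : fderiv ℝ (fun x => h x * W x) x = _ := h4.fderiv
      rw [h5, indicator_of_mem hxs, hDWx]
      simp [mul_comm, add_comm]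
    · have h4 : fderiv ℝ (fun x => h x * W x) x = 0 := by
        rw [EventuallyEq.fderiv_eq (f := fun _ => (0 : ℝ))
          ((hev x hx).mono fun y hy => by rw [hy, zero_mul])]
        simp
      rw [h4]
      by_cases hxs : x ∈ s
      · rw [indicator_of_mem hxs, h2 x hx, (hev x hx).self_of_nhds]; simp
      · rw [indicator_of_notMem hxs]; simp
  have htr : Continuous fun x => traceCLM E (fderiv ℝ V x) :=
    (traceCLM E).continuous.comp (hV.continuous_fderiv two_ne_zero)
  have hi1 : Integrable (fun x => fderiv ℝ (fun x => h x * W x) x (V x)) μ := by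
    refine Continuous.integrable_of_hasCompactSupport
      ((hφ.continuous_fderiv one_ne_zero).clm_apply hV.continuous) ?_
    have hc2 : HasCompactSupport fun x => h x * W x := hc.mul_right
    refine (hc2.fderiv (𝕜 := ℝ)).mono ?_
    intro x hx
    simp only [Function.mem_support] at hx ⊢
    exact fun h => hx (by rw [h]; simp)
  have hi2 : Integrable (fun x => h x * W x * traceCLM E (fderiv ℝ V x)) μ :=
    Continuous.integrable_of_hasCompactSupport (hφ.continuous.mul htr) hc.mul_right.mul_right
  rw [setIntegral_eq_integral_of_forall_compl_eq_zero]
  · have h6 : ∀ x, fderiv ℝ h x (V x) * W x + h x * (DW x + W x * traceCLM E (fderiv ℝ V x)) =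
        fderiv ℝ (fun x => h x * W x) x (V x) + h x * W x * traceCLM E (fderiv ℝ V x) := by
      intro x
      rw [h3]
      by_cases hxs : x ∈ s
      · rw [indicator_of_mem hxs]; ring
      · have hx : x ∉ tsupport h := fun h => hxs (interior_subset (hsupp h))
        rw [indicator_of_notMem hxs, h2 x hx, (hev x hx).self_of_nhds]; simp
    simp only [h6]
    rw [integral_add hi1 hi2, h1]
    ring
  · intro x hxs
    have hx : x ∉ tsupport h := fun h => hxs (interior_subset (hsupp h))
    rw [h2 x hx, (hev x hx).self_of_nhds]; simp

end WeightedDivergence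

/-! ### Product fields -/
section ProductField

variable {d : ℕ} {D : Set (Sp d)} {v : Sp d → Sp d}

/-- The vector field on `n`-tuples that moves each point along `v`. -/
def prodField (v : Sp d → Sp d) (n : ℕ) (x : Fin n → Sp d) : Fin n → Sp d := fun i => v (x i)

theorem contDiff_prodField {k : WithTop ℕ∞} (hv : ContDiff ℝ k v) (n : ℕ) :
    ContDiff ℝ k (prodField v n) :=
  contDiff_pi.2 fun i => hv.comp (contDiff_apply ℝ (Sp d) i)

theorem sum_single_prodField (n : ℕ) (x : Fin n → Sp d) :
    ∑ i, (Pi.single i (v (x i)) : Fin n → Sp d) = prodField v n x :=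
  Finset.univ_sum_single _

theorem sum_apply_single {n : ℕ} (L : (Fin n → Sp d) →L[ℝ] ℝ) (x : Fin n → Sp d) :
    ∑ i, L (Pi.single i (v (x i))) = L (prodField v n x) := by
  rw [← sum_single_prodField, map_sum]

theorem traceCLM_fderiv_eq_neg_adjDiv (x : Sp d) :
    traceCLM (Sp d) (fderiv ℝ v x) = - adjDiv v x := by
  rw [traceCLM_apply, LinearMap.trace_eq_sum_inner _ (EuclideanSpace.basisFun (Fin d) ℝ), adjDiv,
    neg_neg]
  refine Finset.sum_congr rfl fun i _ => ?_
  rw [EuclideanSpace.basisFun_apply, EuclideanSpace.inner_single_left]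
  simp

theorem traceCLM_fderiv_prodField (hv : ContDiff ℝ 1 v) (n : ℕ) (x : Fin n → Sp d) :
    traceCLM (Fin n → Sp d) (fderiv ℝ (prodField v n) x) = - ∑ i, adjDiv v (x i) := by
  have h1 : HasFDerivAt (prodField v n) (ContinuousLinearMap.pi fun i =>
      (fderiv ℝ v (x i)).comp (ContinuousLinearMap.proj (R := ℝ) (φ := fun _ : Fin n => Sp d) i)) x := by
    refine hasFDerivAt_pi.2 fun i => ?_
    exact HasFDerivAt.comp x (hv.differentiable one_ne_zero (x i)).hasFDerivAt (hasFDerivAt_apply i x)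
  rw [h1.fderiv, traceCLM_apply]
  have h2 : ((ContinuousLinearMap.pi fun i => (fderiv ℝ v (x i)).comp
      (ContinuousLinearMap.proj (R := ℝ) (φ := fun _ : Fin n => Sp d) i) :
        (Fin n → Sp d) →L[ℝ] (Fin n → Sp d)) : (Fin n → Sp d) →ₗ[ℝ] (Fin n → Sp d)) =
      ∑ i, (LinearMap.single ℝ (fun _ : Fin n => Sp d) i) ∘ₗ
        ((fderiv ℝ v (x i) : Sp d →ₗ[ℝ] Sp d) ∘ₗ LinearMap.proj i) := by
    refine LinearMap.ext fun y => ?_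
    rw [LinearMap.sum_apply]
    exact (Finset.univ_sum_single (fun i => fderiv ℝ v (x i) (y i))).symm
  rw [h2, map_sum, ← Finset.sum_neg_distrib]
  refine Finset.sum_congr rfl fun i _ => ?_
  rw [LinearMap.trace_comp_comm', ← traceCLM_fderiv_eq_neg_adjDiv, traceCLM_apply]
  congr 1
  ext y
  simp

theorem FlowPreserves.exists_isFlowOn (h : FlowPreserves D v) (n : ℕ) :
    ∃ γ, IsFlowOn (cube D n) (prodField v n) γ := by
  classical
  choose! γ h0 hγ using h
  refine ⟨fun x t i => γ (x i) t, ?_, ?_, ?_⟩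
  · intro x hx; ext1 i; exact h0 _ (hx i)
  · intro x hx t
    exact hasDerivAt_pi.2 fun i => (hγ _ (hx i) t).1
  · intro x hx t i
    exact (hγ _ (hx i) t).2

end ProductField

/-! ### The weights of the law and the coefficient of the adjoint -/
section Measurability

variable {E : Type*} [NormedAddCommGroup E] [NormedSpace ℝ E] [FiniteDimensional ℝ E]
  [MeasurableSpace E] [BorelSpace E]

theorem aestronglyMeasurable_fderivWithin_apply (μ : Measure E) [μ.IsAddHaarMeasure] {s : Set E}
    (hs : MeasurableSet s) {f : E → ℝ} (hf : DifferentiableOn ℝ f s) {V : E → E}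
    (hV : Continuous V) :
    AEStronglyMeasurable (fun x => fderivWithin ℝ f s x (V x)) (μ.restrict s) := by
  rcases subsingleton_or_nontrivial E with h | h
  · have : (fun x => fderivWithin ℝ f s x (V x)) = fun _ => 0 := by
      funext x; rw [Subsingleton.elim (V x) 0, map_zero]
    rw [this]; exact aestronglyMeasurable_const
  · obtain ⟨e, he⟩ := exists_ne (0 : E)
    obtain ⟨l, hl⟩ := SeparatingDual.exists_eq_one (R := ℝ) he
    -- measurability of derivatives is available for maps of `E` into itself
    have h1 : ∀ x ∈ s, HasFDerivWithinAt (fun x => f x • e)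
        ((fderivWithin ℝ f s x).smulRight e) s x := fun x hx =>
      (hf x hx).hasFDerivWithinAt.smul_const e
    have h2 := (aemeasurable_fderivWithin μ hs h1).aestronglyMeasurable
    have h3 : AEStronglyMeasurable (fun x => l ((fderivWithin ℝ f s x).smulRight e (V x)))
        (μ.restrict s) :=
      l.continuous.comp_aestronglyMeasurable
        (isBoundedBilinearMap_apply.continuous.comp_aestronglyMeasurable
          (h2.prodMk hV.aestronglyMeasurable))
    refine h3.congr (Eventually.of_forall fun x => ?_)
    simp [hl]

end Measurability

section Weight

variable {d : ℕ} {D : Set (Sp d)} {J : Sp d → Sp d → ℂ} {ρ : Sp d → ℝ} {c : ℕ → ℝ}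
  {v : Sp d → Sp d}

/-- The Lebesgue density `c_n det J[D](x_1, …, x_n) ρ(x_1) ⋯ ρ(x_n)` of the `n`-point part of the
law. -/
noncomputable def janossyWeight (J : Sp d → Sp d → ℂ) (ρ : Sp d → ℝ) (c : ℕ → ℝ) (n : ℕ)
    (x : Fin n → Sp d) : ℝ :=
  c n * kdet J n x * ∏ i, ρ (x i)

/-- The measure on `D^n` with Lebesgue density `janossyWeight J ρ c n`. -/
noncomputable def janossyMeasure (D : Set (Sp d)) (J : Sp d → Sp d → ℂ) (ρ : Sp d → ℝ) (c : ℕ → ℝ)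
    (n : ℕ) : Measure (Fin n → Sp d) :=
  (volume.restrict (cube D n)).withDensity fun x => ENNReal.ofReal (janossyWeight J ρ c n x)

/-- The derivative of `janossyWeight J ρ c n` along the product field of `v`. -/
noncomputable def derivWeight (D : Set (Sp d)) (J : Sp d → Sp d → ℂ) (ρ : Sp d → ℝ) (c : ℕ → ℝ)
    (v : Sp d → Sp d) (n : ℕ) (x : Fin n → Sp d) : ℝ :=
  c n * fderivWithin ℝ (kdet J n) (cube D n) x (prodField v n x) * (∏ i, ρ (x i)) +
    c n * kdet J n x * ∑ i, (∏ j ∈ Finset.univ.erase i, ρ (x j)) * fderivWithin ℝ ρ D (x i) (v (x i))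

/-- The function of `n` points that gives `B_v^μ + ∇_v U[D]`. Where the determinant vanishes, the
quotient is zero by convention; the law does not charge these points. -/
noncomputable def adjCoeff (D : Set (Sp d)) (J : Sp d → Sp d → ℂ) (ρ : Sp d → ℝ)
    (v : Sp d → Sp d) (n : ℕ) (x : Fin n → Sp d) : ℝ :=
  ∑ i : Fin n, (- inner ℝ (betaMu D ρ (x i)) (v (x i)) + adjDiv v (x i)) +
    - ∑ i : Fin n, fderivWithin ℝ (kdet J n) (cube D n) x (Pi.single i (v (x i))) / kdet J n x

theorem isCompact_cube (hD : IsCompact D) (n : ℕ) : IsCompact (cube D n) := by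
  have : cube D n = univ.pi fun _ => D := by ext x; simp [cube]
  rw [this]
  exact isCompact_univ_pi fun _ => hD

theorem HypH3.contDiffOn_kdet (h3 : HypH3 D J) (n : ℕ) : ContDiffOn ℝ 1 (kdet J n) (cube D n) := by
  rcases Nat.eq_zero_or_pos n with rfl | hn
  · have : kdet J 0 = fun _ => 1 := by funext x; simp [kdet]
    rw [this]
    exact contDiffOn_const
  · exact h3 n hn

theorem contDiffOn_prod_density (hρ : ContDiffOn ℝ 1 ρ D) (n : ℕ) :
    ContDiffOn ℝ 1 (fun x : Fin n → Sp d => ∏ i, ρ (x i)) (cube D n) :=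
  contDiffOn_prod fun i _ => hρ.comp (contDiff_apply ℝ (Sp d) i).contDiffOn fun _ hx => hx i

theorem contDiffOn_janossyWeight (h3 : HypH3 D J) (hρ : ContDiffOn ℝ 1 ρ D) (n : ℕ) :
    ContDiffOn ℝ 1 (janossyWeight J ρ c n) (cube D n) :=
  (contDiffOn_const.mul (h3.contDiffOn_kdet n)).mul (contDiffOn_prod_density hρ n)

theorem exists_hasFDerivWithinAt_janossyWeight (h3 : HypH3 D J) (hρ : ContDiffOn ℝ 1 ρ D) {n : ℕ}
    {x : Fin n → Sp d} (hx : x ∈ cube D n) :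
    ∃ W' : (Fin n → Sp d) →L[ℝ] ℝ, HasFDerivWithinAt (janossyWeight J ρ c n) W' (cube D n) x ∧
      derivWeight D J ρ c v n x = W' (prodField v n x) := by
  have h1 : HasFDerivWithinAt (kdet J n) (fderivWithin ℝ (kdet J n) (cube D n) x) (cube D n) x :=
    ((h3.contDiffOn_kdet n).differentiableOn one_ne_zero x hx).hasFDerivWithinAt
  have h2 : ∀ i, HasFDerivWithinAt (fun x : Fin n → Sp d => ρ (x i))
      ((fderivWithin ℝ ρ D (x i)).comp
        (ContinuousLinearMap.proj (R := ℝ) (φ := fun _ : Fin n => Sp d) i)) (cube D n) x := fun i =>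
    HasFDerivWithinAt.comp x ((hρ.differentiableOn one_ne_zero _ (hx i)).hasFDerivWithinAt)
      (hasFDerivAt_apply i x).hasFDerivWithinAt fun _ hy => hy i
  have h4 := (h1.const_mul (c n)).mul (HasFDerivWithinAt.finsetProd (u := Finset.univ)
    fun i _ => h2 i)
  refine ⟨_, h4, ?_⟩
  simp [derivWeight, prodField, mul_comm, add_comm]

/-- The adjoint coefficient is minus the weighted divergence of the product field, over the
weight. -/
theorem derivWeight_add_eq (hv : ContDiff ℝ 1 v) (hρ : ∀ x ∈ D, 0 < ρ x) {n : ℕ}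
    {x : Fin n → Sp d} (hx : x ∈ cube D n)
    (h0 : kdet J n x = 0 → fderivWithin ℝ (kdet J n) (cube D n) x = 0) :
    derivWeight D J ρ c v n x +
        janossyWeight J ρ c n x * traceCLM (Fin n → Sp d) (fderiv ℝ (prodField v n) x) =
      - (adjCoeff D J ρ v n x * janossyWeight J ρ c n x) := by
  by_cases hw : kdet J n x = 0
  · simp [derivWeight, janossyWeight, hw, h0 hw]
  · have h1 : ∀ i, (∏ j ∈ Finset.univ.erase i, ρ (x j)) * fderivWithin ℝ ρ D (x i) (v (x i)) =
        (∏ i, ρ (x i)) * inner ℝ (betaMu D ρ (x i)) (v (x i)) := by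
      intro i
      rw [betaMu, inner_smul_left, inner_gradientWithin_left,
        ← Finset.mul_prod_erase Finset.univ (fun j => ρ (x j)) (Finset.mem_univ i)]
      have := (hρ _ (hx i)).ne'
      simp only [conj_trivial]
      field_simp
    rw [traceCLM_fderiv_prodField hv, derivWeight, adjCoeff, ← Finset.sum_div, sum_apply_single]
    simp only [h1]
    rw [← Finset.mul_sum, Finset.sum_add_distrib, Finset.sum_neg_distrib, janossyWeight]
    field_simp
    ring

/-- On the zero set of the determinant, where `∇_v U[D]` is not meaningful, the derivative of the
determinant vanishes almost everywhere. -/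
theorem ae_fderivWithin_kdet_eq_zero (hD : IsCompact D) (hJ : Measurable (uncurry J))
    (h3 : HypH3 D J) (n : ℕ) :
    ∀ᵐ x ∂(volume.restrict (cube D n)), kdet J n x = 0 →
      fderivWithin ℝ (kdet J n) (cube D n) x = 0 := by
  have hc := measurableSet_cube hD.measurableSet n
  have hs : MeasurableSet {x | kdet J n x = 0} := measurable_kdet hJ n (measurableSet_singleton 0)
  have h1 := ae_fderivWithin_eq_zero_of_eq_zero volume (hs.inter hc) inter_subset_right
    ((h3.contDiffOn_kdet n).differentiableOn one_ne_zero) fun x hx => hx.1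
  rw [← Measure.restrict_restrict hs, ae_restrict_iff' hs] at h1
  exact h1

theorem ae_restrict_cube {p : Sp d → Prop} (h : ∀ᵐ x ∂(volume.restrict D), p x) (n : ℕ) :
    ∀ᵐ x ∂(volume.restrict (cube D n)), ∀ i, p (x i) := by
  have hc : cube D n = univ.pi fun _ : Fin n => D := by ext x; simp [cube]
  rw [hc, volume_pi, ← pi_restrict]
  refine ae_all_iff.2 fun i => ?_
  exact (Measure.quasiMeasurePreserving_eval (μ := fun _ : Fin n => volume.restrict D) i).ae h

theorem quasiMeasurePreserving_eval_cube (D : Set (Sp d)) {n : ℕ} (i : Fin n) :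
    Measure.QuasiMeasurePreserving (fun x : Fin n → Sp d => x i) (volume.restrict (cube D n))
      (volume.restrict D) := by
  have hc : cube D n = univ.pi fun _ : Fin n => D := by ext x; simp [cube]
  rw [hc, volume_pi, ← pi_restrict]
  exact Measure.quasiMeasurePreserving_eval (μ := fun _ : Fin n => volume.restrict D) i

theorem kdet_comp_perm (k : Sp d → Sp d → ℂ) {n : ℕ} (σ : Equiv.Perm (Fin n)) (x : Fin n → Sp d) :
    kdet k n (x ∘ σ) = kdet k n x := by
  rw [kdet, kdet, ← Matrix.det_submatrix_equiv_self σ (Matrix.of fun i j => k (x i) (x j))]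
  rfl

theorem comp_perm_mem_cube_iff {n : ℕ} (σ : Equiv.Perm (Fin n)) (x : Fin n → Sp d) :
    x ∘ σ ∈ cube D n ↔ x ∈ cube D n :=
  ⟨fun h i => by simpa using h (σ.symm i), fun h i => h (σ i)⟩

theorem fderivWithin_kdet_comp_perm {n : ℕ} (σ : Equiv.Perm (Fin n)) {x : Fin n → Sp d}
    (hx : UniqueDiffWithinAt ℝ (cube D n) x) (y : Fin n → Sp d) :
    fderivWithin ℝ (kdet J n) (cube D n) (x ∘ σ) (y ∘ σ) =
      fderivWithin ℝ (kdet J n) (cube D n) x y := by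
  let e : (Fin n → Sp d) ≃L[ℝ] (Fin n → Sp d) :=
    (LinearEquiv.funCongrLeft ℝ (Sp d) σ).toContinuousLinearEquiv
  have he : ∀ z, e z = z ∘ σ := fun z => rfl
  have h1 : e ⁻¹' (cube D n) = cube D n := by
    ext z; exact comp_perm_mem_cube_iff σ z
  have h2 : kdet J n ∘ e = kdet J n := by
    ext z; exact kdet_comp_perm J σ z
  have h3 := e.comp_right_fderivWithin (f := kdet J n) (s := cube D n) (x := x) (by rwa [h1])
  rw [h1, h2] at h3
  rw [h3]; rfl

theorem adjCoeff_comp_perm {n : ℕ} (σ : Equiv.Perm (Fin n)) {x : Fin n → Sp d}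
    (hx : UniqueDiffWithinAt ℝ (cube D n) x) :
    adjCoeff D J ρ v n (x ∘ σ) = adjCoeff D J ρ v n x := by
  simp only [adjCoeff, ← Finset.sum_div, sum_apply_single, kdet_comp_perm]
  congr 1
  · exact Equiv.sum_comp σ fun i => - inner ℝ (betaMu D ρ (x i)) (v (x i)) + adjDiv v (x i)
  · rw [← fderivWithin_kdet_comp_perm σ hx (prodField v n x)]
    rfl

theorem fderiv_prodField_comp_perm {n : ℕ} {f : (Fin n → Sp d) → ℝ} (σ : Equiv.Perm (Fin n))
    (hf : ∀ x, f (x ∘ σ) = f x) (x : Fin n → Sp d) :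
    fderiv ℝ f (x ∘ σ) (prodField v n (x ∘ σ)) = fderiv ℝ f x (prodField v n x) := by
  let e : (Fin n → Sp d) ≃L[ℝ] (Fin n → Sp d) :=
    (LinearEquiv.funCongrLeft ℝ (Sp d) σ).toContinuousLinearEquiv
  have h2 : f ∘ e = f := by ext z; exact hf z
  have h3 := e.comp_right_fderiv (f := f) (x := x)
  rw [h2] at h3
  rw [h3]; rfl

end Weight

/-! ### Integration by parts for ordered points -/
section JanossyMeasure

variable {d : ℕ} {S D : Set (Sp d)} {μ : Measure (Sp d)} {J : Sp d → Sp d → ℂ} {ρ : Sp d → ℝ}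
  {c : ℕ → ℝ} {v : Sp d → Sp d}

theorem janossyMeasure_absolutelyContinuous (D : Set (Sp d)) (J : Sp d → Sp d → ℂ) (ρ : Sp d → ℝ)
    (c : ℕ → ℝ) (n : ℕ) : janossyMeasure D J ρ c n ≪ volume.restrict (cube D n) :=
  withDensity_absolutelyContinuous _ _

theorem isFiniteMeasure_janossyMeasure (hD : IsCompact D) (h3 : HypH3 D J)
    (hρ : ContDiffOn ℝ 1 ρ D) (c : ℕ → ℝ) (n : ℕ) : IsFiniteMeasure (janossyMeasure D J ρ c n) :=
  isFiniteMeasure_withDensity_ofReal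
    (((contDiffOn_janossyWeight h3 hρ n).continuousOn.integrableOn_compact
      (isCompact_cube hD n)).2)

theorem aemeasurable_janossyWeight (hD : IsCompact D) (h3 : HypH3 D J) (hρ : ContDiffOn ℝ 1 ρ D)
    (c : ℕ → ℝ) (n : ℕ) : AEMeasurable (janossyWeight J ρ c n) (volume.restrict (cube D n)) :=
  (contDiffOn_janossyWeight h3 hρ n).continuousOn.aemeasurable
    (measurableSet_cube hD.measurableSet n)

theorem ae_janossyWeight_nonneg (hD : IsCompact D) (hρ : ∀ x ∈ D, 0 < ρ x) (hc : ∀ n, 0 < c n)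
    {n : ℕ} (hpos : ∀ᵐ x ∂(volume.restrict (cube D n)), 0 ≤ kdet J n x) :
    ∀ᵐ x ∂(volume.restrict (cube D n)), 0 ≤ janossyWeight J ρ c n x := by
  filter_upwards [hpos, ae_restrict_mem (measurableSet_cube hD.measurableSet n)] with x hx hxc
  exact mul_nonneg (mul_nonneg (hc n).le hx) (Finset.prod_nonneg fun i _ => (hρ _ (hxc i)).le)

theorem integral_janossyMeasure (hD : IsCompact D) (h3 : HypH3 D J) (hρ : ContDiffOn ℝ 1 ρ D)
    (hρpos : ∀ x ∈ D, 0 < ρ x) (hc : ∀ n, 0 < c n)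
    {n : ℕ} (hpos : ∀ᵐ x ∂(volume.restrict (cube D n)), 0 ≤ kdet J n x)
    (f : (Fin n → Sp d) → ℝ) :
    ∫ x, f x ∂(janossyMeasure D J ρ c n) = ∫ x in cube D n, janossyWeight J ρ c n x * f x := by
  rw [janossyMeasure, integral_withDensity_eq_integral_toReal_smul₀
    (aemeasurable_janossyWeight hD h3 hρ c n).ennreal_ofReal (by simp)]
  refine integral_congr_ae ?_
  filter_upwards [ae_janossyWeight_nonneg hD hρpos hc hpos] with x hx
  rw [ENNReal.toReal_ofReal hx, smul_eq_mul]

/-- The points where the weight vanishes are negligible, and elsewhere the measures have the same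
null sets as Lebesgue measure. -/
theorem ae_janossyMeasure_iff (hD : IsCompact D) (h3 : HypH3 D J) (hρ : ContDiffOn ℝ 1 ρ D)
    (hρpos : ∀ x ∈ D, 0 < ρ x) (hc : ∀ n, 0 < c n) {n : ℕ} {p : (Fin n → Sp d) → Prop} :
    (∀ᵐ x ∂(janossyMeasure D J ρ c n), p x) ↔
      ∀ᵐ x ∂(volume.restrict (cube D n)), 0 < kdet J n x → p x := by
  rw [janossyMeasure, ae_withDensity_iff' (aemeasurable_janossyWeight hD h3 hρ c n).ennreal_ofReal]
  refine eventually_congr ?_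
  filter_upwards [ae_restrict_mem (measurableSet_cube hD.measurableSet n)] with x hxc
  have h1 : 0 < ∏ i, ρ (x i) := Finset.prod_pos fun i _ => hρpos _ (hxc i)
  have h2 : ENNReal.ofReal (janossyWeight J ρ c n x) ≠ 0 ↔ 0 < kdet J n x := by
    rw [← pos_iff_ne_zero, ENNReal.ofReal_pos, janossyWeight, mul_pos_iff_of_pos_right h1,
      mul_pos_iff_of_pos_left (hc n)]
  rw [h2]

theorem memLp_of_continuous (hD : IsCompact D) (h3 : HypH3 D J) (hρ : ContDiffOn ℝ 1 ρ D)
    (c : ℕ → ℝ) (n : ℕ) {f : (Fin n → Sp d) → ℝ} (hf : Continuous f) :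
    MemLp f 2 (janossyMeasure D J ρ c n) := by
  have := isFiniteMeasure_janossyMeasure hD h3 hρ c n
  obtain ⟨M, hM⟩ := (isCompact_cube hD n).exists_bound_of_continuousOn hf.continuousOn
  refine MemLp.of_bound hf.aestronglyMeasurable M ?_
  refine (janossyMeasure_absolutelyContinuous D J ρ c n).ae_le ?_
  filter_upwards [ae_restrict_mem (measurableSet_cube hD.measurableSet n)] with x hx
  exact hM x hx

/-- The integrability condition says that the logarithmic derivatives of the determinants are
square integrable for the law. -/
theorem IntegrabilityCondition.memLp_partialDet_div (hint : IntegrabilityCondition D μ J)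
    (hD : IsCompact D) (hDS : D ⊆ S) (hJ : Measurable (uncurry J)) (h2 : HypH2 S D μ ρ)
    (h3 : HypH3 D J) (hc : ∀ n, 0 < c n) {n : ℕ}
    (hpos : ∀ᵐ x ∂(volume.restrict (cube D n)), 0 ≤ kdet J n x) (i : Fin n) (h : Fin d) :
    MemLp (fun x => partialDet D J n i h x / kdet J n x) 2 (janossyMeasure D J ρ c n) := by
  have hcm := measurableSet_cube hD.measurableSet n
  have hsf : SigmaFinite μ := by
    rw [h2.density]; exact SigmaFinite.withDensity_ofReal _
  have hdm : AEStronglyMeasurable (partialDet D J n i h) (volume.restrict (cube D n)) :=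
    aestronglyMeasurable_fderivWithin_apply volume hcm
      ((h3.contDiffOn_kdet n).differentiableOn one_ne_zero) continuous_const
  have hkm : Measurable (kdet J n) := measurable_kdet hJ n
  refine ⟨(hdm.aemeasurable.div hkm.aemeasurable).aestronglyMeasurable.mono_ac
    (janossyMeasure_absolutelyContinuous D J ρ c n), ?_⟩
  have hprod : Measurable fun x : Fin n → Sp d => ∏ i, ENNReal.ofReal (ρ (x i)) :=
    Finset.measurable_prod _ fun i _ => h2.measurable.ennreal_ofReal.comp (measurable_pi_apply i)
  have hfin := hint n (Fin.pos i) i i h h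
  have hset : {x | x ∈ cube D n ∧ 0 < kdet J n x} = {x | 0 < kdet J n x} ∩ cube D n := by
    ext x; exact and_comm
  have hkpos : MeasurableSet {x | 0 < kdet J n x} := measurableSet_lt measurable_const hkm
  have hcube : cube D n = univ.pi fun _ : Fin n => D := by ext x; simp [cube]
  have hpi : (Measure.pi fun _ : Fin n => μ).restrict (cube D n) =
      (volume.restrict (cube D n)).withDensity fun x => ∏ i, ENNReal.ofReal (ρ (x i)) := by
    rw [← h2.pi_restrict_eq hD.measurableSet hDS, pi_restrict, hcube]
  rw [hset, ← Measure.restrict_restrict hkpos, hpi, ← lintegral_indicator hkpos,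
    lintegral_withDensity_eq_lintegral_mul_non_measurable _ hprod
      (Eventually.of_forall fun x => ENNReal.prod_lt_top fun i _ => ENNReal.ofReal_lt_top)] at hfin
  rw [eLpNorm_lt_top_iff_lintegral_rpow_enorm_lt_top two_ne_zero ENNReal.ofNat_ne_top,
    janossyMeasure, lintegral_withDensity_eq_lintegral_mul_non_measurable₀ _
      (aemeasurable_janossyWeight hD h3 h2.contDiffOn c n).ennreal_ofReal
      (Eventually.of_forall fun x => ENNReal.ofReal_lt_top)]
  have hfin' := ENNReal.mul_lt_top (ENNReal.ofReal_lt_top (r := c n)) hfin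
  rw [← lintegral_const_mul' _ _ ENNReal.ofReal_ne_top] at hfin'
  refine lt_of_le_of_lt (lintegral_mono_ae ?_) hfin'
  filter_upwards [hpos, ae_restrict_mem hcm] with x hx hxc
  have hr : ∀ i ∈ Finset.univ, 0 ≤ ρ (x i) := fun i _ => (h2.pos _ (hxc i)).le
  simp only [Pi.mul_apply]
  rw [← ENNReal.ofReal_prod_of_nonneg hr, ENNReal.toReal_ofNat, ENNReal.rpow_ofNat, ← enorm_pow,
    Real.enorm_eq_ofReal_abs]
  rcases hx.eq_or_lt with hx0 | hx0
  · simp [janossyWeight, ← hx0]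
  · have hW0 : 0 ≤ janossyWeight J ρ c n x :=
      mul_nonneg (mul_nonneg (hc n).le hx) (Finset.prod_nonneg hr)
    rw [indicator_of_mem (show x ∈ {x | 0 < kdet J n x} from hx0), Real.enorm_eq_ofReal_abs,
      ← ENNReal.ofReal_mul (Finset.prod_nonneg hr), ← ENNReal.ofReal_mul (hc n).le,
      ← ENNReal.ofReal_mul hW0]
    refine ENNReal.ofReal_le_ofReal (le_of_eq ?_)
    rw [abs_of_nonneg (sq_nonneg _), abs_div, abs_of_nonneg (mul_self_nonneg _),
      abs_of_pos hx0, janossyWeight]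
    field_simp

/-- The coefficient `B_v^μ + ∇_v U[D]` of the adjoint is square integrable on the configurations
of `n` points. -/
theorem IntegrabilityCondition.memLp_adjCoeff (hint : IntegrabilityCondition D μ J)
    (hD : IsCompact D) (hDS : D ⊆ S) (hJ : Measurable (uncurry J)) (h2 : HypH2 S D μ ρ)
    (h3 : HypH3 D J) (hc : ∀ n, 0 < c n) (hv : ContDiff ℝ 1 v) {n : ℕ}
    (hpos : ∀ᵐ x ∂(volume.restrict (cube D n)), 0 ≤ kdet J n x) :
    MemLp (adjCoeff D J ρ v n) 2 (janossyMeasure D J ρ c n) := by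
  have hfinm := isFiniteMeasure_janossyMeasure hD h3 h2.contDiffOn c n
  have hac := janossyMeasure_absolutelyContinuous D J ρ c n
  have hρd : DifferentiableOn ℝ ρ D := h2.contDiffOn.differentiableOn one_ne_zero
  obtain ⟨MV, hMV⟩ := hD.exists_bound_of_continuousOn hv.continuous.continuousOn
  have hdivc : Continuous (adjDiv v) := by
    have : adjDiv v = fun x => - traceCLM (Sp d) (fderiv ℝ v x) := by
      funext x; rw [traceCLM_fderiv_eq_neg_adjDiv, neg_neg]
    rw [this]
    exact ((traceCLM (Sp d)).continuous.comp (hv.continuous_fderiv one_ne_zero)).neg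
  have hβ : ∀ x, inner ℝ (betaMu D ρ x) (v x) = (ρ x)⁻¹ * fderivWithin ℝ ρ D x (v x) := by
    intro x
    rw [betaMu, inner_smul_left, inner_gradientWithin_left, conj_trivial]
  have hβm : AEStronglyMeasurable (fun x => inner ℝ (betaMu D ρ x) (v x)) (volume.restrict D) := by
    simp only [hβ]
    exact h2.measurable.inv.aestronglyMeasurable.mul
      (aestronglyMeasurable_fderivWithin_apply volume hD.measurableSet hρd hv.continuous)
  obtain ⟨Mρ, hMρ⟩ := hD.exists_bound_of_continuousOn
    (h2.contDiffOn.continuousOn.inv₀ fun x hx => (h2.pos x hx).ne')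
  obtain ⟨Mf, hMf⟩ := ContDiffOn.exists_bound_hasFDerivWithinAt hD h2.contDiffOn
  have hβb : ∀ᵐ x ∂(volume.restrict D), ‖(inner ℝ (betaMu D ρ x) (v x) : ℝ)‖ ≤ Mρ * (Mf * MV) := by
    filter_upwards [ae_uniqueDiffWithinAt volume hD.measurableSet,
      ae_restrict_mem hD.measurableSet] with x hx hxD
    obtain ⟨f', hf', hb⟩ := hMf x hxD
    rw [hβ, norm_mul, hf'.fderivWithin hx]
    have h1 : ‖f' (v x)‖ ≤ Mf * MV := (f'.le_opNorm _).trans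
      (mul_le_mul hb (hMV x hxD) (norm_nonneg _) ((norm_nonneg _).trans hb))
    exact mul_le_mul (hMρ x hxD) h1 (norm_nonneg _) ((norm_nonneg _).trans (hMρ x hxD))
  have hdrift : ∀ i : Fin n,
      MemLp (fun x => - inner ℝ (betaMu D ρ (x i)) (v (x i)) + adjDiv v (x i)) 2
        (janossyMeasure D J ρ c n) := by
    intro i
    have hq := quasiMeasurePreserving_eval_cube D i
    refine MemLp.add (MemLp.neg ?_)
      (memLp_of_continuous hD h3 h2.contDiffOn c n (hdivc.comp (continuous_apply i)))
    exact MemLp.of_bound ((hβm.comp_quasiMeasurePreserving hq).mono_ac hac) _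
      (hac.ae_le (hq.ae hβb))
  have hU : ∀ i : Fin n,
      MemLp (fun x => fderivWithin ℝ (kdet J n) (cube D n) x (Pi.single i (v (x i))) / kdet J n x)
        2 (janossyMeasure D J ρ c n) := by
    intro i
    have h4 : ∀ x : Fin n → Sp d,
        fderivWithin ℝ (kdet J n) (cube D n) x (Pi.single i (v (x i))) / kdet J n x =
          ∑ h, v (x i) h * (partialDet D J n i h x / kdet J n x) := by
      intro x
      have h5 : (Pi.single i (v (x i)) : Fin n → Sp d) =
          ∑ h, v (x i) h • Pi.single i (EuclideanSpace.single h (1 : ℝ)) := by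
        have h6 := congrArg (LinearMap.single ℝ (fun _ : Fin n => Sp d) i)
          ((EuclideanSpace.basisFun (Fin d) ℝ).sum_repr (v (x i))).symm
        rw [map_sum] at h6
        simpa only [map_smul, LinearMap.single_apply, EuclideanSpace.basisFun_apply,
          EuclideanSpace.basisFun_repr] using h6
      rw [h5, map_sum, Finset.sum_div]
      refine Finset.sum_congr rfl fun h _ => ?_
      rw [map_smul, smul_eq_mul, mul_div_assoc, partialDet]
    simp only [h4]
    refine memLp_finsetSum _ fun h _ => ?_
    have h6 := hint.memLp_partialDet_div hD hDS hJ h2 h3 hc hpos i h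
    refine MemLp.of_le_mul (c := MV) h6 ?_ ?_
    · refine AEStronglyMeasurable.mul ?_ h6.1
      have : Continuous fun x : Fin n → Sp d => v (x i) h :=
        (EuclideanSpace.proj h : Sp d →L[ℝ] ℝ).continuous.comp
          (hv.continuous.comp (continuous_apply i))
      exact this.aestronglyMeasurable
    · refine hac.ae_le ?_
      filter_upwards [ae_restrict_mem (measurableSet_cube hD.measurableSet n)] with x hx
      rw [norm_mul]
      exact mul_le_mul_of_nonneg_right ((PiLp.norm_apply_le _ h).trans (hMV _ (hx i)))
        (norm_nonneg _)
  exact (memLp_finsetSum _ fun i _ => hdrift i).add (memLp_finsetSum _ fun i _ => hU i).neg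

/-- Integration by parts for the part of the law on `n` points, as soon as the weighted divergence
theorem holds for `h = f g`. -/
theorem integral_mul_adjoint_eq (hint : IntegrabilityCondition D μ J)
    (hD : IsCompact D) (hDS : D ⊆ S) (hJ : Measurable (uncurry J)) (h2 : HypH2 S D μ ρ)
    (h3 : HypH3 D J) (hc : ∀ n, 0 < c n) (hv : ContDiff ℝ 2 v) {n : ℕ}
    (hpos : ∀ᵐ x ∂(volume.restrict (cube D n)), 0 ≤ kdet J n x)
    {f g : (Fin n → Sp d) → ℝ} (hf : ContDiff ℝ 1 f) (hg : ContDiff ℝ 1 g)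
    (hfg : FlowPreserves D v ∨ (HasCompactSupport (fun x => f x * g x) ∧
      tsupport (fun x => f x * g x) ⊆ interior (cube D n))) :
    ∫ x, g x * fderiv ℝ f x (prodField v n x) ∂(janossyMeasure D J ρ c n) =
      ∫ x, f x * (- fderiv ℝ g x (prodField v n x) + g x * adjCoeff D J ρ v n x)
        ∂(janossyMeasure D J ρ c n) := by
  have hV : ContDiff ℝ 2 (prodField v n) := contDiff_prodField hv n
  have hh : ContDiff ℝ 1 fun x => f x * g x := hf.mul hg
  have hW := contDiffOn_janossyWeight (c := c) h3 h2.contDiffOn n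
  have key : ∫ x in cube D n, (fderiv ℝ (fun x => f x * g x) x (prodField v n x) *
      janossyWeight J ρ c n x + f x * g x * (derivWeight D J ρ c v n x + janossyWeight J ρ c n x *
        traceCLM (Fin n → Sp d) (fderiv ℝ (prodField v n) x))) = 0 := by
    rcases hfg with hfl | ⟨hcs, hts⟩
    · obtain ⟨γ, hγ⟩ := hfl.exists_isFlowOn n
      exact hγ.integral_weighted_divergence_eq_zero volume (isCompact_cube hD n) hV hW
        (fun x hx => exists_hasFDerivWithinAt_janossyWeight h3 h2.contDiffOn hx) hh
    · exact integral_weighted_divergence_eq_zero_of_tsupport_subset volume hV hW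
        (fun x hx => exists_hasFDerivWithinAt_janossyWeight h3 h2.contDiffOn hx) hh hcs hts
  have hcV : Continuous (prodField v n) := hV.continuous
  have hfd : Continuous fun x => fderiv ℝ f x (prodField v n x) :=
    (hf.continuous_fderiv one_ne_zero).clm_apply hcV
  have hgd : Continuous fun x => fderiv ℝ g x (prodField v n x) :=
    (hg.continuous_fderiv one_ne_zero).clm_apply hcV
  have hL := fun {u : (Fin n → Sp d) → ℝ} (hu : Continuous u) =>
    memLp_of_continuous hD h3 h2.contDiffOn c n hu
  have hadj := hint.memLp_adjCoeff hD hDS hJ h2 h3 hc (hv.of_le one_le_two) hpos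
  have hi1 : Integrable (fun x => g x * fderiv ℝ f x (prodField v n x))
      (janossyMeasure D J ρ c n) := (hL hg.continuous).integrable_mul (hL hfd)
  have hi2 : Integrable (fun x => f x * fderiv ℝ g x (prodField v n x))
      (janossyMeasure D J ρ c n) := (hL hf.continuous).integrable_mul (hL hgd)
  have hi3 : Integrable (fun x => f x * g x * adjCoeff D J ρ v n x)
      (janossyMeasure D J ρ c n) := (hL hh.continuous).integrable_mul hadj
  have h4 : ∫ x, (g x * fderiv ℝ f x (prodField v n x) + f x * fderiv ℝ g x (prodField v n x) -
      f x * g x * adjCoeff D J ρ v n x) ∂(janossyMeasure D J ρ c n) = 0 := by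
    rw [integral_janossyMeasure hD h3 h2.contDiffOn h2.pos hc hpos, ← key]
    refine integral_congr_ae ?_
    filter_upwards [ae_fderivWithin_kdet_eq_zero hD hJ h3 n,
      ae_restrict_mem (measurableSet_cube hD.measurableSet n)] with x hx hxc
    rw [derivWeight_add_eq (hv.of_le one_le_two) h2.pos hxc hx,
      fderiv_fun_mul (hf.differentiable one_ne_zero x) (hg.differentiable one_ne_zero x)]
    simp only [add_apply, smul_apply, smul_eq_mul]
    ring
  have hi12 : Integrable (fun x => g x * fderiv ℝ f x (prodField v n x) +
      f x * fderiv ℝ g x (prodField v n x)) (janossyMeasure D J ρ c n) := hi1.add hi2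
  rw [integral_sub hi12 hi3, integral_add hi1 hi2] at h4
  have h5 : ∀ x, f x * (- fderiv ℝ g x (prodField v n x) + g x * adjCoeff D J ρ v n x) =
      f x * g x * adjCoeff D J ρ v n x - f x * fderiv ℝ g x (prodField v n x) := fun x => by ring
  simp only [h5]
  rw [integral_sub hi3 hi2]
  linarith

end JanossyMeasure

/-! ### Operators on test functionals -/
section Operators

variable {d : ℕ} {D : Set (Sp d)} {m : ∀ n : ℕ, Measure (Fin n → Sp d)}
  {L L' : ∀ n : ℕ, ((Fin n → Sp d) → ℝ) → (Fin n → Sp d) → ℝ}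

/-- The functional `a F + G`. -/
def TestFunctional.combo (a : ℝ) (F G : TestFunctional d) : TestFunctional d where
  coeff n x := a * F.coeff n x + G.coeff n x
  deg := max F.deg G.deg
  smooth n := (contDiff_const.mul (F.smooth n)).add (G.smooth n)
  symm n σ x := by rw [F.symm, G.symm]
  vanish n hn := by
    funext x
    rw [F.vanish n ((le_max_left _ _).trans_lt hn), G.vanish n ((le_max_right _ _).trans_lt hn)]
    simp

/-- The zero functional. -/
def TestFunctional.zero (d : ℕ) : TestFunctional d where
  coeff _ _ := 0
  deg := 0
  smooth _ := contDiff_const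
  symm _ _ _ := rfl
  vanish _ _ := rfl

/-- The operators `L n`, on smooth functions of `n` points, are linear, preserve symmetry, and are
well-defined from `L²(m n)` to itself, with the smooth functions as domain. -/
structure IsTestOperator (m : ∀ n : ℕ, Measure (Fin n → Sp d))
    (L : ∀ n : ℕ, ((Fin n → Sp d) → ℝ) → (Fin n → Sp d) → ℝ) : Prop where
  memLp : ∀ n f, ContDiff ℝ ((⊤ : ℕ∞) : WithTop ℕ∞) f → MemLp (L n f) 2 (m n)
  symm : ∀ n f, ContDiff ℝ ((⊤ : ℕ∞) : WithTop ℕ∞) f →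
    (∀ (σ : Equiv.Perm (Fin n)) x, f (x ∘ σ) = f x) →
    ∀ σ : Equiv.Perm (Fin n), ∀ᵐ x ∂(m n), L n f (x ∘ σ) = L n f x
  combo : ∀ n f g (a : ℝ), ContDiff ℝ ((⊤ : ℕ∞) : WithTop ℕ∞) f →
    ContDiff ℝ ((⊤ : ℕ∞) : WithTop ℕ∞) g →
    L n (fun x => a * f x + g x) = fun x => a * L n f x + L n g x
  null : ∀ n f, ContDiff ℝ ((⊤ : ℕ∞) : WithTop ℕ∞) f → (∀ᵐ x ∂(m n), f x = 0) →
    ∀ᵐ x ∂(m n), L n f x = 0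

/-- The functional on configurations given by `L`. -/
noncomputable def evalOp (D : Set (Sp d))
    (L : ∀ n : ℕ, ((Fin n → Sp d) → ℝ) → (Fin n → Sp d) → ℝ) (F : TestFunctional d) :
    FinConf D → ℝ :=
  evalConf D fun n => L n (F.coeff n)

theorem TestFunctional.isAESymm (F : TestFunctional d) : IsAESymm m F.coeff :=
  fun n σ => Eventually.of_forall (F.symm n σ)

theorem IsTestOperator.isAESymm (hL : IsTestOperator m L) (F : TestFunctional d) :
    IsAESymm m fun n => L n (F.coeff n) :=
  fun n σ => hL.symm n _ (F.smooth n) (F.symm n) σ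

theorem IsTestOperator.map_zero (hL : IsTestOperator m L) (n : ℕ) : L n (fun _ => 0) = 0 := by
  have h := hL.combo n (fun _ => 0) (fun _ => 0) 1 contDiff_const contDiff_const
  simp only [mul_zero, add_zero, one_mul] at h
  funext x
  have := congrFun h x
  simp only [Pi.zero_apply]
  linarith

theorem IsTestOperator.evalOp_combo (hL : IsTestOperator m L) (a : ℝ) (F G : TestFunctional d)
    (B : FinConf D) :
    evalOp D L (F.combo a G) B = a * evalOp D L F B + evalOp D L G B := by
  have h := hL.combo B.1.card _ _ a (F.smooth B.1.card) (G.smooth B.1.card)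
  exact congrFun h B.pts

theorem IsTestOperator.evalOp_zero (hL : IsTestOperator m L) (B : FinConf D) :
    evalOp D L (TestFunctional.zero d) B = 0 :=
  congrFun (hL.map_zero B.1.card) B.pts

theorem IsTestOperator.memLp_evalOp (hL : IsTestOperator m L) (hm : IsSymmFamily D m)
    (hD : IsCompact D) (F : TestFunctional d) : MemLp (evalOp D L F) 2 (confLaw D m) :=
  hm.memLp_evalConf hD (hL.isAESymm F) (fun n => hL.memLp n _ (F.smooth n)) (N := F.deg)
    fun n hn => by rw [F.vanish n hn]; exact hL.map_zero n

/-- The graph of the operator given by `L` on the test functionals. -/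
def IsTestOperator.graph (hL : IsTestOperator m L) (D : Set (Sp d)) :
    Submodule ℝ (Lp ℝ 2 (confLaw D m) × Lp ℝ 2 (confLaw D m)) where
  carrier := {p | ∃ F : TestFunctional d, p.1 =ᵐ[confLaw D m] F.eval D ∧
    p.2 =ᵐ[confLaw D m] evalOp D L F}
  add_mem' := by
    rintro p q ⟨F, hF1, hF2⟩ ⟨G, hG1, hG2⟩
    refine ⟨F.combo 1 G, ?_, ?_⟩
    · filter_upwards [hF1, hG1, Lp.coeFn_add p.1 q.1] with B h1 h2 h3
      rw [Prod.fst_add, h3, Pi.add_apply, h1, h2]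
      exact congrArg (· + _) (one_mul _).symm
    · filter_upwards [hF2, hG2, Lp.coeFn_add p.2 q.2] with B h1 h2 h3
      rw [Prod.snd_add, h3, Pi.add_apply, h1, h2, hL.evalOp_combo, one_mul]
  zero_mem' := by
    refine ⟨TestFunctional.zero d, Lp.coeFn_zero ℝ 2 (confLaw D m), ?_⟩
    filter_upwards [Lp.coeFn_zero ℝ 2 (confLaw D m)] with B h
    rw [hL.evalOp_zero]; exact h
  smul_mem' := by
    rintro a p ⟨F, hF1, hF2⟩
    refine ⟨F.combo a (TestFunctional.zero d), ?_, ?_⟩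
    · filter_upwards [hF1, Lp.coeFn_smul a p.1] with B h1 h3
      rw [Prod.smul_fst, h3, Pi.smul_apply, h1, smul_eq_mul]
      exact (add_zero _).symm
    · filter_upwards [hF2, Lp.coeFn_smul a p.2] with B h1 h3
      rw [Prod.smul_snd, h3, Pi.smul_apply, h1, hL.evalOp_combo, hL.evalOp_zero, smul_eq_mul,
        add_zero]

/-- The operator given by `L` is well-defined on the classes of the test functionals. -/
theorem IsTestOperator.exists_isOperatorOnTests (hL : IsTestOperator m L) (hm : IsSymmFamily D m)
    (hD : IsCompact D) :
    ∃ A : Lp ℝ 2 (confLaw D m) →ₗ.[ℝ] Lp ℝ 2 (confLaw D m),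
      IsOperatorOnTests (confLaw D m) (evalOp D L) A := by
  refine ⟨(hL.graph D).toLinearPMap, fun p => ?_⟩
  rw [Submodule.toLinearPMap_graph_eq]
  · rfl
  · rintro p ⟨F, h1, h2⟩ h0
    rw [h0] at h1
    refine eq_zero_of_compPts_eq_zero hm hD fun n => ?_
    rw [Lp.eq_zero_iff_ae_eq_zero]
    have h3 : ∀ᵐ x ∂(m n), F.coeff n x = 0 := by
      filter_upwards [ae_of_ae_confLaw hD h1 n, hm.evalConf_ofPts F.isAESymm n,
        ae_of_ae_confLaw hD (Lp.coeFn_zero ℝ 2 (confLaw D m)) n] with x h4 h5 h6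
      rw [← h5, ← TestFunctional.eval, ← h4, h6]; rfl
    exact (compPts_of_ae_eq hm hD (hL.isAESymm F) n h2).trans (hL.null n _ (F.smooth n) h3)

/-- Closability, from sufficiently many functions in the domain of the adjoint on the functions of
`n` ordered points. These need not be symmetric. -/
theorem IsTestOperator.isClosable (hL : IsTestOperator m L) (hm : IsSymmFamily D m)
    (hD : IsCompact D) {A : Lp ℝ 2 (confLaw D m) →ₗ.[ℝ] Lp ℝ 2 (confLaw D m)}
    (hA : IsOperatorOnTests (confLaw D m) (evalOp D L) A)
    (hdense : ∀ (n : ℕ) (y : Lp ℝ 2 (m n)), (∀ g h : (Fin n → Sp d) → ℝ, MemLp g 2 (m n) →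
      MemLp h 2 (m n) → (∀ f, ContDiff ℝ ((⊤ : ℕ∞) : WithTop ℕ∞) f →
        ∫ x, g x * L n f x ∂(m n) = ∫ x, f x * h x ∂(m n)) → ∫ x, g x * y x ∂(m n) = 0) → y = 0) :
    A.IsClosable := by
  refine ⟨A.graph.topologicalClosure.toLinearPMap, ?_⟩
  rw [Submodule.toLinearPMap_graph_eq]
  rintro ⟨x, y⟩ hp hx
  simp only at hx ⊢
  subst hx
  refine eq_zero_of_compPts_eq_zero hm hD fun n => hdense n _ fun g h hg hh hgh => ?_
  let Λ : Lp ℝ 2 (confLaw D m) × Lp ℝ 2 (confLaw D m) → ℝ := fun p =>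
    inner ℝ (compPts hD m n p.2) hg.toLp - inner ℝ hh.toLp (compPts hD m n p.1)
  have hΛ : Continuous Λ := by
    refine Continuous.sub ?_ ?_
    · exact ((compPts hD m n).continuous.comp continuous_snd).inner continuous_const
    · exact continuous_const.inner ((compPts hD m n).continuous.comp continuous_fst)
  have h0 : ∀ p ∈ A.graph, Λ p = 0 := by
    intro p hp
    obtain ⟨F, hF1, hF2⟩ := (hA p).1 hp
    have h1 := compPts_of_ae_eq hm hD F.isAESymm n hF1
    have h2 := compPts_of_ae_eq hm hD (hL.isAESymm F) n hF2
    simp only [Λ]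
    rw [sub_eq_zero, L2.inner_def, L2.inner_def]
    refine Eq.trans (integral_congr_ae ?_) ((hgh _ (F.smooth n)).trans (integral_congr_ae ?_))
    · filter_upwards [h2, hg.coeFn_toLp] with x h3 h4
      rw [h3, h4]; simp
    · filter_upwards [h1, hh.coeFn_toLp] with x h3 h4
      rw [h3, h4]; simp
  have h1 : (inner ℝ (compPts hD m n y) hg.toLp : ℝ) -
      inner ℝ hh.toLp (compPts hD m n (0 : Lp ℝ 2 (confLaw D m))) = 0 :=
    closure_minimal (t := {p | Λ p = 0}) h0 (isClosed_eq hΛ continuous_const) hp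
  rw [(compPts hD m n).map_zero, inner_zero_right, sub_zero, L2.inner_def] at h1
  rw [← h1]
  refine integral_congr_ae ?_
  filter_upwards [hg.coeFn_toLp] with x h4
  rw [h4]; simp

/-- Duality on the test functionals extends to the closures. -/
theorem IsTestOperator.integral_closure_eq (hL : IsTestOperator m L) (hL' : IsTestOperator m L')
    (hm : IsSymmFamily D m) (hD : IsCompact D)
    {A A' : Lp ℝ 2 (confLaw D m) →ₗ.[ℝ] Lp ℝ 2 (confLaw D m)}
    (hA : IsOperatorOnTests (confLaw D m) (evalOp D L) A)
    (hA' : IsOperatorOnTests (confLaw D m) (evalOp D L') A')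
    (hcl : A.IsClosable) (hcl' : A'.IsClosable)
    (hdual : ∀ n f g, ContDiff ℝ ((⊤ : ℕ∞) : WithTop ℕ∞) f →
      ContDiff ℝ ((⊤ : ℕ∞) : WithTop ℕ∞) g →
      ∫ x, g x * L n f x ∂(m n) = ∫ x, f x * L' n g x ∂(m n))
    (F : A.closure.domain) (G : A'.closure.domain) :
    ∫ B, (G : Lp ℝ 2 (confLaw D m)) B * A.closure F B ∂(confLaw D m) =
      ∫ B, (F : Lp ℝ 2 (confLaw D m)) B * A'.closure G B ∂(confLaw D m) := by
  have h0 : ∀ p ∈ A.graph, ∀ q ∈ A'.graph, (inner ℝ p.2 q.1 : ℝ) = inner ℝ q.2 p.1 := by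
    intro p hp q hq
    obtain ⟨f, hf1, hf2⟩ := (hA p).1 hp
    obtain ⟨g, hg1, hg2⟩ := (hA' q).1 hq
    refine (hasSum_inner_compPts hD p.2 q.1).unique ?_
    convert! hasSum_inner_compPts hD q.2 p.1 using 1
    funext n
    have h1 := compPts_of_ae_eq hm hD f.isAESymm n hf1
    have h2 := compPts_of_ae_eq hm hD (hL.isAESymm f) n hf2
    have h3 := compPts_of_ae_eq hm hD g.isAESymm n hg1
    have h4 := compPts_of_ae_eq hm hD (hL'.isAESymm g) n hg2
    rw [L2.inner_def, L2.inner_def]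
    refine Eq.trans (integral_congr_ae ?_)
      ((hdual n _ _ (f.smooth n) (g.smooth n)).trans (integral_congr_ae ?_))
    · filter_upwards [h2, h3] with x h5 h6
      rw [h5, h6]; simp
    · filter_upwards [h1, h4] with x h5 h6
      rw [h5, h6]; simp
  have h1 : ∀ p ∈ A.graph.topologicalClosure, ∀ q ∈ A'.graph,
      (inner ℝ p.2 q.1 : ℝ) = inner ℝ q.2 p.1 := fun p hp q hq =>
    closure_minimal (t := {p : Lp ℝ 2 (confLaw D m) × Lp ℝ 2 (confLaw D m) |
      (inner ℝ p.2 q.1 : ℝ) = inner ℝ q.2 p.1}) (fun p hp => h0 p hp q hq)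
      (isClosed_eq (continuous_snd.inner continuous_const)
        (continuous_const.inner continuous_fst)) hp
  have h2 : ∀ p ∈ A.graph.topologicalClosure, ∀ q ∈ A'.graph.topologicalClosure,
      (inner ℝ p.2 q.1 : ℝ) = inner ℝ q.2 p.1 := fun p hp q hq =>
    closure_minimal (t := {q : Lp ℝ 2 (confLaw D m) × Lp ℝ 2 (confLaw D m) |
      (inner ℝ p.2 q.1 : ℝ) = inner ℝ q.2 p.1}) (fun q hq => h1 p hp q hq)
      (isClosed_eq (continuous_const.inner continuous_fst)
        (continuous_snd.inner continuous_const)) hq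
  have hF := A.closure.mem_graph F
  have hG := A'.closure.mem_graph G
  rw [← hcl.graph_closure_eq_closure_graph] at hF
  rw [← hcl'.graph_closure_eq_closure_graph] at hG
  have h3 := h2 _ hF _ hG
  simp only [L2.inner_def] at h3
  simpa using h3

end Operators

/-! ### The operators `∇_v` and `∇_v^*` -/
section GradientOperators

variable {d : ℕ} {S D : Set (Sp d)} {μ : Measure (Sp d)} {J : Sp d → Sp d → ℂ} {ρ : Sp d → ℝ}
  {c : ℕ → ℝ} {v : Sp d → Sp d}

/-- The operator `∇_v` on functions of `n` points. -/
noncomputable def gradOp (v : Sp d → Sp d) (n : ℕ) (f : (Fin n → Sp d) → ℝ) (x : Fin n → Sp d) :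
    ℝ :=
  fderiv ℝ f x (prodField v n x)

/-- The operator `∇_v^*` on functions of `n` points. -/
noncomputable def adjOp (D : Set (Sp d)) (J : Sp d → Sp d → ℂ) (ρ : Sp d → ℝ) (v : Sp d → Sp d)
    (n : ℕ) (f : (Fin n → Sp d) → ℝ) (x : Fin n → Sp d) : ℝ :=
  - fderiv ℝ f x (prodField v n x) + f x * adjCoeff D J ρ v n x

theorem grad_eq_evalOp : (fun F : TestFunctional d => F.grad D v) = evalOp D (gradOp v) := by
  funext F B
  exact sum_apply_single _ _

theorem gradStar_eq_evalOp :
    (fun F : TestFunctional d => F.gradStar D ρ J v) = evalOp D (adjOp D J ρ v) := by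
  funext F B
  have h : F.grad D v B = evalOp D (gradOp v) F B := congrFun (congrFun grad_eq_evalOp F) B
  simp only [TestFunctional.gradStar, h]
  rfl

/-- The law is carried by configurations with a positive determinant, and where a function
vanishes, so does its derivative at almost every point. -/
theorem ae_fderiv_eq_zero (hD : IsCompact D) (h3 : HypH3 D J)
    (hρ : ContDiffOn ℝ 1 ρ D) (hρpos : ∀ x ∈ D, 0 < ρ x) (hc : ∀ n, 0 < c n) {n : ℕ}
    {f : (Fin n → Sp d) → ℝ} (hf : ContDiff ℝ 1 f)
    (h0 : ∀ᵐ x ∂(janossyMeasure D J ρ c n), f x = 0) :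
    ∀ᵐ x ∂(janossyMeasure D J ρ c n), fderiv ℝ f x = 0 := by
  rw [ae_janossyMeasure_iff hD h3 hρ hρpos hc] at h0 ⊢
  have hs : MeasurableSet {x | f x = 0} := hf.continuous.measurable (measurableSet_singleton 0)
  have h1 := ae_fderivWithin_eq_zero_of_eq_zero volume hs (subset_univ _)
    (hf.differentiable one_ne_zero).differentiableOn fun x hx => hx
  rw [ae_restrict_iff' hs] at h1
  filter_upwards [h0, ae_restrict_of_ae h1] with x hx hx' hk
  rw [← fderivWithin_univ]
  exact hx' (hx hk)

theorem isTestOperator_gradOp (hD : IsCompact D) (h3 : HypH3 D J)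
    (hρ : ContDiffOn ℝ 1 ρ D) (hρpos : ∀ x ∈ D, 0 < ρ x) (hc : ∀ n, 0 < c n)
    (hv : ContDiff ℝ 1 v) : IsTestOperator (janossyMeasure D J ρ c) (gradOp v) where
  memLp n f hf := memLp_of_continuous hD h3 hρ c n
    ((hf.continuous_fderiv (by simp)).clm_apply (contDiff_prodField hv n).continuous)
  symm n f _ hs σ := Eventually.of_forall (fderiv_prodField_comp_perm σ (hs σ))
  combo n f g a hf hg := by
    funext x
    have hf' := hf.differentiable (by simp) x
    have hg' := hg.differentiable (by simp) x
    rw [gradOp, fderiv_fun_add (hf'.const_mul a) hg', fderiv_const_mul hf']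
    rfl
  null n f hf h0 := by
    filter_upwards [ae_fderiv_eq_zero hD h3 hρ hρpos hc (hf.of_le (by simp)) h0] with x hx
    rw [gradOp, hx]; rfl

theorem isTestOperator_adjOp (hint : IntegrabilityCondition D μ J)
    (hD : IsCompact D) (hDS : D ⊆ S) (hJ : Measurable (uncurry J)) (h2 : HypH2 S D μ ρ)
    (h3 : HypH3 D J) (hc : ∀ n, 0 < c n) (hv : ContDiff ℝ 1 v)
    (hpos : ∀ n, ∀ᵐ x ∂(volume.restrict (cube D n)), 0 ≤ kdet J n x) :
    IsTestOperator (janossyMeasure D J ρ c) (adjOp D J ρ v) where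
  memLp n f hf := by
    have hadj := hint.memLp_adjCoeff hD hDS hJ h2 h3 hc hv (hpos n)
    refine MemLp.add (MemLp.neg (memLp_of_continuous hD h3 h2.contDiffOn c n
      ((hf.continuous_fderiv (by simp)).clm_apply (contDiff_prodField hv n).continuous))) ?_
    obtain ⟨M, hM⟩ := (isCompact_cube hD n).exists_bound_of_continuousOn hf.continuous.continuousOn
    refine MemLp.of_le_mul (c := M) hadj (hf.continuous.aestronglyMeasurable.mul hadj.1) ?_
    refine (janossyMeasure_absolutelyContinuous D J ρ c n).ae_le ?_
    filter_upwards [ae_restrict_mem (measurableSet_cube hD.measurableSet n)] with x hx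
    rw [norm_mul]
    exact mul_le_mul_of_nonneg_right (hM x hx) (norm_nonneg _)
  symm n f _ hs σ := by
    refine (janossyMeasure_absolutelyContinuous D J ρ c n).ae_le ?_
    filter_upwards [ae_uniqueDiffWithinAt volume (measurableSet_cube hD.measurableSet n)] with x hx
    rw [adjOp, adjOp, fderiv_prodField_comp_perm σ (hs σ), hs, adjCoeff_comp_perm σ hx]
  combo n f g a hf hg := by
    funext x
    have hf' := hf.differentiable (by simp) x
    have hg' := hg.differentiable (by simp) x
    rw [adjOp, fderiv_fun_add (hf'.const_mul a) hg', fderiv_const_mul hf']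
    simp only [adjOp, add_apply, smul_apply, smul_eq_mul]
    ring
  null n f hf h0 := by
    filter_upwards [ae_fderiv_eq_zero hD h3 h2.contDiffOn h2.pos hc (hf.of_le (by simp)) h0, h0]
      with x hx hx'
    rw [adjOp, hx, hx']; simp

/-- Smooth functions with compact support in an open set of full measure separate the points of
the `L²` space of the law. -/
theorem eq_zero_of_integral_contDiff_mul_eq_zero (hD : IsCompact D) (h3 : HypH3 D J)
    (hρ : ContDiffOn ℝ 1 ρ D) (hρpos : ∀ x ∈ D, 0 < ρ x) (hc : ∀ n, 0 < c n) {n : ℕ}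
    (hpos : ∀ᵐ x ∂(volume.restrict (cube D n)), 0 ≤ kdet J n x) {U : Set (Fin n → Sp d)}
    (hU : IsOpen U) (hUc : ∀ᵐ x ∂(volume.restrict (cube D n)), x ∈ U)
    (y : Lp ℝ 2 (janossyMeasure D J ρ c n))
    (h : ∀ g : (Fin n → Sp d) → ℝ, ContDiff ℝ ((⊤ : ℕ∞) : WithTop ℕ∞) g → HasCompactSupport g →
      tsupport g ⊆ U → ∫ x, g x * y x ∂(janossyMeasure D J ρ c n) = 0) : y = 0 := by
  have hfin := isFiniteMeasure_janossyMeasure hD h3 hρ c n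
  have hcm := measurableSet_cube hD.measurableSet n
  have hW0 := ae_janossyWeight_nonneg hD hρpos hc hpos
  have hy : Integrable y (janossyMeasure D J ρ c n) := (Lp.memLp y).integrable one_le_two
  have hy' := (integrable_withDensity_iff_integrable_smul₀'
    (aemeasurable_janossyWeight hD h3 hρ c n).ennreal_ofReal (by simp)).1 hy
  have hWy : Integrable (fun x => janossyWeight J ρ c n x * y x) (volume.restrict (cube D n)) := by
    refine hy'.congr ?_
    filter_upwards [hW0] with x hx
    rw [ENNReal.toReal_ofReal hx, smul_eq_mul]
  have h1 := hU.ae_eq_zero_of_integral_contDiff_smul_eq_zero (μ := volume.restrict (cube D n))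
    (f := fun x => janossyWeight J ρ c n x * y x) (hWy.locallyIntegrable.locallyIntegrableOn U)
    fun g hg hgc hgU => by
      rw [← h g hg hgc hgU, integral_janossyMeasure hD h3 hρ hρpos hc hpos]
      refine integral_congr_ae (Eventually.of_forall fun x => ?_)
      simp only [smul_eq_mul]
      ring
  rw [Lp.eq_zero_iff_ae_eq_zero]
  change ∀ᵐ x ∂(janossyMeasure D J ρ c n), y x = 0
  rw [ae_janossyMeasure_iff hD h3 hρ hρpos hc]
  filter_upwards [h1, hUc, ae_restrict_mem hcm] with x hx hxU hxc hk
  have hW : 0 < janossyWeight J ρ c n x :=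
    mul_pos (mul_pos (hc n) hk) (Finset.prod_pos fun i _ => hρpos _ (hxc i))
  exact (mul_eq_zero.1 (hx hxU)).resolve_left hW.ne'

/-- If the flow preserves `D`, or `D` has a negligible boundary, integration by parts holds against
enough test functions of ordered points. -/
theorem exists_isOpen_forall_integral_eq (hint : IntegrabilityCondition D μ J)
    (hD : IsCompact D) (hDS : D ⊆ S) (hJ : Measurable (uncurry J)) (h2 : HypH2 S D μ ρ)
    (h3 : HypH3 D J) (hc : ∀ n, 0 < c n) (hv : ContDiff ℝ 2 v) {n : ℕ}
    (hpos : ∀ᵐ x ∂(volume.restrict (cube D n)), 0 ≤ kdet J n x)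
    (hcase : FlowPreserves D v ∨ volume (frontier D) = 0) :
    ∃ U : Set (Fin n → Sp d), IsOpen U ∧ (∀ᵐ x ∂(volume.restrict (cube D n)), x ∈ U) ∧
      ∀ f g : (Fin n → Sp d) → ℝ, ContDiff ℝ 1 f → ContDiff ℝ 1 g →
        HasCompactSupport (fun x => f x * g x) → tsupport (fun x => f x * g x) ⊆ U →
        ∫ x, g x * gradOp v n f x ∂(janossyMeasure D J ρ c n) =
          ∫ x, f x * adjOp D J ρ v n g x ∂(janossyMeasure D J ρ c n) := by
  rcases hcase with hfl | hfr
  · exact ⟨univ, isOpen_univ, by simp, fun f g hf hg _ _ =>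
      integral_mul_adjoint_eq hint hD hDS hJ h2 h3 hc hv hpos hf hg (Or.inl hfl)⟩
  · refine ⟨interior (cube D n), isOpen_interior, ?_, fun f g hf hg hcs hts =>
      integral_mul_adjoint_eq hint hD hDS hJ h2 h3 hc hv hpos hf hg (Or.inr ⟨hcs, hts⟩)⟩
    have h1 : ∀ᵐ x ∂(volume.restrict D), x ∈ interior D := by
      have h4 : ∀ᵐ x : Sp d, x ∉ frontier D := measure_eq_zero_iff_ae_notMem.1 hfr
      filter_upwards [ae_restrict_of_ae h4, ae_restrict_mem hD.measurableSet] with x hx hxD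
      by_contra h5
      exact hx ⟨subset_closure hxD, h5⟩
    filter_upwards [ae_restrict_cube h1 n] with x hx
    have h6 : cube D n = univ.pi fun _ => D := by ext x; simp [cube]
    rw [h6, interior_pi_set finite_univ]
    exact fun i _ => hx i

end GradientOperators
end DPP

theorem mainTheorem1 {d : ℕ} (S D : Set (Sp d)) (hS : IsOpen S) (hS' : IsConnected S)
    (hD : IsCompact D) (hDS : D ⊆ S)
    (μ : Measure (Sp d)) (hμS : μ Sᶜ = 0)
    (hμ : ∀ C : Set (Sp d), C ⊆ S → IsCompact C → μ C < ∞)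
    (K J : Sp d → Sp d → ℂ) (ρ : Sp d → ℝ)
    (h1 : HypH1 S μ K) (hJ : IsInteractionKernel D μ K J)
    (h2 : HypH2 S D μ ρ) (h3 : HypH3 D J) (hint : IntegrabilityCondition D μ J)
    {Ω : Type*} [MeasurableSpace Ω] (P : Measure Ω) [IsProbabilityMeasure P]
    (X : Ω → LocFinConf S) (hX : IsDeterminantal S μ K P X)
    (v : Sp d → Sp d) (hv : ContDiff ℝ ((⊤ : ℕ∞) : WithTop ℕ∞) v) :
    (∀ F : TestFunctional d,
      MemLp (F.eval D) 2 (lawD hD hDS P X) ∧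
      MemLp (F.grad D v) 2 (lawD hD hDS P X) ∧
      MemLp (F.gradStar D ρ J v) 2 (lawD hD hDS P X)) ∧
    ∃ A Astar : Lp ℝ 2 (lawD hD hDS P X) →ₗ.[ℝ] Lp ℝ 2 (lawD hD hDS P X),
      IsOperatorOnTests (lawD hD hDS P X) (fun F => F.grad D v) A ∧
      IsOperatorOnTests (lawD hD hDS P X) (fun G => G.gradStar D ρ J v) Astar ∧
      (FlowPreserves D v ∨ volume (frontier D) = 0 → A.IsClosable ∧ Astar.IsClosable) ∧
      (FlowPreserves D v →
        ∀ (F : A.closure.domain) (G : Astar.closure.domain),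
          ∫ B, (G : Lp ℝ 2 (lawD hD hDS P X)) B * A.closure F B ∂(lawD hD hDS P X) =
          ∫ B, (F : Lp ℝ 2 (lawD hD hDS P X)) B * Astar.closure G B ∂(lawD hD hDS P X)) := by
  obtain ⟨c, hc, hlaw, hm⟩ := exists_lawD_eq_sum hS hD hDS hμS (hμ D hDS hD) h1 hJ h2 P hX
  have hpos := fun n => (hm n).1
  have hsymm : IsSymmFamily D (janossyMeasure D J ρ c) :=
    ⟨fun n => (hm n).2.1, fun n σ => (hm n).2.2 σ⟩
  -- in terms of the Janossy measures, everything reduces to functions of ordered points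
  change lawD hD hDS P X = confLaw D (janossyMeasure D J ρ c) at hlaw
  rw [hlaw]
  have hv1 : ContDiff ℝ 1 v := hv.of_le (by simp)
  have hv2 : ContDiff ℝ 2 v := contDiff_infty.1 hv 2
  have hL := isTestOperator_gradOp (c := c) hD h3 h2.contDiffOn h2.pos hc hv1
  have hL' := isTestOperator_adjOp hint hD hDS hJ.1 h2 h3 hc hv1 hpos
  have hgrad := fun F : TestFunctional _ => congrFun (grad_eq_evalOp (D := D) (v := v)) F
  have hstar := fun F : TestFunctional _ =>
    congrFun (gradStar_eq_evalOp (D := D) (J := J) (ρ := ρ) (v := v)) F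
  rw [grad_eq_evalOp, gradStar_eq_evalOp]
  obtain ⟨A, hA⟩ := hL.exists_isOperatorOnTests hsymm hD
  obtain ⟨A', hA'⟩ := hL'.exists_isOperatorOnTests hsymm hD
  -- the smooth functions supported in an open set of full measure are in the domain of the adjoint
  have hcl : FlowPreserves D v ∨ volume (frontier D) = 0 → A.IsClosable ∧ A'.IsClosable := by
    intro hcase
    refine ⟨hL.isClosable hsymm hD hA fun n y hy => ?_,
      hL'.isClosable hsymm hD hA' fun n y hy => ?_⟩ <;>
    obtain ⟨U, hU, hUc, hibp⟩ :=
      exists_isOpen_forall_integral_eq hint hD hDS hJ.1 h2 h3 hc hv2 (hpos n) hcase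
    · refine eq_zero_of_integral_contDiff_mul_eq_zero hD h3 h2.contDiffOn h2.pos hc (hpos n) hU hUc
        y fun g hg hgc hgU => hy g (adjOp D J ρ v n g)
          (memLp_of_continuous hD h3 h2.contDiffOn c n hg.continuous) (hL'.memLp n g hg)
          fun f hf => ?_
      exact hibp f g (hf.of_le (by simp)) (hg.of_le (by simp)) hgc.mul_left
        (tsupport_mul_subset_right.trans hgU)
    · refine eq_zero_of_integral_contDiff_mul_eq_zero hD h3 h2.contDiffOn h2.pos hc (hpos n) hU hUc
        y fun g hg hgc hgU => hy g (gradOp v n g)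
          (memLp_of_continuous hD h3 h2.contDiffOn c n hg.continuous) (hL.memLp n g hg)
          fun f hf => ?_
      exact (hibp g f (hg.of_le (by simp)) (hf.of_le (by simp)) hgc.mul_right
        (tsupport_mul_subset_left.trans hgU)).symm
  refine ⟨fun F => ⟨?_, ?_, ?_⟩, A, A', hA, hA', hcl, fun hfl F G => ?_⟩
  · exact hsymm.memLp_evalConf hD F.isAESymm (fun n =>
      memLp_of_continuous hD h3 h2.contDiffOn c n (F.smooth n).continuous) F.vanish
  · rw [hgrad]
    exact hL.memLp_evalOp hsymm hD F
  · rw [hstar]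
    exact hL'.memLp_evalOp hsymm hD F
  · refine hL.integral_closure_eq hL' hsymm hD hA hA' (hcl (Or.inl hfl)).1 (hcl (Or.inl hfl)).2
      (fun n f g hf hg => ?_) F G
    exact integral_mul_adjoint_eq hint hD hDS hJ.1 h2 h3 hc hv2 (hpos n) (hf.of_le (by simp))
      (hg.of_le (by simp)) (Or.inl hfl)
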